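/- Let $\tau\in\mathbf C$ and $q=e^{-2i\pi\tau}$ with $|q|>1$; put $q_l=e^{-2i\pi\tau/l}$ for $l\ge 1$. Let $K$ be one of the fields $\mathcal M(\mathbf C)$ (functions meromorphic on $\mathbf C$), $\mathbf C(\{z\})$ (convergent Laurent series at $0$) or $\mathbf C((z))$ (formal Laurent series), with the automorphism $\sigma_q: f(z)\mapsto f(qz)$. A $q$-difference module over $K$ is a finite-dimensional $K$-vector space $M$ with a bijective $\sigma_q$-linear map $\Phi:M\to M$; its submodules are the subspaces stable under $\Phi$ and $\Phi^{-1}$, and the tensor product of $(M_1,\Phi_1)$ and $(M_2,\Phi_2)$ is $M_1\otimes_K M_2$ with $x\otimes y\mapsto\Phi_1(x)\otimes\Phi_2(y)$. The slopes of $M$ are defined as follows. For $l\ge 1$ let $K_l\supset K$ be the same kind of field in a variable $z_l$ with $z_l^l=z$, with the automorphism $f(z_l)\mapsto f(q_l z_l)$. Choose $l$ such that $K_l\otimes_K M$ has a tower of submodules with quotients of rank $1$, and write the $i$-th quotient as $K_l e_i$ with $\Phi(e_i)=a_ie_i$, $a_i\in K_l^*$; the slopes of $M$ are the rational numbers $\frac1l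 v(a_i)$, where $v$ is the $z_l$-adic valuation. For $\mu\in\mathbf Q$, let $F^{\geq\mu}(M)$ be the largest submodule of $M$ all of whose slopes are $\geq\mu$ (the sum of all the submodules with this property). Then, for all $q$-difference modules $M_1,M_2$ over $K$ and all $\mu\in\mathbf Q$, $$F^{\geq\mu}(M_1\otimes M_2)=\sum_{\mu_1+\mu_2\geq\mu}F^{\geq\mu_1}(M_1)\otimes F^{\geq\mu_2}(M_2),$$ where the sum is over $(\mu_1,\mu_2)\in\mathbf Q^2$ and the terms on the right are regarded as subspaces of $M_1\otimes_K M_2$. -/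

import Mathlib

open scoped TensorProduct Topology
open Filter

noncomputable section

namespace QDiff

/-! ## The three base fields, as subfields of the field of formal Laurent series -/

/-- The Laurent series `f` converges to `g z` for all `z ≠ 0` close to `0`. -/
def IsExpansion (f : LaurentSeries ℂ) (g : ℂ → ℂ) : Prop :=
  ∀ᶠ z in 𝓝[≠] (0 : ℂ), HasSum (fun n : ℤ => f.coeff n * z ^ n) (g z)

theorem IsExpansion.congr {f : LaurentSeries ℂ} {g g' : ℂ → ℂ} (h : IsExpansion f g)
    (hg : g =ᶠ[𝓝[≠] 0] g') : IsExpansion f g' := by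
  filter_upwards [h, hg] with z h1 h2
  rwa [← h2]

theorem isExpansion_single (n : ℤ) (c : ℂ) :
    IsExpansion (HahnSeries.single n c) (fun z => c * z ^ n) := by
  refine Eventually.of_forall fun z => ?_
  convert hasSum_single n ?_ using 1
  · simp
  · intro m hm
    simp [HahnSeries.coeff_single_of_ne hm]

theorem isExpansion_zero : IsExpansion 0 (fun _ => 0) :=
  Eventually.of_forall fun z => by simp

theorem isExpansion_one : IsExpansion 1 (fun _ => 1) := by
  simpa using isExpansion_single 0 1

theorem IsExpansion.add {f f' : LaurentSeries ℂ} {g g' : ℂ → ℂ} (h : IsExpansion f g)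
    (h' : IsExpansion f' g') : IsExpansion (f + f') (g + g') := by
  filter_upwards [h, h'] with z h1 h2
  simpa [add_mul] using h1.add h2

theorem IsExpansion.neg {f : LaurentSeries ℂ} {g : ℂ → ℂ} (h : IsExpansion f g) :
    IsExpansion (-f) (-g) := by
  filter_upwards [h] with z h1
  simpa using h1.neg

theorem hasSum_cauchy {a b : ℤ → ℂ} {s t : ℂ} (ha : HasSum a s) (hb : HasSum b t) :
    HasSum (fun x : ℤ × ℤ => a x.2 * b (x.1 - x.2)) (s * t) := by
  have hs : Summable fun x : ℤ × ℤ => a x.1 * b x.2 :=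
    summable_mul_of_summable_norm (summable_norm_iff.2 ha.summable)
      (summable_norm_iff.2 hb.summable)
  let e : ℤ × ℤ ≃ ℤ × ℤ :=
    { toFun := fun x => (x.2, x.1 - x.2)
      invFun := fun x => (x.1 + x.2, x.1)
      left_inv := fun x => by ext <;> simp
      right_inv := fun x => by ext <;> simp }
  exact e.hasSum_iff.2 (ha.mul hb hs)

theorem IsExpansion.mul {f f' : LaurentSeries ℂ} {g g' : ℂ → ℂ} (h : IsExpansion f g)
    (h' : IsExpansion f' g') : IsExpansion (f * f') (g * g') := by
  filter_upwards [h, h', self_mem_nhdsWithin] with z h1 h2 hz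
  have hz : z ≠ 0 := hz
  have hp' := hasSum_cauchy h1 h2
  have key : ∀ n : ℤ, HasSum (fun k : ℤ =>
      (f.coeff k * z ^ k) * (f'.coeff (n - k) * z ^ (n - k))) ((f * f').coeff n * z ^ n) := by
    intro n
    have h3 : ((f * f').coeff n * z ^ n) =
        ∑ k ∈ ((Finset.antidiagonal f.isPWO_support f'.isPWO_support n).image Prod.fst),
          (f.coeff k * z ^ k) * (f'.coeff (n - k) * z ^ (n - k)) := by
      rw [HahnSeries.coeff_mul, Finset.sum_image, Finset.sum_mul]
      · refine Finset.sum_congr rfl fun x hx => ?_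
        have hx' := (Finset.mem_antidiagonal.1 hx).2.2
        have hx2 : n - x.1 = x.2 := by omega
        rw [hx2, ← hx', zpow_add₀ hz]
        ring
      · intro x hx y hy hxy
        have hx' := (Finset.mem_antidiagonal.1 hx).2.2
        have hy' := (Finset.mem_antidiagonal.1 hy).2.2
        have : x.1 = y.1 := hxy
        exact Prod.ext this (by omega)
    rw [h3]
    refine hasSum_sum_of_ne_finset_zero fun k hk => ?_
    by_contra hne
    refine hk (Finset.mem_image.2 ⟨(k, n - k), Finset.mem_antidiagonal.2 ⟨?_, ?_, ?_⟩, rfl⟩)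
    · intro h0
      exact hne (by rw [h0]; ring)
    · intro h0
      exact hne (by rw [h0]; ring)
    · exact add_sub_cancel k n
  exact hp'.prod_fiberwise key

theorem IsExpansion.exists_analyticAt {f : LaurentSeries ℂ} {g : ℂ → ℂ} (h : IsExpansion f g)
    (hf : f ≠ 0) : ∃ u : ℂ → ℂ, AnalyticAt ℂ u 0 ∧ u 0 ≠ 0 ∧
      ∀ᶠ z in 𝓝[≠] (0 : ℂ), g z = z ^ f.order * u z := by
  set a : ℕ → ℂ := fun k => f.coeff (f.order + k) with ha
  have hsum : ∀ᶠ z in 𝓝[≠] (0 : ℂ),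
      HasSum (fun k : ℕ => a k * z ^ k) (z ^ (-f.order) * g z) := by
    filter_upwards [h, self_mem_nhdsWithin] with z h1 hz
    have hz : z ≠ 0 := hz
    have hinj : Function.Injective (fun k : ℕ => f.order + (k : ℤ)) := by
      intro k k' hk
      simpa using hk
    have h2 := (hinj.hasSum_iff (f := fun n : ℤ => f.coeff n * z ^ n) (a := g z) (by
      intro n hn
      rw [HahnSeries.coeff_eq_zero_of_lt_order, zero_mul]
      by_contra hlt
      exact hn ⟨(n - f.order).toNat, by simp; omega⟩)).2 h1
    have h3 := h2.mul_left (z ^ (-f.order))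
    refine (congrArg (fun F : ℕ → ℂ => HasSum F (z ^ (-f.order) * g z))
      (funext fun k => ?_)).mpr h3
    change a k * z ^ k = z ^ (-f.order) * (a k * z ^ (f.order + (k : ℤ)))
    rw [zpow_add₀ hz, zpow_neg, zpow_natCast]
    have : z ^ f.order ≠ 0 := zpow_ne_zero _ hz
    field_simp
  set u : ℂ → ℂ := fun z => ∑' k : ℕ, a k * z ^ k with hu
  have hu0 : u 0 = f.coeff f.order := by
    change ∑' k : ℕ, a k * (0 : ℂ) ^ k = f.coeff f.order
    rw [tsum_eq_single 0]
    · simp [ha]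
    · intro k hk
      rw [zero_pow hk, mul_zero]
  have hser : HasFPowerSeriesAt u (FormalMultilinearSeries.ofScalars ℂ a) 0 := by
    rw [hasFPowerSeriesAt_iff]
    have h0 : ∀ᶠ z in 𝓝 (0 : ℂ), HasSum (fun k : ℕ => a k * z ^ k) (u z) := by
      rw [eventually_nhdsWithin_iff] at hsum
      filter_upwards [hsum] with z hz
      by_cases hz0 : z = 0
      · subst hz0
        have : Summable fun k : ℕ => a k * (0 : ℂ) ^ k :=
          summable_of_ne_finset_zero (s := {0}) fun k hk => by
            simp at hk
            simp [hk]
        exact this.hasSum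
      · exact (hz hz0).summable.hasSum
    filter_upwards [h0] with z hz
    simpa [mul_comm] using hz
  refine ⟨u, hser.analyticAt, ?_, ?_⟩
  · rw [hu0]
    exact HahnSeries.coeff_order_eq_zero.not.2 hf
  · filter_upwards [hsum, self_mem_nhdsWithin] with z h1 hz
    have hz : z ≠ 0 := hz
    have : u z = z ^ (-f.order) * g z := h1.tsum_eq
    rw [this, zpow_neg]
    field_simp

theorem IsExpansion.eq_zero {f : LaurentSeries ℂ} (h : IsExpansion f (fun _ => 0)) : f = 0 := by
  by_contra hf
  obtain ⟨u, hu, hu0, hg⟩ := h.exists_analyticAt hf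
  have h1 : ∀ᶠ z in 𝓝[≠] (0 : ℂ), u z ≠ 0 :=
    (hu.continuousAt.eventually_ne hu0).filter_mono nhdsWithin_le_nhds
  obtain ⟨z, hz, hz', hz0⟩ := (hg.and (h1.and self_mem_nhdsWithin)).exists
  have hz0 : z ≠ 0 := hz0
  exact mul_ne_zero (zpow_ne_zero _ hz0) hz' hz.symm

theorem IsExpansion.meromorphicAt {f : LaurentSeries ℂ} {g : ℂ → ℂ} (h : IsExpansion f g) :
    MeromorphicAt g 0 := by
  by_cases hf : f = 0
  · subst hf
    refine (MeromorphicAt.const (0 : ℂ) 0).congr ?_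
    filter_upwards [h] with z hz
    exact HasSum.unique (by simp) hz
  · obtain ⟨u, hu, -, hg⟩ := h.exists_analyticAt hf
    refine (((MeromorphicAt.id (0 : ℂ)).zpow f.order).mul hu.meromorphicAt).congr ?_
    filter_upwards [hg] with z hz
    simp [hz]

theorem exists_isExpansion {g : ℂ → ℂ} (hg : MeromorphicAt g 0) :
    ∃ f : LaurentSeries ℂ, IsExpansion f g := by
  obtain ⟨n, u, ⟨p, hp⟩, hgu⟩ := MeromorphicAt.iff_eventuallyEq_zpow_smul_analyticAt.1 hg
  have hu : IsExpansion (HahnSeries.ofPowerSeries ℤ ℂ (PowerSeries.mk fun k => p.coeff k)) u := by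
    have h0 := (hasFPowerSeriesAt_iff.1 hp).filter_mono (nhdsWithin_le_nhds (s := {0}ᶜ))
    filter_upwards [h0] with z hz
    have hinj : Function.Injective (fun k : ℕ => (k : ℤ)) := Nat.cast_injective
    refine (hinj.hasSum_iff ?_).1 ?_
    · intro m hm
      rw [HahnSeries.ofPowerSeries_apply, HahnSeries.embDomain_of_notMem_range, zero_mul]
      simpa using hm
    · simp only [Function.comp_def, HahnSeries.ofPowerSeries_apply_coeff, PowerSeries.coeff_mk]
      simpa [mul_comm] using hz
  refine ⟨_, ((isExpansion_single n 1).mul hu).congr ?_⟩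
  filter_upwards [hgu] with z hz
  simp [hz]

theorem IsExpansion.inv {f : LaurentSeries ℂ} {g : ℂ → ℂ} (h : IsExpansion f g) :
    IsExpansion f⁻¹ g⁻¹ := by
  by_cases hf : f = 0
  · subst hf
    have h0 : g =ᶠ[𝓝[≠] 0] fun _ => 0 := by
      filter_upwards [h] with z hz
      exact hz.unique (by simp)
    rw [inv_zero]
    refine isExpansion_zero.congr ?_
    filter_upwards [h0] with z hz
    simp [hz]
  obtain ⟨f', hf'⟩ := exists_isExpansion h.meromorphicAt.inv
  obtain ⟨u, hu, hu0, hg⟩ := h.exists_analyticAt hf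
  have h1 : ∀ᶠ z in 𝓝[≠] (0 : ℂ), u z ≠ 0 :=
    (hu.continuousAt.eventually_ne hu0).filter_mono nhdsWithin_le_nhds
  have h2 : IsExpansion (f * f' + -1) (fun _ => 0) := by
    refine ((h.mul hf').add isExpansion_one.neg).congr ?_
    filter_upwards [h1, hg, self_mem_nhdsWithin] with z hz hz' hz0
    have hz0 : z ≠ 0 := hz0
    have : g z ≠ 0 := by
      rw [hz']
      exact mul_ne_zero (zpow_ne_zero _ hz0) hz
    simp [this]
  have h3 : f * f' = 1 := by
    have := h2.eq_zero
    rwa [← sub_eq_add_neg, sub_eq_zero] at this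
  rwa [inv_eq_of_mul_eq_one_right h3]

/-- `ℂ({z})`: the Laurent series that converge in some punctured disc around `0`. -/
def convergentField : Subfield (LaurentSeries ℂ) where
  carrier := {f | ∃ g : ℂ → ℂ, IsExpansion f g}
  mul_mem' := fun ⟨_, h⟩ ⟨_, h'⟩ => ⟨_, h.mul h'⟩
  one_mem' := ⟨_, isExpansion_one⟩
  add_mem' := fun ⟨_, h⟩ ⟨_, h'⟩ => ⟨_, h.add h'⟩
  zero_mem' := ⟨_, isExpansion_zero⟩
  neg_mem' := fun ⟨_, h⟩ => ⟨_, h.neg⟩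
  inv_mem' := fun _ ⟨_, h⟩ => ⟨_, h.inv⟩

/-- `𝓜(ℂ)`: the expansions at `0` of the functions that are meromorphic on the whole of `ℂ`. -/
def meromorphicField : Subfield (LaurentSeries ℂ) where
  carrier := {f | ∃ g : ℂ → ℂ, MeromorphicOn g Set.univ ∧ IsExpansion f g}
  mul_mem' := fun ⟨_, hm, h⟩ ⟨_, hm', h'⟩ => ⟨_, hm.mul hm', h.mul h'⟩
  one_mem' := ⟨_, MeromorphicOn.const 1, isExpansion_one⟩
  add_mem' := fun ⟨_, hm, h⟩ ⟨_, hm', h'⟩ => ⟨_, hm.add hm', h.add h'⟩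
  zero_mem' := ⟨_, MeromorphicOn.const 0, isExpansion_zero⟩
  neg_mem' := fun ⟨_, hm, h⟩ => ⟨_, hm.neg, h.neg⟩
  inv_mem' := fun _ ⟨_, hm, h⟩ => ⟨_, hm.inv, h.inv⟩

/-- The three possible base fields. -/
inductive BaseField
  | meromorphic
  | convergent
  | formal

/-- `𝓜(ℂ) ⊂ ℂ({z}) ⊂ ℂ((z))`. -/
def BaseField.toSubfield : BaseField → Subfield (LaurentSeries ℂ)
  | .meromorphic => meromorphicField
  | .convergent => convergentField
  | .formal => ⊤

/-- The base field `K`. -/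
abbrev BaseField.K (B : BaseField) : Type := B.toSubfield

/-! ## The automorphism `σ_q` -/

/-- `f(z) ↦ f(qz)` on formal Laurent series. -/
def dilHom (q : ℂˣ) : LaurentSeries ℂ →+* LaurentSeries ℂ where
  toFun f :=
    { coeff := fun n => (q : ℂ) ^ n * f.coeff n
      isPWO_support' := f.isPWO_support.mono fun n hn h0 => hn (by simp [h0]) }
  map_one' := by
    ext n
    by_cases hn : n = 0
    · simp [hn]
    · simp [HahnSeries.coeff_one, hn]
  map_zero' := by
    ext n
    simp
  map_add' f g := by
    ext n
    simp [mul_add]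
  map_mul' f g := by
    ext n
    simp only [HahnSeries.coeff_mul, Finset.mul_sum]
    refine Finset.sum_congr ?_ fun x hx => ?_
    · ext x
      simp only [Finset.mem_antidiagonal, HahnSeries.mem_support, ne_eq, mul_eq_zero,
        zpow_ne_zero _ q.ne_zero, false_or]
    · rw [← (Finset.mem_antidiagonal.1 hx).2.2, zpow_add₀ q.ne_zero]
      ring

@[simp]
theorem dilHom_coeff (q : ℂˣ) (f : LaurentSeries ℂ) (n : ℤ) :
    (dilHom q f).coeff n = (q : ℂ) ^ n * f.coeff n := rfl

theorem IsExpansion.dil {f : LaurentSeries ℂ} {g : ℂ → ℂ} (h : IsExpansion f g) (q : ℂˣ) :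
    IsExpansion (dilHom q f) (fun z => g (q * z)) := by
  have ht : Tendsto (fun z : ℂ => (q : ℂ) * z) (𝓝[≠] 0) (𝓝[≠] 0) := by
    refine tendsto_nhdsWithin_iff.2 ⟨?_, ?_⟩
    · have : Continuous fun z : ℂ => (q : ℂ) * z := by fun_prop
      simpa using (this.tendsto 0).mono_left nhdsWithin_le_nhds
    · filter_upwards [self_mem_nhdsWithin] with z hz
      exact mul_ne_zero q.ne_zero hz
  filter_upwards [ht.eventually h] with z hz
  convert hz using 2 with n
  rw [dilHom_coeff, mul_zpow]
  ring

theorem BaseField.dil_mem (B : BaseField) (q : ℂˣ) {f : LaurentSeries ℂ}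
    (hf : f ∈ B.toSubfield) : dilHom q f ∈ B.toSubfield := by
  cases B with
  | meromorphic =>
    obtain ⟨g, hm, h⟩ := hf
    refine ⟨_, fun z _ => ?_, h.dil q⟩
    refine (hm ((q : ℂ) * z) trivial).comp_analyticAt (f := g) (g := fun z => (q : ℂ) * z) ?_
    fun_prop
  | convergent =>
    obtain ⟨g, h⟩ := hf
    exact ⟨_, h.dil q⟩
  | formal => exact Subfield.mem_top _

/-- The automorphism `σ_q : f(z) ↦ f(qz)` of `K`. -/
def BaseField.sigma (B : BaseField) (q : ℂˣ) : B.K →+* B.K :=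
  (dilHom q).restrict B.toSubfield B.toSubfield fun _ h => B.dil_mem q h

/-! ## Ramification -/

/-- `f(z) ↦ f(z_l ^ l)` on formal Laurent series. -/
def ramHom (l : ℕ+) : LaurentSeries ℂ →+* LaurentSeries ℂ :=
  HahnSeries.embDomainRingHom (AddMonoidHom.mulLeft (l : ℤ))
    (fun a b h => by simpa using h) (fun a b => by simp)

theorem ramHom_coeff_mul (l : ℕ+) (f : LaurentSeries ℂ) (n : ℤ) :
    (ramHom l f).coeff (l * n) = f.coeff n :=
  HahnSeries.embDomain_coeff (f := ⟨⟨AddMonoidHom.mulLeft (l : ℤ), _⟩, _⟩)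

theorem ramHom_coeff_of_not_dvd (l : ℕ+) (f : LaurentSeries ℂ) {n : ℤ} (hn : ¬ (l : ℤ) ∣ n) :
    (ramHom l f).coeff n = 0 :=
  HahnSeries.embDomain_of_notMem_range (f := ⟨⟨AddMonoidHom.mulLeft (l : ℤ), _⟩, _⟩)
    (fun ⟨m, hm⟩ => hn ⟨m, hm.symm⟩)

theorem IsExpansion.ram {f : LaurentSeries ℂ} {g : ℂ → ℂ} (h : IsExpansion f g) (l : ℕ+) :
    IsExpansion (ramHom l f) (fun z => g (z ^ (l : ℕ))) := by
  have ht : Tendsto (fun z : ℂ => z ^ (l : ℕ)) (𝓝[≠] 0) (𝓝[≠] 0) := by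
    refine tendsto_nhdsWithin_iff.2 ⟨?_, ?_⟩
    · have : Continuous fun z : ℂ => z ^ (l : ℕ) := by fun_prop
      simpa using (this.tendsto 0).mono_left nhdsWithin_le_nhds
    · filter_upwards [self_mem_nhdsWithin] with z hz
      exact pow_ne_zero _ hz
  filter_upwards [ht.eventually h] with z hz
  have hinj : Function.Injective (fun n : ℤ => (l : ℤ) * n) := fun a b h => by simpa using h
  refine (hinj.hasSum_iff ?_).1 ?_
  · intro n hn
    rw [ramHom_coeff_of_not_dvd, zero_mul]
    rintro ⟨m, rfl⟩
    exact hn ⟨m, rfl⟩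
  · convert hz using 2 with n
    simp only [Function.comp, ramHom_coeff_mul, zpow_mul, zpow_natCast]

theorem BaseField.ram_mem (B : BaseField) (l : ℕ+) {f : LaurentSeries ℂ}
    (hf : f ∈ B.toSubfield) : ramHom l f ∈ B.toSubfield := by
  cases B with
  | meromorphic =>
    obtain ⟨g, hm, h⟩ := hf
    refine ⟨_, fun z _ => ?_, h.ram l⟩
    refine (hm (z ^ (l : ℕ)) trivial).comp_analyticAt (f := g) (g := fun z => z ^ (l : ℕ)) ?_
    fun_prop
  | convergent =>
    obtain ⟨g, h⟩ := hf
    exact ⟨_, h.ram l⟩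
  | formal => exact Subfield.mem_top _

/-- The ramified extension `K_l`: the field `K` in the variable `z_l`. It contains `K`
through `z = z_l ^ l`, see the algebra structure below. -/
def BaseField.Ram (B : BaseField) (_l : ℕ+) : Type := B.K

instance (B : BaseField) (l : ℕ+) : Field (B.Ram l) := inferInstanceAs (Field B.K)

instance (B : BaseField) (l : ℕ+) : Algebra B.K (B.Ram l) :=
  RingHom.toAlgebra
    ((ramHom l).restrict B.toSubfield B.toSubfield fun _ h => B.ram_mem l h : B.K →+* B.K)

/-- The `z_l`-adic valuation of a nonzero element of `K_l`. -/
def BaseField.Ram.val {B : BaseField} {l : ℕ+} (f : B.Ram l) : ℤ :=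
  ((show B.K from f) : LaurentSeries ℂ).order

/-- `f(z_l) ↦ f(q z_l)` on `K_l`. -/
def BaseField.Ram.sigma (B : BaseField) (l : ℕ+) (q : ℂˣ) : B.Ram l →+* B.Ram l :=
  B.sigma q

/-- `q = exp(-2 i π τ)`. -/
def qOf (τ : ℂ) : ℂˣ :=
  Units.mk0 (Complex.exp (-2 * Complex.I * Real.pi * τ)) (Complex.exp_ne_zero _)

/-- The compatible family of roots `q_l = exp(-2 i π τ / l)` of `q = exp(-2 i π τ)`. -/
def qRoot (τ : ℂ) (l : ℕ+) : ℂˣ := qOf (τ / (l : ℕ))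

theorem qRoot_pow (τ : ℂ) (l : ℕ+) : qRoot τ l ^ (l : ℕ) = qOf τ := by
  ext
  have hl : ((l : ℕ) : ℂ) ≠ 0 := by exact_mod_cast l.ne_zero
  simp only [qRoot, qOf, Units.val_pow_eq_pow_val, Units.val_mk0]
  rw [← Complex.exp_nat_mul]
  congr 1
  field_simp

theorem sigma_algebraMap (B : BaseField) (τ : ℂ) (l : ℕ+) (a : B.K) :
    BaseField.Ram.sigma B l (qRoot τ l) (algebraMap B.K (B.Ram l) a) =
      algebraMap B.K (B.Ram l) (B.sigma (qOf τ) a) := by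
  refine Subtype.ext ?_
  change dilHom (qRoot τ l) (ramHom l a) = ramHom l (dilHom (qOf τ) a)
  ext n
  rw [dilHom_coeff]
  by_cases hn : (l : ℤ) ∣ n
  · obtain ⟨m, rfl⟩ := hn
    rw [ramHom_coeff_mul, ramHom_coeff_mul, dilHom_coeff, zpow_mul, ← qRoot_pow τ l]
    simp
  · rw [ramHom_coeff_of_not_dvd l _ hn, ramHom_coeff_of_not_dvd l _ hn, mul_zero]

/-! ## `q`-difference modules: a finite dimensional `K`-vector space `M` with a bijective
`σ_q`-linear map `Φ : M → M` -/

section Modules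

variable {B : BaseField} {τ : ℂ} {M : Type*} [AddCommGroup M] [Module B.K M]

/-- `σ_{q_l}` on `K_l`, as a `σ_q`-linear map of `K`-vector spaces. -/
def ramSemilinear (B : BaseField) (τ : ℂ) (l : ℕ+) :
    B.Ram l →ₛₗ[B.sigma (qOf τ)] B.Ram l where
  toFun := BaseField.Ram.sigma B l (qRoot τ l)
  map_add' := map_add _
  map_smul' a x := by rw [Algebra.smul_def, Algebra.smul_def, map_mul, sigma_algebraMap]

/-- The operator `σ_{q_l} ⊗ Φ` on `M_l = K_l ⊗_K M`. -/
def ramify (l : ℕ+) (Φ : M →ₛₗ[B.sigma (qOf τ)] M) :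
    (B.Ram l ⊗[B.K] M) →ₛₗ[BaseField.Ram.sigma B l (qRoot τ l)] (B.Ram l ⊗[B.K] M) where
  toFun := TensorProduct.map (ramSemilinear B τ l) Φ
  map_add' := map_add _
  map_smul' c x := by
    induction x with
    | zero => simp
    | add x y hx hy => simp only [smul_add, map_add, hx, hy]
    | tmul a m =>
      rw [TensorProduct.smul_tmul', TensorProduct.map_tmul, TensorProduct.map_tmul,
        TensorProduct.smul_tmul']
      congr 1
      exact map_mul (BaseField.Ram.sigma B l (qRoot τ l)) c a

end Modules

/-- `N` is a submodule of the `σ`-difference module `(V, Ψ)`: a linear subspace that is stable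
under `Ψ` and `Ψ⁻¹`. -/
def IsDiffSubmodule {k V : Type*} [Field k] [AddCommGroup V] [Module k V] {σ : k →+* k}
    (Ψ : V →ₛₗ[σ] V) (N : Submodule k V) : Prop :=
  ∀ x, Ψ x ∈ N ↔ x ∈ N

/-- A dévissage of `(V, Ψ)` with quotients of rank `1`: a tower of submodules
`0 = N 0 ⊂ N 1 ⊂ ⋯ ⊂ N n = V` such that `N (i + 1) / N i` is the line generated by the class of
`e i`, on which `Ψ` is given by `Ψ (e i) = a i • e i`. -/
structure Triangularization {k V : Type*} [Field k] [AddCommGroup V] [Module k V] {σ : k →+* k}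
    (Ψ : V →ₛₗ[σ] V) where
  n : ℕ
  N : Fin (n + 1) → Submodule k V
  e : Fin n → V
  a : Fin n → k
  isDiffSubmodule : ∀ i, IsDiffSubmodule Ψ (N i)
  bot : N 0 = ⊥
  top : N (Fin.last n) = ⊤
  succ : ∀ i : Fin n, N i.succ = N i.castSucc ⊔ Submodule.span k {e i}
  notMem : ∀ i : Fin n, e i ∉ N i.castSucc
  apply_e : ∀ i : Fin n, Ψ (e i) - a i • e i ∈ N i.castSucc

section Slopes

variable {B : BaseField} {τ : ℂ} {M : Type*} [AddCommGroup M] [Module B.K M]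

/-- The set `S(M)` of slopes of `(M, Φ)`: after a ramification of level `l` that makes the module
triangularizable, they are the numbers `v(a i) / l`, where `v` is the `z_l`-adic valuation and
`Ψ e = a i • e` describes the `i`-th quotient of rank `1`. -/
def slopes (Φ : M →ₛₗ[B.sigma (qOf τ)] M) : Set ℚ :=
  {μ | ∃ (l : ℕ+) (T : Triangularization (ramify l Φ)) (i : Fin T.n),
    μ = ((T.a i).val : ℚ) / (l : ℕ)}

/-- The restriction of `Φ` to a submodule. -/
def IsDiffSubmodule.restrict {Φ : M →ₛₗ[B.sigma (qOf τ)] M} {N : Submodule B.K M}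
    (h : IsDiffSubmodule Φ N) : N →ₛₗ[B.sigma (qOf τ)] N :=
  LinearMap.restrict Φ fun x hx => (h x).2 hx

/-- `F^{≥ μ}(M)`: the largest submodule of `M` all of whose slopes are `≥ μ`, i.e. the sum of all
the submodules with this property. -/
def slopeFiltration (Φ : M →ₛₗ[B.sigma (qOf τ)] M) (μ : ℚ) : Submodule B.K M :=
  sSup {N | ∃ h : IsDiffSubmodule Φ N, ∀ ν ∈ slopes h.restrict, μ ≤ ν}

end Slopes

end QDiff

end

noncomputable section

namespace QDiff

/-! ## Solving `q`-difference equations -/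

/-! The slope filtration has a description in which slopes do not appear. Call `growth Φ μ` the
space of the `x` such that, for each linear form `φ`, the valuation of `φ (Φ^n x)` is at least `n μ
- C` for all `n`, with `C` independent of `n`. Since `σ_q` preserves valuations, this is a
submodule, and `slopeFiltration_eq_growth` identifies it with `F^{≥ μ}`. The inclusion of the
right-hand side in the left-hand side is then the additivity of valuations under products
(`tmul_mem_growth`).

The other inclusion needs adapted bases. After ramification both modules have towers with quotients
of rank 1 whose slopes do not increase from bottom to top (`exists_common_triangularization`), so
each generator `e i` lies in the growth space of its own slope. If `x` in the tensor product has a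
nonzero coefficient on some `e i ⊗ e' j` of total slope below `μ`, take such a pair `(i, j)` that is
maximal. Modulo a stable subspace, `x` is then a multiple of `e i ⊗ e' j`, and its orbit grows too
slowly (`le_ord_of_mem_growth`). Thus the growth space over `K_l` is spanned by products of
sufficiently large total slope (`mem_span_of_mem_growth`). To return to `K`, split a series in `z_l`
according to its exponents modulo `l`: the resulting maps `K_l ⊗ M → M` commute with the operators
up to constants, so they preserve growth (`sectionModule_mem_growth`).

The sorted towers are the analytic part. A Newton polygon argument makes a cyclic equation integral
with nonzero reduction. A root of least modulus of the characteristic polynomial avoids resonances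
and gives an eigenvector (`exists_eigenvector`), and induction on the dimension gives a tower
(`exists_tri`). Neighbouring quotients in the wrong order are exchanged by solving `a σ(f) - b f =
c` with `ord a < ord b` (`BaseField.exists_split`). The scalar equations are contracting for `|q| <
1`, so they are solved for the inverse operator: power series are found by recursion, converge by a
majorant, and extend to `ℂ` through the functional equation (`BaseField.exists_solution`). -/

/-- The sequence defined by a recursion of unbounded memory. -/
def recSeq (F : ∀ n : ℕ, (Fin n → ℂ) → ℂ) (n : ℕ) : ℂ :=
  F n fun i => recSeq F i
termination_by n
decreasing_by exact i.2

/-- Row `n ≥ 1` determines `g n` because its diagonal entry is not `1`. Row `0` may be resonant, so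
`g₀` is prescribed and only has to be compatible. -/
theorem exists_triangular_solution (H : ℕ → ℕ → ℂ) (e : ℕ → ℂ) (g₀ : ℂ)
    (hd : ∀ n, 1 ≤ n → H n n ≠ 1) (h0 : (1 - H 0 0) * g₀ = e 0) :
    ∃ g : ℕ → ℂ, g 0 = g₀ ∧ ∀ n, g n = ∑ j ∈ Finset.range (n + 1), H n j * g j + e n := by
  let F : ∀ n : ℕ, (Fin n → ℂ) → ℂ := fun n f =>
    if n = 0 then g₀ else (1 - H n n)⁻¹ * (e n + ∑ j : Fin n, H n j * f j)
  have hF : ∀ n, recSeq F n = F n fun i => recSeq F i := fun n => by rw [recSeq]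
  have h00 : recSeq F 0 = g₀ := by rw [hF]; simp [F]
  refine ⟨recSeq F, h00, fun n => ?_⟩
  rcases Nat.eq_zero_or_pos n with rfl | hn
  · rw [Finset.sum_range_one, h00, ← h0]; ring
  · have h1 : recSeq F n = (1 - H n n)⁻¹ *
        (e n + ∑ j ∈ Finset.range n, H n j * recSeq F j) := by
      rw [hF, Finset.sum_range]
      simp only [F, if_neg hn.ne']
    have h2 : 1 - H n n ≠ 0 := sub_ne_zero.2 (hd n hn).symm
    have h3 : (1 - H n n) * recSeq F n =
        e n + ∑ j ∈ Finset.range n, H n j * recSeq F j := by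
      rw [h1, mul_inv_cancel_left₀ h2]
    rw [Finset.sum_range_succ]
    linear_combination h3

/-- With `β = A / δ`, the recursion gives `‖g n‖ ≤ β R^n (1 + ∑_{j<n} R^{-j} ‖g j‖)`. The rate `S =
R (1 + β)` closes the induction, since `β ∑_{j<n} (1 + β)^j = (1 + β)^n - 1`. The leftover `β - D`
is nonpositive by the choice of `D`. -/
theorem triangular_solution_bound {H : ℕ → ℕ → ℂ} {e g : ℕ → ℂ} {A R δ : ℝ} (hA : 0 ≤ A)
    (hR : 0 < R) (hδ : 0 < δ) (hH : ∀ n j, j < n → ‖H n j‖ ≤ A * R ^ (n - j))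
    (he : ∀ n, ‖e n‖ ≤ A * R ^ n) (hd : ∀ n, 1 ≤ n → δ ≤ ‖1 - H n n‖)
    (hg : ∀ n, g n = ∑ j ∈ Finset.range (n + 1), H n j * g j + e n) :
    ∃ D S : ℝ, 0 < S ∧ ∀ n, ‖g n‖ ≤ D * S ^ n := by
  set β : ℝ := A / δ with hβ
  have hβ0 : 0 ≤ β := by positivity
  set D : ℝ := max β ‖g 0‖ with hD
  have hD0 : 0 ≤ D := le_max_of_le_left hβ0
  refine ⟨D, R * (1 + β), by positivity, fun n => ?_⟩
  induction n using Nat.strong_induction_on with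
  | _ n ih =>
    rcases Nat.eq_zero_or_pos n with rfl | hn
    · simp [hD]
    have h1 : (1 - H n n) * g n = e n + ∑ j ∈ Finset.range n, H n j * g j := by
      have := hg n
      rw [Finset.sum_range_succ] at this
      linear_combination this
    have h2 : δ * ‖g n‖ ≤ A * R ^ n * (1 + D * ∑ j ∈ Finset.range n, (1 + β) ^ j) := by
      calc δ * ‖g n‖ ≤ ‖1 - H n n‖ * ‖g n‖ := by
            gcongr; exact hd n hn
        _ = ‖e n + ∑ j ∈ Finset.range n, H n j * g j‖ := by rw [← norm_mul, h1]
        _ ≤ ‖e n‖ + ∑ j ∈ Finset.range n, ‖H n j‖ * ‖g j‖ := by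
            refine (norm_add_le _ _).trans ?_
            gcongr
            refine (norm_sum_le _ _).trans (le_of_eq ?_)
            simp
        _ ≤ A * R ^ n + ∑ j ∈ Finset.range n,
              A * R ^ (n - j) * (D * (R * (1 + β)) ^ j) := by
            gcongr with j hj
            · exact he n
            · exact hH n j (Finset.mem_range.1 hj)
            · exact ih j (Finset.mem_range.1 hj)
        _ = A * R ^ n * (1 + D * ∑ j ∈ Finset.range n, (1 + β) ^ j) := by
            rw [mul_add (A * R ^ n), mul_one (A * R ^ n), Finset.mul_sum, Finset.mul_sum]
            congr 1
            refine Finset.sum_congr rfl fun j hj => ?_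
            have : R ^ n = R ^ (n - j) * R ^ j := by
              rw [← pow_add, Nat.sub_add_cancel (Finset.mem_range.1 hj).le]
            rw [this, mul_pow]
            ring
    have h3 : β * ∑ j ∈ Finset.range n, (1 + β) ^ j = (1 + β) ^ n - 1 := by
      have := mul_geom_sum (1 + β) n
      simpa using this
    have h4 : ‖g n‖ ≤ β * R ^ n * (1 + D * ∑ j ∈ Finset.range n, (1 + β) ^ j) := by
      rw [hβ, div_mul_eq_mul_div, div_mul_eq_mul_div, le_div_iff₀ hδ, ← hβ]
      linarith
    calc ‖g n‖ ≤ β * R ^ n * (1 + D * ∑ j ∈ Finset.range n, (1 + β) ^ j) := h4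
      _ = R ^ n * (β + D * (β * ∑ j ∈ Finset.range n, (1 + β) ^ j)) := by ring
      _ = R ^ n * (β - D + D * (1 + β) ^ n) := by rw [h3]; ring
      _ ≤ R ^ n * (D * (1 + β) ^ n) := by
          gcongr
          have : β ≤ D := le_max_left _ _
          linarith
      _ = D * (R * (1 + β)) ^ n := by rw [mul_pow]; ring

/-- A Laurent series without polar part is a power series. -/
theorem exists_ofPowerSeries {f : LaurentSeries ℂ} (hf : ∀ n < 0, f.coeff n = 0) :
    f = HahnSeries.ofPowerSeries ℤ ℂ (PowerSeries.mk fun n => f.coeff n) := by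
  ext n
  rcases lt_or_ge n 0 with hn | hn
  · rw [hf n hn, HahnSeries.ofPowerSeries_apply, HahnSeries.embDomain_of_notMem_range]
    rintro ⟨m, hm⟩
    have : (m : ℤ) = n := hm
    omega
  · lift n to ℕ using hn
    have := HahnSeries.ofPowerSeries_apply_coeff (Γ := ℤ) (PowerSeries.mk fun n => f.coeff n) n
    rw [PowerSeries.coeff_mk] at this
    exact this.symm

theorem ofPowerSeries_coeff_of_neg (p : PowerSeries ℂ) {n : ℤ} (hn : n < 0) :
    (HahnSeries.ofPowerSeries ℤ ℂ p).coeff n = 0 := by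
  rw [HahnSeries.ofPowerSeries_apply, HahnSeries.embDomain_of_notMem_range]
  rintro ⟨m, hm⟩
  have : (m : ℤ) = n := hm
  omega

theorem ofPowerSeries_coeff_natCast (p : PowerSeries ℂ) (n : ℕ) :
    (HahnSeries.ofPowerSeries ℤ ℂ p).coeff (n : ℤ) = PowerSeries.coeff n p :=
  HahnSeries.ofPowerSeries_apply_coeff (Γ := ℤ) p n

theorem dilHom_ofPowerSeries (q : ℂˣ) (p : PowerSeries ℂ) :
    dilHom q (HahnSeries.ofPowerSeries ℤ ℂ p) =
      HahnSeries.ofPowerSeries ℤ ℂ (PowerSeries.rescale (q : ℂ) p) := by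
  ext n
  rcases lt_or_ge n 0 with hn | hn
  · rw [dilHom_coeff, ofPowerSeries_coeff_of_neg _ hn, ofPowerSeries_coeff_of_neg _ hn, mul_zero]
  · lift n to ℕ using hn
    rw [dilHom_coeff, ofPowerSeries_coeff_natCast, ofPowerSeries_coeff_natCast,
      PowerSeries.coeff_rescale, zpow_natCast]

theorem dilHom_dilHom (q q' : ℂˣ) (f : LaurentSeries ℂ) :
    dilHom q (dilHom q' f) = dilHom (q * q') f := by
  ext n
  simp only [dilHom_coeff, Units.val_mul, mul_zpow]
  ring

theorem dilHom_one (f : LaurentSeries ℂ) : dilHom 1 f = f := by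
  ext n
  simp

theorem exists_bound_of_isExpansion {f : LaurentSeries ℂ} {g : ℂ → ℂ} (h : IsExpansion f g) :
    ∃ A R : ℝ, 0 ≤ A ∧ 0 < R ∧ ∀ n : ℕ, ‖f.coeff n‖ ≤ A * R ^ n := by
  obtain ⟨z, hz, hz0⟩ := (h.and self_mem_nhdsWithin).exists
  have hz0 : z ≠ 0 := hz0
  have hz' : 0 < ‖z‖ := norm_pos_iff.2 hz0
  have hs := (summable_norm_iff.2 hz.summable)
  refine ⟨∑' n : ℤ, ‖f.coeff n * z ^ n‖, ‖z‖⁻¹, tsum_nonneg fun _ => norm_nonneg _,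
    inv_pos.2 hz', fun n => ?_⟩
  have h1 := hs.le_tsum (n : ℤ) fun _ _ => norm_nonneg _
  rw [norm_mul, zpow_natCast, norm_pow] at h1
  rw [inv_pow, ← div_eq_mul_inv, le_div_iff₀ (by positivity)]
  exact h1

theorem isExpansion_of_bound {p : ℕ → ℂ} {D S : ℝ} (hS : 0 < S)
    (hp : ∀ n, ‖p n‖ ≤ D * S ^ n) :
    ∃ g, IsExpansion (HahnSeries.ofPowerSeries ℤ ℂ (PowerSeries.mk p)) g := by
  refine ⟨fun z => ∑' n : ℕ, p n * z ^ n, ?_⟩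
  have hball : ∀ᶠ z in 𝓝[≠] (0 : ℂ), ‖z‖ < S⁻¹ := by
    refine nhdsWithin_le_nhds ?_
    filter_upwards [Metric.ball_mem_nhds (0 : ℂ) (inv_pos.2 hS)] with z hz
    simpa using hz
  filter_upwards [hball] with z hz
  have h1 : ‖z‖ * S < 1 := by
    rwa [← lt_div_iff₀ hS, one_div]
  have hsum : Summable fun n : ℕ => p n * z ^ n := by
    refine Summable.of_norm_bounded (g := fun n => D * (‖z‖ * S) ^ n) ?_ fun n => ?_
    · exact (summable_geometric_of_lt_one (by positivity) h1).mul_left D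
    · rw [norm_mul, norm_pow, mul_pow, mul_comm (‖z‖ ^ n), ← mul_assoc]
      gcongr
      exact hp n
  have hinj : Function.Injective (fun k : ℕ => (k : ℤ)) := Nat.cast_injective
  refine (hinj.hasSum_iff ?_).1 ?_
  · intro m hm
    rw [ofPowerSeries_coeff_of_neg, zero_mul]
    by_contra h
    exact hm ⟨m.toNat, by simp; omega⟩
  · simpa only [Function.comp_def, ofPowerSeries_coeff_natCast, PowerSeries.coeff_mk,
      zpow_natCast] using hsum.hasSum

/-! ### Power series solutions of scalar equations and their convergence -/

section Equation

variable {q : ℂˣ} {r : ℕ}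

theorem tendsto_sum_pow (hq : ‖(q : ℂ)‖ < 1) (c : Fin r → ℂ) :
    Tendsto (fun n : ℕ => ∑ k, c k * (q : ℂ) ^ ((k + 1 : ℕ) * n)) atTop (𝓝 0) := by
  rw [show (0 : ℂ) = ∑ k : Fin r, c k * 0 by simp]
  refine tendsto_finsetSum _ fun k _ => Tendsto.const_mul _ ?_
  simp only [pow_mul]
  refine tendsto_pow_atTop_nhds_zero_of_norm_lt_one ?_
  rw [norm_pow]
  exact pow_lt_one₀ (norm_nonneg _) hq (by simp)

/-- The quantities tend to `1` and none of them vanishes, so only finitely many matter for the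
infimum. -/
theorem exists_lower_bound (hq : ‖(q : ℂ)‖ < 1) (c : Fin r → ℂ)
    (hc : ∀ n : ℕ, 1 ≤ n → ∑ k, c k * (q : ℂ) ^ ((k + 1 : ℕ) * n) ≠ 1) :
    ∃ δ : ℝ, 0 < δ ∧ ∀ n : ℕ, 1 ≤ n → δ ≤ ‖1 - ∑ k, c k * (q : ℂ) ^ ((k + 1 : ℕ) * n)‖ := by
  have ht : Tendsto (fun n : ℕ => ‖1 - ∑ k, c k * (q : ℂ) ^ ((k + 1 : ℕ) * n)‖) atTop
      (𝓝 1) := by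
    simpa using ((tendsto_sum_pow hq c).const_sub 1).norm
  obtain ⟨N, hN⟩ := eventually_atTop.1 (ht.eventually (lt_mem_nhds (show (1 / 2 : ℝ) < 1 by norm_num)))
  have hpos : ∀ n : ℕ, 1 ≤ n → 0 < ‖1 - ∑ k, c k * (q : ℂ) ^ ((k + 1 : ℕ) * n)‖ := fun n hn =>
    norm_pos_iff.2 (sub_ne_zero.2 (hc n hn).symm)
  obtain ⟨δ, hδ, hδ'⟩ : ∃ δ : ℝ, 0 < δ ∧ ∀ n ∈ Finset.Icc 1 N,
      δ ≤ ‖1 - ∑ k, c k * (q : ℂ) ^ ((k + 1 : ℕ) * n)‖ := by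
    rcases (Finset.Icc 1 N).eq_empty_or_nonempty with h | h
    · exact ⟨1, one_pos, by simp [h]⟩
    · obtain ⟨m, hm, hmin⟩ := Finset.exists_min_image (Finset.Icc 1 N)
        (fun n : ℕ => ‖1 - ∑ k, c k * (q : ℂ) ^ ((k + 1 : ℕ) * n)‖) h
      exact ⟨_, hpos m (Finset.mem_Icc.1 hm).1, hmin⟩
  refine ⟨min δ (1 / 2), by positivity, fun n hn => ?_⟩
  rcases le_or_gt n N with h | h
  · exact (min_le_left _ _).trans (hδ' n (Finset.mem_Icc.2 ⟨hn, h⟩))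
  · exact (min_le_right _ _).trans (hN n h.le).le

/-- Comparing coefficients of `z^n` gives a triangular system whose diagonal entry is the reduced
characteristic polynomial at `q^n`; `hP` excludes resonance for `n ≥ 1`. When `|q| < 1`, the factors
`q^{(k+1) j}` have modulus at most `1` and the diagonal stays away from `1`, so convergence follows
from `triangular_solution_bound`. -/
theorem exists_formal_solution {h : Fin r → LaurentSeries ℂ}
    (hint : ∀ k, ∀ n < 0, (h k).coeff n = 0) {e : LaurentSeries ℂ}
    (he : ∀ n < 0, e.coeff n = 0) {g₀ : ℂ}
    (hP : ∀ n : ℕ, 1 ≤ n → ∑ k, (h k).coeff 0 * (q : ℂ) ^ ((k + 1 : ℕ) * n) ≠ 1)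
    (h0 : (1 - ∑ k, (h k).coeff 0) * g₀ = e.coeff 0) :
    ∃ g : LaurentSeries ℂ, (∀ n < 0, g.coeff n = 0) ∧ g.coeff 0 = g₀ ∧
      g = ∑ k, h k * dilHom (q ^ (k + 1 : ℕ)) g + e ∧
      (‖(q : ℂ)‖ < 1 → (∀ k, h k ∈ convergentField) → e ∈ convergentField →
        g ∈ convergentField) := by
  set H : ℕ → ℕ → ℂ := fun n j =>
    ∑ k, (h k).coeff ((n - j : ℕ) : ℤ) * (q : ℂ) ^ ((k + 1 : ℕ) * j) with hH
  have hHd : ∀ n, H n n = ∑ k, (h k).coeff 0 * (q : ℂ) ^ ((k + 1 : ℕ) * n) := by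
    intro n; simp [hH]
  obtain ⟨p, hp0, hp⟩ := exists_triangular_solution H (fun n => e.coeff n) g₀
    (fun n hn => by rw [hHd]; exact hP n hn) (by rw [hHd]; simpa using h0)
  refine ⟨HahnSeries.ofPowerSeries ℤ ℂ (PowerSeries.mk p),
    fun n hn => ofPowerSeries_coeff_of_neg _ hn, ?_, ?_, ?_⟩
  · have := ofPowerSeries_coeff_natCast (PowerSeries.mk p) 0
    simpa [hp0] using this
  · have key : PowerSeries.mk p = ∑ k, (PowerSeries.mk fun n => (h k).coeff n) *
        PowerSeries.rescale ((q ^ (k + 1 : ℕ) : ℂˣ) : ℂ) (PowerSeries.mk p) +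
        PowerSeries.mk fun n => e.coeff n := by
      ext n
      simp only [map_add, map_sum, PowerSeries.coeff_mk, PowerSeries.coeff_mul,
        PowerSeries.coeff_rescale]
      rw [hp n]
      congr 1
      simp only [hH, Finset.sum_mul]
      rw [Finset.sum_comm]
      refine Finset.sum_congr rfl fun k _ => ?_
      rw [Finset.Nat.sum_antidiagonal_eq_sum_range_succ (fun i j =>
        (h k).coeff (i : ℤ) * (((q ^ (k + 1 : ℕ) : ℂˣ) : ℂ) ^ j * p j)),
        ← Finset.sum_range_reflect]
      refine Finset.sum_congr rfl fun j hj => ?_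
      have hj' : j ≤ n := Nat.lt_succ_iff.1 (Finset.mem_range.1 hj)
      have e1 : n + 1 - 1 - j = n - j := by omega
      have e2 : n - (n - j) = j := by omega
      rw [e1, e2, Units.val_pow_eq_pow_val, ← pow_mul, mul_assoc]
    conv_lhs => rw [key]
    rw [map_add, map_sum, ← exists_ofPowerSeries he]
    congr 1
    refine Finset.sum_congr rfl fun k _ => ?_
    rw [map_mul, ← exists_ofPowerSeries (hint k), dilHom_ofPowerSeries]
  · intro hq hhc hec
    obtain ⟨δ, hδ, hδ'⟩ := exists_lower_bound hq (fun k => (h k).coeff 0) hP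
    choose G hG using hhc
    choose A R hA hR hAR using fun k => exists_bound_of_isExpansion (hG k)
    obtain ⟨Ge, hGe⟩ := hec
    obtain ⟨A', R', hA', hR', hAR'⟩ := exists_bound_of_isExpansion hGe
    set A₁ := A' + ∑ k, A k
    set R₁ := R' + ∑ k, R k
    have hA0 : 0 ≤ ∑ k, A k := Finset.sum_nonneg fun k _ => hA k
    have hR0 : 0 ≤ ∑ k, R k := Finset.sum_nonneg fun k _ => (hR k).le
    obtain ⟨D, S, hS, hDS⟩ := triangular_solution_bound (A := A₁) (R := R₁) (δ := δ)
      (by positivity) (by positivity) hδ (H := H) (e := fun n => e.coeff n) (g := p)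
      (by
        intro n j _
        refine (norm_sum_le _ _).trans ?_
        have : ∑ k, A k * R₁ ^ (n - j) ≤ A₁ * R₁ ^ (n - j) := by
          rw [← Finset.sum_mul]
          gcongr
          simp only [A₁]; linarith
        refine le_trans (Finset.sum_le_sum fun k _ => ?_) this
        rw [norm_mul, norm_pow]
        have h1 : ‖(q : ℂ)‖ ^ ((k + 1 : ℕ) * j) ≤ 1 := pow_le_one₀ (norm_nonneg _) hq.le
        have h2 : R k ≤ R₁ := by
          have := Finset.single_le_sum (fun k _ => (hR k).le) (Finset.mem_univ k)
          simp only [R₁]; linarith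
        calc _ ≤ A k * R k ^ (n - j) * 1 := by
              gcongr
              · exact mul_nonneg (hA k) (pow_nonneg (hR k).le _)
              · exact hAR k _
          _ ≤ A k * R₁ ^ (n - j) := by
              rw [mul_one]
              have := hA k
              have := (hR k).le
              gcongr)
      (by
        intro n
        refine (hAR' n).trans ?_
        gcongr
        · simp only [A₁]; linarith
        · simp only [R₁]; linarith)
      (fun n hn => by rw [hHd]; exact hδ' n hn) hp
    exact isExpansion_of_bound hS hDS

end Equation

theorem IsExpansion.sum {ι : Type*} (s : Finset ι) {f : ι → LaurentSeries ℂ} {g : ι → ℂ → ℂ}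
    (h : ∀ i, IsExpansion (f i) (g i)) :
    IsExpansion (∑ i ∈ s, f i) (fun z => ∑ i ∈ s, g i z) := by
  classical
  induction s using Finset.induction_on with
  | empty => simpa using isExpansion_zero
  | insert i s hi ih =>
    simp only [Finset.sum_insert hi]
    exact (h i).add ih

theorem IsExpansion.eventuallyEq {f : LaurentSeries ℂ} {g g' : ℂ → ℂ} (h : IsExpansion f g)
    (h' : IsExpansion f g') : g =ᶠ[𝓝[≠] 0] g' := by
  filter_upwards [h, h'] with z h1 h2 using h1.unique h2

/-! ### Meromorphic continuation by the functional equation -/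

section Continuation

variable {q : ℂˣ} {r : ℕ}

/-- The solution germs of a `q`-difference equation `g = ∑ h_k σ^k g + e`, `|q| < 1`, with
meromorphic coefficients extend meromorphically to `ℂ`. -/
theorem mem_meromorphicField_of_eq (hq : ‖(q : ℂ)‖ < 1) {g : LaurentSeries ℂ}
    (hg : g ∈ convergentField) {h : Fin r → LaurentSeries ℂ} (hh : ∀ k, h k ∈ meromorphicField)
    {e : LaurentSeries ℂ} (he : e ∈ meromorphicField)
    (heq : g = ∑ k, h k * dilHom (q ^ (k + 1 : ℕ)) g + e) : g ∈ meromorphicField := by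
  obtain ⟨G, hG⟩ := hg
  choose H hHm hH using hh
  obtain ⟨E, hEm, hE⟩ := he
  set op : (ℂ → ℂ) → ℂ → ℂ := fun F z => ∑ k, H k z * F ((q ^ (k + 1 : ℕ) : ℂˣ) * z) + E z
    with hop
  have hexp : ∀ F, IsExpansion g F → IsExpansion g (op F) := by
    intro F hF
    conv_lhs => rw [heq]
    exact (IsExpansion.sum Finset.univ fun k => (hH k).mul (hF.dil (q ^ (k + 1 : ℕ)))).add hE
  have hq0 : 0 < ‖(q : ℂ)‖ := norm_pos_iff.2 q.ne_zero
  obtain ⟨ρ, hρ, hρG⟩ : ∃ ρ > 0, ∀ z : ℂ, z ≠ 0 → ‖z‖ < ρ → AnalyticAt ℂ G z ∧ G z = op G z := by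
    have h1 := hG.meromorphicAt.eventually_analyticAt.and (hG.eventuallyEq (hexp G hG))
    rw [eventually_nhdsWithin_iff, Metric.eventually_nhds_iff] at h1
    obtain ⟨ρ, hρ, h1⟩ := h1
    exact ⟨ρ, hρ, fun z hz hz' => h1 (by simpa using hz') hz⟩
  -- The value of `op F` at `z` involves `F` only at the points `q^(k+1) z`, of modulus at most `|q|
  -- |z|`. Each application of `op` therefore enlarges the disc of meromorphy by the factor `1 /
  -- |q|`.
  set rad : ℕ → ℝ := fun n => ρ * (‖(q : ℂ)‖ ^ n)⁻¹ with hrad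
  have hstep : ∀ n (z : ℂ) (k : Fin r), ‖z‖ < rad (n + 1) →
      ‖((q ^ (k + 1 : ℕ) : ℂˣ) : ℂ) * z‖ < rad n := by
    intro n z k hz
    rw [norm_mul, Units.val_pow_eq_pow_val, norm_pow]
    have h1 : ‖(q : ℂ)‖ ^ (k + 1 : ℕ) ≤ ‖(q : ℂ)‖ :=
      pow_le_of_le_one hq0.le hq.le (by simp)
    calc _ ≤ ‖(q : ℂ)‖ * ‖z‖ := by gcongr
      _ < ‖(q : ℂ)‖ * rad (n + 1) := by gcongr
      _ = rad n := by
        simp only [hrad, pow_succ]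
        field_simp
  have hne : ∀ (z : ℂ) (k : Fin r), z ≠ 0 → ((q ^ (k + 1 : ℕ) : ℂˣ) : ℂ) * z ≠ 0 :=
    fun z k hz => mul_ne_zero (Units.ne_zero _) hz
  have hrad_mono : Monotone rad := by
    intro a b hab
    simp only [hrad]
    gcongr ρ * ?_
    exact inv_anti₀ (by positivity) (pow_le_pow_of_le_one hq0.le hq.le hab)
  have hiter : ∀ n (z : ℂ), z ≠ 0 → ‖z‖ < rad n → (op^[n + 1] G) z = (op^[n] G) z := by
    intro n
    induction n with
    | zero =>
      intro z hz hz'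
      exact (hρG z hz (by simpa [hrad] using hz')).2.symm
    | succ n ih =>
      intro z hz hz'
      rw [Function.iterate_succ_apply' op (n + 1)]
      conv_rhs => rw [Function.iterate_succ_apply' op n]
      change ∑ k, H k z * (op^[n + 1] G) _ + E z = ∑ k, H k z * (op^[n] G) _ + E z
      congr 1
      refine Finset.sum_congr rfl fun k _ => ?_
      rw [ih _ (hne z k hz) (hstep n z k hz')]
  have hmero : ∀ n (z : ℂ), ‖z‖ < rad n → MeromorphicAt (op^[n] G) z := by
    intro n
    induction n with
    | zero =>
      intro z hz
      by_cases hz0 : z = 0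
      · subst hz0; exact hG.meromorphicAt
      · exact (hρG z hz0 (by simpa [hrad] using hz)).1.meromorphicAt
    | succ n ih =>
      intro z hz
      rw [Function.iterate_succ_apply']
      refine MeromorphicAt.add (MeromorphicAt.fun_sum fun k _ => ?_) (hEm z trivial)
      refine (hHm k z trivial).mul ?_
      refine (ih _ (hstep n z k hz)).comp_analyticAt
        (g := fun z => ((q ^ (k + 1 : ℕ) : ℂˣ) : ℂ) * z) ?_
      fun_prop
  have hex : ∀ z : ℂ, ∃ n, ‖z‖ < rad n := by
    intro z
    obtain ⟨n, hn⟩ := exists_pow_lt_of_lt_one (show 0 < ρ / (‖z‖ + 1) by positivity) hq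
    refine ⟨n, ?_⟩
    rw [lt_div_iff₀ (by positivity)] at hn
    simp only [hrad]
    rw [← div_eq_mul_inv, lt_div_iff₀ (by positivity)]
    nlinarith [pow_pos hq0 n]
  have hle : ∀ n m (z : ℂ), n ≤ m → z ≠ 0 → ‖z‖ < rad n → (op^[m] G) z = (op^[n] G) z := by
    intro n m z hnm hz hz'
    induction m, hnm using Nat.le_induction with
    | base => rfl
    | succ m hm ih => rw [hiter m z hz (hz'.trans_le (hrad_mono hm)), ih]
  classical
  -- Gluing of the iterates: at `z`, take the first iterate whose disc contains `z`. The iterates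
  -- agree on common discs only away from `0`, which suffices for equality on punctured
  -- neighbourhoods.
  let F : ℂ → ℂ := fun z => (op^[Nat.find (hex z)] G) z
  have hF : ∀ n (z : ℂ), z ≠ 0 → ‖z‖ < rad n → F z = (op^[n] G) z := fun n z hz hz' =>
    (hle _ _ z (Nat.find_min' (hex z) hz') hz (Nat.find_spec (hex z))).symm
  have hFev : ∀ n (z : ℂ), ‖z‖ < rad n → F =ᶠ[𝓝[≠] z] op^[n] G := by
    intro n z hz
    have h1 : ∀ᶠ w in 𝓝[≠] z, ‖w‖ < rad n :=
      nhdsWithin_le_nhds (continuous_norm.continuousAt.eventually_lt continuousAt_const hz)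
    have h2 : ∀ᶠ w in 𝓝[≠] z, w ≠ 0 := by
      by_cases hz0 : z = 0
      · subst hz0; exact self_mem_nhdsWithin
      · exact nhdsWithin_le_nhds (continuousAt_id.eventually_ne hz0)
    filter_upwards [h1, h2] with w hw hw' using hF n w hw' hw
  refine ⟨F, fun z _ => ?_, ?_⟩
  · obtain ⟨n, hn⟩ := hex z
    exact (hmero n z hn).congr (hFev n z hn).symm
  · exact hG.congr (hFev 0 0 (by simpa [hrad] using hρ)).symm

/-- One formal solution serves the three fields: it converges by the majorant, and it is meromorphic
on `ℂ` when the data are. -/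
theorem BaseField.exists_solution (B : BaseField) (hq : ‖(q : ℂ)‖ < 1)
    {h : Fin r → LaurentSeries ℂ} (hh : ∀ k, h k ∈ B.toSubfield)
    (hint : ∀ k, ∀ n < 0, (h k).coeff n = 0) {e : LaurentSeries ℂ} (heB : e ∈ B.toSubfield)
    (he : ∀ n < 0, e.coeff n = 0) {g₀ : ℂ}
    (hP : ∀ n : ℕ, 1 ≤ n → ∑ k, (h k).coeff 0 * (q : ℂ) ^ ((k + 1 : ℕ) * n) ≠ 1)
    (h0 : (1 - ∑ k, (h k).coeff 0) * g₀ = e.coeff 0) :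
    ∃ g ∈ B.toSubfield, g.coeff 0 = g₀ ∧
      g = ∑ k, h k * dilHom (q ^ (k + 1 : ℕ)) g + e := by
  obtain ⟨g, -, hg0, hg, hconv⟩ := exists_formal_solution hint he hP h0
  refine ⟨g, ?_, hg0, hg⟩
  have hmc : ∀ {f}, f ∈ meromorphicField → f ∈ convergentField := fun ⟨G, _, hG⟩ => ⟨G, hG⟩
  cases B with
  | meromorphic =>
    exact mem_meromorphicField_of_eq hq (hconv hq (fun k => hmc (hh k)) (hmc heB)) hh heB hg
  | convergent => exact hconv hq hh heB
  | formal => exact Subfield.mem_top _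

end Continuation

/-! ## Sections of the ramification -/

/-- The Laurent series `∑ f_{ln+s} z^n`. -/
def section₀ (l : ℕ+) (s : ℤ) : LaurentSeries ℂ →+ LaurentSeries ℂ where
  toFun f :=
    { coeff := fun n => f.coeff (l * n + s)
      isPWO_support' := by
        have hm : StrictMono fun n : ℤ => (l : ℤ) * n + s := fun a b hab => by
          have : (0 : ℤ) < l := by exact_mod_cast l.pos
          dsimp only
          nlinarith
        refine Set.partiallyWellOrderedOn_iff_exists_lt.2 fun u hu => ?_
        obtain ⟨m, n, hmn, hle⟩ := f.isPWO_support.exists_lt (f := fun i => (l : ℤ) * u i + s)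
          fun i => hu i
        exact ⟨m, n, hmn, hm.le_iff_le.1 hle⟩ }
  map_zero' := by ext; simp
  map_add' f g := by ext; simp

@[simp]
theorem section₀_coeff (l : ℕ+) (s : ℤ) (f : LaurentSeries ℂ) (n : ℤ) :
    (section₀ l s f).coeff n = f.coeff (l * n + s) := rfl

/-- Multiplication by a series in `z_l^l` does not change exponents modulo `l`. This is the
`K`-linearity of the section maps. -/
theorem section₀_ramHom_mul (l : ℕ+) (s : ℤ) (a f : LaurentSeries ℂ) :
    section₀ l s (ramHom l a * f) = a * section₀ l s f := by
  have hl : (l : ℤ) ≠ 0 := by exact_mod_cast l.ne_zero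
  ext n
  rw [section₀_coeff, HahnSeries.coeff_mul, HahnSeries.coeff_mul]
  refine Finset.sum_nbij' (fun x => (x.1 / l, (x.2 - s) / l)) (fun x => (l * x.1, l * x.2 + s))
    ?_ ?_ ?_ ?_ ?_
  all_goals
    intro x hx
    obtain ⟨h1, h2, h3⟩ := Finset.mem_antidiagonal.1 hx
  · have hd : (l : ℤ) ∣ x.1 := by
      by_contra hd
      exact h1 (ramHom_coeff_of_not_dvd l a hd)
    obtain ⟨i, hi⟩ := hd
    have e2 : x.2 = l * (n - i) + s := by rw [hi] at h3; linear_combination h3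
    have e1 : x.1 / (l : ℤ) = i := by rw [hi, Int.mul_ediv_cancel_left _ hl]
    have e3 : (x.2 - s) / (l : ℤ) = n - i := by
      rw [e2, add_sub_cancel_right, Int.mul_ediv_cancel_left _ hl]
    rw [Finset.mem_antidiagonal, e1, e3]
    refine ⟨?_, ?_, add_sub_cancel i n⟩
    · intro h0
      exact h1 (by rw [hi, ramHom_coeff_mul]; exact h0)
    · intro h0
      exact h2 (by rw [e2]; exact h0)
  · refine Finset.mem_antidiagonal.2 ⟨?_, h2, ?_⟩
    · rw [HahnSeries.mem_support, ramHom_coeff_mul]; exact h1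
    · dsimp only; rw [← h3]; ring
  · have hd : (l : ℤ) ∣ x.1 := by
      by_contra hd
      exact h1 (ramHom_coeff_of_not_dvd l a hd)
    obtain ⟨i, hi⟩ := hd
    have e2 : x.2 = l * (n - i) + s := by rw [hi] at h3; linear_combination h3
    ext
    · dsimp only; rw [hi, Int.mul_ediv_cancel_left _ hl]
    · dsimp only; rw [e2, add_sub_cancel_right, Int.mul_ediv_cancel_left _ hl]
  · ext
    · exact Int.mul_ediv_cancel_left _ hl
    · dsimp only; rw [add_sub_cancel_right, Int.mul_ediv_cancel_left _ hl]
  · have hd : (l : ℤ) ∣ x.1 := by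
      by_contra hd
      exact h1 (ramHom_coeff_of_not_dvd l a hd)
    obtain ⟨i, hi⟩ := hd
    have e2 : x.2 = l * (n - i) + s := by rw [hi] at h3; linear_combination h3
    have e3 : (x.2 - s) / (l : ℤ) = n - i := by
      rw [e2, add_sub_cancel_right, Int.mul_ediv_cancel_left _ hl]
    dsimp only
    rw [section₀_coeff, e3, hi, Int.mul_ediv_cancel_left _ hl, ramHom_coeff_mul, e2]

theorem single_mul_coeff (s : ℤ) (f : LaurentSeries ℂ) (n : ℤ) :
    (HahnSeries.single s (1 : ℂ) * f).coeff n = f.coeff (n - s) := by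
  have := HahnSeries.coeff_single_mul_add (r := (1 : ℂ)) (x := f) (a := n - s) (b := s)
  rwa [sub_add_cancel, one_mul] at this

theorem section₀_dilHom (l : ℕ+) (s : ℤ) (q : ℂˣ) (f : LaurentSeries ℂ) :
    section₀ l s (dilHom q f) =
      HahnSeries.single 0 ((q : ℂ) ^ s) * dilHom (q ^ (l : ℕ)) (section₀ l s f) := by
  ext n
  have := HahnSeries.coeff_single_zero_mul (r := (q : ℂ) ^ s)
    (x := dilHom (q ^ (l : ℕ)) (section₀ l s f)) (a := n)
  rw [this, section₀_coeff, dilHom_coeff, dilHom_coeff, section₀_coeff, zpow_add₀ q.ne_zero,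
    zpow_mul, Units.val_pow_eq_pow_val, zpow_natCast]
  ring

theorem sum_section₀ (l : ℕ+) (f : LaurentSeries ℂ) :
    ∑ s : Fin l, HahnSeries.single (s : ℤ) (1 : ℂ) * ramHom l (section₀ l s f) = f := by
  have hl : (0 : ℤ) < l := by exact_mod_cast l.pos
  ext n
  rw [HahnSeries.coeff_sum]
  have hmod := Int.emod_nonneg n hl.ne'
  have hmod' := Int.emod_lt_of_pos n hl
  have h0 : (n % l).toNat < (l : ℕ) := by omega
  rw [Finset.sum_eq_single (⟨(n % l).toNat, h0⟩ : Fin l)]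
  · rw [single_mul_coeff]
    have e1 : n - (((⟨(n % l).toNat, h0⟩ : Fin l) : ℕ) : ℤ) = l * (n / l) := by
      have := Int.mul_ediv_add_emod n l
      simp only [Int.toNat_of_nonneg hmod]
      linarith
    rw [e1, ramHom_coeff_mul, section₀_coeff]
    congr 1
    linarith
  · intro s _ hs
    rw [single_mul_coeff, ramHom_coeff_of_not_dvd]
    rintro ⟨m, hm⟩
    apply hs
    ext
    have h1 : n = s + l * m := by linarith
    have h2 : n % l = s := by
      rw [h1, Int.add_mul_emod_self_left]
      exact Int.emod_eq_of_lt (by positivity) (by have := s.2; exact_mod_cast this)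
    simp only [h2, Int.toNat_natCast]
  · simp

/-! ### Sections as averages over the `l`-th roots -/

theorem sum_nthRoots_zpow (l : ℕ+) (n : ℤ) :
    ∑ ξ ∈ Polynomial.nthRootsFinset l (1 : ℂ), ξ ^ n = if (l : ℤ) ∣ n then (l : ℂ) else 0 := by
  have hprim := Complex.isPrimitiveRoot_exp l l.ne_zero
  have hmem : ∀ {ξ : ℂ}, ξ ∈ Polynomial.nthRootsFinset l (1 : ℂ) ↔ ξ ^ (l : ℕ) = 1 :=
    Polynomial.mem_nthRootsFinset l.pos _
  split_ifs with hn
  · obtain ⟨m, rfl⟩ := hn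
    rw [Finset.sum_congr rfl (g := fun _ => (1 : ℂ))]
    · rw [Finset.sum_const, hprim.card_nthRootsFinset, nsmul_eq_mul, mul_one]
    · intro ξ hξ
      rw [zpow_mul, zpow_natCast, hmem.1 hξ, one_zpow]
  · set ζ := Complex.exp (2 * Real.pi * Complex.I / l)
    have hζ0 : ζ ≠ 0 := Complex.exp_ne_zero _
    have hζ : ζ ^ n ≠ 1 := fun h => hn ((hprim.zpow_eq_one_iff_dvd n).1 h)
    have h1 : ∑ ξ ∈ Polynomial.nthRootsFinset l (1 : ℂ), ξ ^ n =
        ζ ^ n * ∑ ξ ∈ Polynomial.nthRootsFinset l (1 : ℂ), ξ ^ n := by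
      rw [Finset.mul_sum]
      refine Finset.sum_nbij' (fun ξ => ζ⁻¹ * ξ) (fun ξ => ζ * ξ) ?_ ?_ ?_ ?_ ?_
      · intro ξ hξ
        rw [hmem, mul_pow, inv_pow, hprim.pow_eq_one, hmem.1 hξ]; simp
      · intro ξ hξ
        rw [hmem, mul_pow, hprim.pow_eq_one, hmem.1 hξ]; simp
      · intro ξ _; exact mul_inv_cancel_left₀ hζ0 ξ
      · intro ξ _; exact inv_mul_cancel_left₀ hζ0 ξ
      · intro ξ _
        rw [← mul_zpow, mul_inv_cancel_left₀ hζ0]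
    have h2 : (1 - ζ ^ n) * ∑ ξ ∈ Polynomial.nthRootsFinset l (1 : ℂ), ξ ^ n = 0 := by
      rw [sub_mul, one_mul]; exact sub_eq_zero.2 h1
    exact (mul_eq_zero.1 h2).resolve_left (sub_ne_zero.2 hζ.symm)

/-- The mean of `F` over the `l`-th roots of `w`. -/
def rootMean (l : ℕ+) (F : ℂ → ℂ) (w : ℂ) : ℂ :=
  (l : ℂ)⁻¹ * ∑ ξ ∈ Polynomial.nthRootsFinset l (1 : ℂ), F (ξ * w ^ ((l : ℂ)⁻¹))

/-- Changing the chosen root of `w` permutes the terms of the mean, so the principal branch in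
`rootMean` can be replaced by any other. -/
theorem rootMean_eq (l : ℕ+) (F : ℂ → ℂ) {w u : ℂ} (hw : w ≠ 0) (hu : u ^ (l : ℕ) = w) :
    rootMean l F w =
      (l : ℂ)⁻¹ * ∑ ξ ∈ Polynomial.nthRootsFinset l (1 : ℂ), F (ξ * u) := by
  have hmem : ∀ {ξ : ℂ}, ξ ∈ Polynomial.nthRootsFinset l (1 : ℂ) ↔ ξ ^ (l : ℕ) = 1 :=
    Polynomial.mem_nthRootsFinset l.pos _
  set v := w ^ ((l : ℂ)⁻¹) with hv
  have hvl : v ^ (l : ℕ) = w := by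
    rw [hv]; exact Complex.cpow_nat_inv_pow w l.ne_zero
  have hu0 : u ≠ 0 := by rintro rfl; exact hw (by rw [← hu, zero_pow l.ne_zero])
  have hv0 : v ≠ 0 := by intro h; exact hw (by rw [← hvl, h, zero_pow l.ne_zero])
  rw [rootMean]
  congr 1
  refine Finset.sum_nbij' (fun ξ => ξ * v / u) (fun ξ => ξ * u / v) ?_ ?_ ?_ ?_ ?_
  · intro ξ hξ
    rw [hmem, div_pow, mul_pow, hmem.1 hξ, hu, hvl, one_mul, div_self hw]
  · intro ξ hξ
    rw [hmem, div_pow, mul_pow, hmem.1 hξ, hu, hvl, one_mul, div_self hw]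
  · intro ξ _; field_simp
  · intro ξ _; field_simp
  · intro ξ _; rw [div_mul_cancel₀ _ hu0]

/-- The average over `ξ^l = 1` kills every exponent not divisible by `l`. The remaining terms are
powers of `w`, so no branch is visible in the result. -/
theorem IsExpansion.rootMean {f : LaurentSeries ℂ} {F : ℂ → ℂ} (h : IsExpansion f F) (l : ℕ+) :
    IsExpansion (section₀ l 0 f) (rootMean l F) := by
  have hl : (l : ℂ) ≠ 0 := by exact_mod_cast l.ne_zero
  have ht : Tendsto (fun w : ℂ => w ^ ((l : ℂ)⁻¹)) (𝓝[≠] 0) (𝓝[≠] 0) := by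
    have hpos : 0 < ((l : ℂ)⁻¹).re := by
      have : ((l : ℂ)⁻¹) = (((l : ℝ)⁻¹ : ℝ) : ℂ) := by push_cast; rfl
      rw [this, Complex.ofReal_re]
      have : (0 : ℝ) < (l : ℕ) := by exact_mod_cast l.pos
      positivity
    refine tendsto_nhdsWithin_iff.2 ⟨?_, ?_⟩
    · have := (Complex.continuousAt_cpow_zero_of_re_pos hpos).comp
        (f := fun w : ℂ => (w, ((l : ℂ)⁻¹))) (x := 0) (by fun_prop)
      have h2 := this.tendsto
      simp only [Function.comp_def, Complex.zero_cpow (inv_ne_zero hl)] at h2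
      exact h2.mono_left nhdsWithin_le_nhds
    · filter_upwards [self_mem_nhdsWithin] with w hw
      intro h0
      exact hw (by
        have := Complex.cpow_nat_inv_pow w l.ne_zero
        rw [← this, h0, zero_pow l.ne_zero]; rfl)
  have h' : ∀ ξ ∈ Polynomial.nthRootsFinset l (1 : ℂ), ∀ᶠ w in 𝓝[≠] (0 : ℂ),
      HasSum (fun n : ℤ => f.coeff n * (ξ * w ^ ((l : ℂ)⁻¹)) ^ n) (F (ξ * w ^ ((l : ℂ)⁻¹))) := by
    intro ξ hξ
    have hξ1 : ξ ^ (l : ℕ) = 1 := (Polynomial.mem_nthRootsFinset l.pos _).1 hξ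
    have hξ0 : ξ ≠ 0 := by rintro rfl; simp [zero_pow l.ne_zero] at hξ1
    have ht' : Tendsto (fun z : ℂ => ξ * z) (𝓝[≠] 0) (𝓝[≠] 0) := by
      refine tendsto_nhdsWithin_iff.2 ⟨?_, ?_⟩
      · have : Continuous fun z : ℂ => ξ * z := by fun_prop
        simpa using (this.tendsto 0).mono_left nhdsWithin_le_nhds
      · filter_upwards [self_mem_nhdsWithin] with z hz
        exact mul_ne_zero hξ0 hz
    exact (ht'.comp ht).eventually h
  have hall := (eventually_all_finset _).2 h'
  filter_upwards [hall] with w hw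
  have hsum := (hasSum_sum hw).mul_left (l : ℂ)⁻¹
  have hinj : Function.Injective (fun n : ℤ => (l : ℤ) * n) := fun a b h => by simpa using h
  have hwl : (w ^ ((l : ℂ)⁻¹)) ^ (l : ℕ) = w := Complex.cpow_nat_inv_pow w l.ne_zero
  have hterm : ∀ n : ℤ, (l : ℂ)⁻¹ * ∑ ξ ∈ Polynomial.nthRootsFinset l (1 : ℂ),
      f.coeff n * (ξ * w ^ ((l : ℂ)⁻¹)) ^ n =
      if (l : ℤ) ∣ n then f.coeff n * (w ^ ((l : ℂ)⁻¹)) ^ n else 0 := by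
    intro n
    have : ∑ ξ ∈ Polynomial.nthRootsFinset l (1 : ℂ), f.coeff n * (ξ * w ^ ((l : ℂ)⁻¹)) ^ n =
        (f.coeff n * (w ^ ((l : ℂ)⁻¹)) ^ n) *
          ∑ ξ ∈ Polynomial.nthRootsFinset l (1 : ℂ), ξ ^ n := by
      rw [Finset.mul_sum]
      refine Finset.sum_congr rfl fun ξ _ => ?_
      rw [mul_zpow]; ring
    rw [this, sum_nthRoots_zpow]
    split_ifs
    · field_simp
    · simp
  simp only [hterm] at hsum
  have h2 := (hinj.hasSum_iff (by
    intro n hn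
    rw [if_neg]
    rintro ⟨m, rfl⟩
    exact hn ⟨m, rfl⟩)).2 hsum
  refine (congrArg (fun T : ℤ → ℂ => HasSum T (QDiff.rootMean l F w)) (funext fun n => ?_)).mpr h2
  rw [Function.comp_apply, if_pos (dvd_mul_right _ _), section₀_coeff, add_zero, zpow_mul,
    zpow_natCast, hwl]

theorem MeromorphicAt.rootMean_of_ne_zero {F : ℂ → ℂ} (hF : MeromorphicOn F Set.univ) (l : ℕ+)
    {w₀ : ℂ} (hw₀ : w₀ ≠ 0) : MeromorphicAt (rootMean l F) w₀ := by
  have hl : (l : ℂ) ≠ 0 := by exact_mod_cast l.ne_zero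
  set c := w₀ ^ ((l : ℂ)⁻¹)
  have hc : c ^ (l : ℕ) = w₀ := Complex.cpow_nat_inv_pow w₀ l.ne_zero
  -- A branch of the `l`-th root that is analytic at `w₀`, even where the principal branch is cut:
  -- `w / w₀` is close to `1`.
  set r : ℂ → ℂ := fun w => c * (w / w₀) ^ ((l : ℂ)⁻¹) with hr
  have hrl : ∀ w, r w ^ (l : ℕ) = w := by
    intro w
    rw [hr]
    dsimp only
    rw [mul_pow, hc, Complex.cpow_nat_inv_pow _ l.ne_zero, mul_div_cancel₀ _ hw₀]
  have hra : AnalyticAt ℂ r w₀ := by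
    refine analyticAt_const.mul (AnalyticAt.cpow ?_ analyticAt_const ?_)
    · exact analyticAt_id.div analyticAt_const hw₀
    · simp [div_self hw₀]
  have h1 : MeromorphicAt (fun w => (l : ℂ)⁻¹ *
      ∑ ξ ∈ Polynomial.nthRootsFinset l (1 : ℂ), F (ξ * r w)) w₀ := by
    refine (MeromorphicAt.const _ _).mul (MeromorphicAt.fun_sum fun ξ _ => ?_)
    exact (hF (ξ * r w₀) trivial).comp_analyticAt (g := fun w => ξ * r w)
      (analyticAt_const.mul hra)
  refine h1.congr (nhdsWithin_le_nhds ?_)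
  filter_upwards [continuousAt_id.eventually_ne hw₀] with w hw
  exact (rootMean_eq l F hw (hrl w)).symm

theorem BaseField.single_mem (B : BaseField) (n : ℤ) (c : ℂ) :
    HahnSeries.single n c ∈ B.toSubfield := by
  cases B with
  | meromorphic =>
    refine ⟨_, fun z _ => ?_, isExpansion_single n c⟩
    exact (MeromorphicAt.const c z).mul ((MeromorphicAt.id z).zpow n)
  | convergent => exact ⟨_, isExpansion_single n c⟩
  | formal => exact Subfield.mem_top _

theorem section₀_eq (l : ℕ+) (s : ℤ) (f : LaurentSeries ℂ) :
    section₀ l s f = section₀ l 0 (HahnSeries.single (-s) (1 : ℂ) * f) := by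
  ext n
  rw [section₀_coeff, section₀_coeff, single_mul_coeff]
  congr 1
  ring

theorem BaseField.section₀_mem (B : BaseField) (l : ℕ+) (s : ℤ) {f : LaurentSeries ℂ}
    (hf : f ∈ B.toSubfield) : section₀ l s f ∈ B.toSubfield := by
  rw [section₀_eq]
  have hf' := B.toSubfield.mul_mem (B.single_mem (-s) 1) hf
  generalize HahnSeries.single (-s) (1 : ℂ) * f = f' at hf'
  cases B with
  | meromorphic =>
    obtain ⟨F, hm, h⟩ := hf'
    refine ⟨_, fun z _ => ?_, h.rootMean l⟩
    by_cases hz : z = 0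
    · subst hz; exact (h.rootMean l).meromorphicAt
    · exact MeromorphicAt.rootMean_of_ne_zero hm l hz
  | convergent =>
    obtain ⟨F, h⟩ := hf'
    exact ⟨_, h.rootMean l⟩
  | formal => exact Subfield.mem_top _

/-! ## Valuations and growth of orbits -/

/-- A field of Laurent series. -/
class SeriesField (k : Type*) [Field k] where
  ser : k →+* LaurentSeries ℂ

instance (B : BaseField) : SeriesField B.K := ⟨B.toSubfield.subtype⟩

instance (B : BaseField) (l : ℕ+) : SeriesField (B.Ram l) := ⟨B.toSubfield.subtype⟩

/-- An endomorphism of a field of Laurent series that preserves the supports. -/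
class Isometric {k : Type*} [Field k] [SeriesField k] (σ : k →+* k) : Prop where
  coeff_eq_zero_iff : ∀ f n,
    (SeriesField.ser (σ f)).coeff n = 0 ↔ (SeriesField.ser f).coeff n = 0

theorem dilHom_coeff_eq_zero_iff (q : ℂˣ) (f : LaurentSeries ℂ) (n : ℤ) :
    (dilHom q f).coeff n = 0 ↔ f.coeff n = 0 := by
  rw [dilHom_coeff, mul_eq_zero, or_iff_right (zpow_ne_zero _ q.ne_zero)]

instance (B : BaseField) (q : ℂˣ) : Isometric (B.sigma q) :=
  ⟨fun f n => dilHom_coeff_eq_zero_iff q f n⟩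

instance (B : BaseField) (l : ℕ+) (q : ℂˣ) : Isometric (BaseField.Ram.sigma B l q) :=
  ⟨fun _ n => dilHom_coeff_eq_zero_iff q _ n⟩

section Iterate

variable {k : Type*} [Field k] {σ : k →+* k}

theorem iterate_ne_zero (σ : k →+* k) {f : k} (hf : f ≠ 0) (n : ℕ) : σ^[n] f ≠ 0 := by
  induction n with
  | zero => exact hf
  | succ n ih =>
    rw [Function.iterate_succ_apply']
    exact (map_ne_zero σ).2 ih

variable {V W : Type*} [AddCommGroup V] [Module k V] [AddCommGroup W] [Module k W]
  (Ψ : V →ₛₗ[σ] V) (Ψ' : W →ₛₗ[σ] W)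

theorem iterate_semilinear_smul (n : ℕ) (c : k) (x : V) : Ψ^[n] (c • x) = σ^[n] c • Ψ^[n] x := by
  induction n with
  | zero => rfl
  | succ n ih =>
    rw [Function.iterate_succ_apply', ih, LinearMap.map_smulₛₗ, ← Function.iterate_succ_apply' σ,
      ← Function.iterate_succ_apply' Ψ]

theorem iterate_map_tmul (n : ℕ) (x : V) (y : W) :
    (TensorProduct.map Ψ Ψ')^[n] (x ⊗ₜ[k] y) = (Ψ^[n] x) ⊗ₜ[k] (Ψ'^[n] y) := by
  induction n with
  | zero => rfl
  | succ n ih => simp only [Function.iterate_succ_apply', ih, TensorProduct.map_tmul]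

end Iterate

/-! ### Lower bounds for valuations -/

section Valuation

variable {k : Type*} [Field k] [SeriesField k]

/-- The valuation of `f` is at least `t`. -/
def ValGE (f : k) (t : ℚ) : Prop :=
  ∀ n : ℤ, (n : ℚ) < t → (SeriesField.ser f).coeff n = 0

/-- The valuation of a nonzero element. -/
def ord (f : k) : ℤ := (SeriesField.ser f).order

theorem ValGE.mono {f : k} {t t' : ℚ} (h : ValGE f t) (ht : t' ≤ t) : ValGE f t' :=
  fun n hn => h n (hn.trans_le ht)

theorem valGE_zero (t : ℚ) : ValGE (0 : k) t := fun n _ => by simp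

theorem ValGE.add {f g : k} {t : ℚ} (hf : ValGE f t) (hg : ValGE g t) : ValGE (f + g) t :=
  fun n hn => by simp [hf n hn, hg n hn]

theorem ValGE.sum {ι : Type*} (s : Finset ι) {f : ι → k} {t : ℚ} (hf : ∀ i ∈ s, ValGE (f i) t) :
    ValGE (∑ i ∈ s, f i) t := by
  classical
  induction s using Finset.induction_on with
  | empty => simpa using valGE_zero t
  | insert i s hi ih =>
    rw [Finset.sum_insert hi]
    exact (hf i (Finset.mem_insert_self _ _)).add
      (ih fun j hj => hf j (Finset.mem_insert_of_mem hj))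

theorem ValGE.mul {f g : k} {t t' : ℚ} (hf : ValGE f t) (hg : ValGE g t') :
    ValGE (f * g) (t + t') := by
  intro n hn
  rw [map_mul, HahnSeries.coeff_mul]
  refine Finset.sum_eq_zero fun x hx => ?_
  have hx' := (Finset.mem_antidiagonal.1 hx).2.2
  rcases lt_or_ge (x.1 : ℚ) t with h | h
  · rw [hf _ h, zero_mul]
  · rw [hg x.2, mul_zero]
    have : (x.1 : ℚ) + x.2 = n := by exact_mod_cast hx'
    linarith

theorem ser_ne_zero {f : k} (hf : f ≠ 0) : SeriesField.ser f ≠ 0 :=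
  (map_ne_zero _).2 hf

theorem valGE_iff {f : k} (hf : f ≠ 0) (t : ℚ) : ValGE f t ↔ t ≤ ord f := by
  constructor
  · intro h
    by_contra hlt
    exact HahnSeries.coeff_order_eq_zero.not.2 (ser_ne_zero hf) (h _ (not_le.1 hlt))
  · intro h n hn
    refine HahnSeries.coeff_eq_zero_of_lt_order ?_
    exact_mod_cast hn.trans_le h

/-- True for `f = 0` too, where `ord` takes the default value `0`. Constants built from `ord` thus
need no case distinction. -/
theorem valGE_ord (f : k) : ValGE f (ord f) := fun n hn =>
  HahnSeries.coeff_eq_zero_of_lt_order (by exact_mod_cast hn)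

theorem ord_mul {f g : k} (hf : f ≠ 0) (hg : g ≠ 0) : ord (f * g) = ord f + ord g := by
  rw [ord, map_mul, HahnSeries.order_mul (ser_ne_zero hf) (ser_ne_zero hg)]; rfl

theorem ord_inv {f : k} (hf : f ≠ 0) : ord f⁻¹ = -ord f := by
  have h := ord_mul hf (inv_ne_zero hf)
  rw [mul_inv_cancel₀ hf, ord, map_one, HahnSeries.order_one] at h
  omega

variable (σ : k →+* k) [Isometric σ]

theorem valGE_map_iff {f : k} {t : ℚ} : ValGE (σ f) t ↔ ValGE f t :=
  forall₂_congr fun n _ => Isometric.coeff_eq_zero_iff f n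

theorem valGE_iterate_iff {f : k} {t : ℚ} (n : ℕ) : ValGE (σ^[n] f) t ↔ ValGE f t := by
  induction n with
  | zero => rfl
  | succ n ih => rw [Function.iterate_succ_apply', valGE_map_iff, ih]

theorem ord_map {f : k} (hf : f ≠ 0) : ord (σ f) = ord f := by
  have h0 : σ f ≠ 0 := (map_ne_zero σ).2 hf
  refine le_antisymm ?_ ?_
  · have := (valGE_iff hf (ord (σ f))).1 ((valGE_map_iff σ).1 (valGE_ord _))
    exact_mod_cast this
  · have := (valGE_iff h0 (ord f)).1 ((valGE_map_iff σ).2 (valGE_ord _))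
    exact_mod_cast this

theorem ord_iterate {f : k} (hf : f ≠ 0) (n : ℕ) : ord (σ^[n] f) = ord f := by
  induction n with
  | zero => rfl
  | succ n ih =>
    rw [Function.iterate_succ_apply', ord_map σ (iterate_ne_zero σ hf n), ih]

end Valuation

/-! ### The growth filtration -/

section Growth

variable {k : Type*} [Field k] [SeriesField k] {σ : k →+* k}
  {V : Type*} [AddCommGroup V] [Module k V] (Ψ : V →ₛₗ[σ] V)

variable [Isometric σ]

/-- The vectors `x` such that the valuation of `Ψ^n x` grows at least like `n μ`. -/
def growth (μ : ℚ) : Submodule k V where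
  carrier := {x | ∀ φ : V →ₗ[k] k, ∃ C : ℚ, ∀ n : ℕ, ValGE (φ (Ψ^[n] x)) (n * μ - C)}
  zero_mem' := fun φ => ⟨0, fun n => by
    rw [iterate_map_zero, map_zero]; exact valGE_zero _⟩
  add_mem' := by
    intro x y hx hy φ
    obtain ⟨C, hC⟩ := hx φ
    obtain ⟨C', hC'⟩ := hy φ
    refine ⟨max C C', fun n => ?_⟩
    rw [iterate_map_add, map_add]
    exact ((hC n).mono (by linarith [le_max_left C C'])).add
      ((hC' n).mono (by linarith [le_max_right C C']))
  smul_mem' := by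
    intro c x hx φ
    obtain ⟨C, hC⟩ := hx φ
    refine ⟨C - ord c, fun n => ?_⟩
    rw [iterate_semilinear_smul, map_smul, smul_eq_mul]
    exact (((valGE_iterate_iff σ n).2 (valGE_ord c)).mul (hC n)).mono (by linarith)

variable {Ψ}

theorem growth_anti {μ μ' : ℚ} (h : μ ≤ μ') : growth Ψ μ' ≤ growth Ψ μ := by
  intro x hx φ
  obtain ⟨C, hC⟩ := hx φ
  refine ⟨C, fun n => (hC n).mono ?_⟩
  have : (n : ℚ) * μ ≤ n * μ' := by gcongr
  linarith

theorem isDiffSubmodule_growth (μ : ℚ) : IsDiffSubmodule Ψ (growth Ψ μ) := by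
  intro x
  constructor
  · intro h φ
    obtain ⟨C, hC⟩ := h φ
    -- The orbit of `Ψ x` is that of `x` shifted by one: `C + μ` absorbs the shift, and `-ord (φ x)`
    -- handles the missing term `n = 0`.
    refine ⟨max (C + μ) (-ord (φ x)), fun n => ?_⟩
    rcases n with _ | n
    · refine (valGE_ord (φ x)).mono ?_
      have := le_max_right (C + μ) (-ord (φ x))
      push_cast
      linarith
    · rw [Function.iterate_succ_apply]
      refine (hC n).mono ?_
      have := le_max_left (C + μ) (-ord (φ x))
      push_cast
      linarith
  · intro h φ
    obtain ⟨C, hC⟩ := h φ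
    refine ⟨C - μ, fun n => ?_⟩
    rw [← Function.iterate_succ_apply]
    refine (hC (n + 1)).mono ?_
    push_cast
    linarith

/-- A morphism of difference modules maps `growth` into `growth`. -/
theorem map_mem_growth {W : Type*} [AddCommGroup W] [Module k W] {Ψ' : W →ₛₗ[σ] W}
    (f : V →ₗ[k] W) (hf : ∀ x, f (Ψ x) = Ψ' (f x)) {μ : ℚ} {x : V} (hx : x ∈ growth Ψ μ) :
    f x ∈ growth Ψ' μ := by
  intro φ
  obtain ⟨C, hC⟩ := hx (φ ∘ₗ f)
  refine ⟨C, fun n => ?_⟩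
  have : Ψ'^[n] (f x) = f (Ψ^[n] x) := ((Function.Semiconj.iterate_right hf n) x).symm
  rw [this]
  exact hC n

/-- `growth` of a submodule. -/
theorem mem_growth_of_injective {W : Type*} [AddCommGroup W] [Module k W] {Ψ' : W →ₛₗ[σ] W}
    (f : V →ₗ[k] W) (hinj : Function.Injective f) (hf : ∀ x, f (Ψ x) = Ψ' (f x)) {μ : ℚ} {x : V}
    (hx : f x ∈ growth Ψ' μ) : x ∈ growth Ψ μ := by
  intro φ
  -- A linear retraction extends `φ` to `W`. It need not commute with the operators, because it is
  -- applied only after the iteration.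
  obtain ⟨g, hg⟩ := f.exists_leftInverse_of_injective (LinearMap.ker_eq_bot.2 hinj)
  obtain ⟨C, hC⟩ := hx (φ ∘ₗ g)
  refine ⟨C, fun n => ?_⟩
  have : Ψ'^[n] (f x) = f (Ψ^[n] x) := ((Function.Semiconj.iterate_right hf n) x).symm
  have h := hC n
  rw [this, LinearMap.comp_apply, ← LinearMap.comp_apply g, hg, LinearMap.id_apply] at h
  exact h

/-- The orbit of `u` modulo a stable subspace in which `Ψ u = α u`. -/
theorem exists_iterate_eq {E : Submodule k V} (hE : ∀ x ∈ E, Ψ x ∈ E) {u : V} {α : k}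
    (hα : α ≠ 0) (hu : Ψ u - α • u ∈ E) (n : ℕ) :
    ∃ β : k, β ≠ 0 ∧ ord β = n * ord α ∧ Ψ^[n] u - β • u ∈ E := by
  induction n with
  | zero => exact ⟨1, one_ne_zero, by simp [ord], by simp⟩
  | succ n ih =>
    obtain ⟨β, hβ, hord, h⟩ := ih
    refine ⟨σ β * α, mul_ne_zero ((map_ne_zero σ).2 hβ) hα, ?_, ?_⟩
    · rw [ord_mul ((map_ne_zero σ).2 hβ) hα, ord_map σ hβ, hord]
      push_cast; ring
    · have h1 := hE _ h
      rw [map_sub, LinearMap.map_smulₛₗ, ← Function.iterate_succ_apply' Ψ] at h1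
      have h2 := E.add_mem h1 (E.smul_mem (σ β) hu)
      rw [smul_sub, smul_smul] at h2
      convert h2 using 1
      abel

/-- After the form `φ`, which kills `E`, the orbit of `x` becomes `σ^n(c) β_n φ(u)`, of valuation
exactly `ord c + n ord α + ord (φ u)`. A lower bound `n μ - C` for all `n` forces `μ ≤ ord α`. -/
theorem le_ord_of_mem_growth {E : Submodule k V} (hE : ∀ x ∈ E, Ψ x ∈ E) {u : V} {α : k}
    (hα : α ≠ 0) (hu : Ψ u - α • u ∈ E) {φ : V →ₗ[k] k} (hφE : ∀ x ∈ E, φ x = 0)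
    (hφu : φ u ≠ 0) {x : V} {c : k} (hc : c ≠ 0) (hx : x - c • u ∈ E) {μ : ℚ}
    (hxμ : x ∈ growth Ψ μ) : μ ≤ ord α := by
  obtain ⟨C, hC⟩ := hxμ φ
  have hEn : ∀ n : ℕ, ∀ y ∈ E, Ψ^[n] y ∈ E := by
    intro n y hy
    induction n with
    | zero => exact hy
    | succ n ih => rw [Function.iterate_succ_apply']; exact hE _ ih
  have key : ∀ n : ℕ, (n : ℚ) * μ - C ≤ ord c + n * ord α + ord (φ u) := by
    intro n
    obtain ⟨β, hβ, hord, hβu⟩ := exists_iterate_eq hE hα hu n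
    have h1 := hEn n _ hx
    rw [sub_eq_add_neg, iterate_map_add, ← neg_smul, iterate_semilinear_smul] at h1
    have hcn : σ^[n] c ≠ 0 := iterate_ne_zero σ hc n
    have h2 : φ (Ψ^[n] x) = σ^[n] c * β * φ u := by
      have e1 := hφE _ h1
      have e2 := hφE _ hβu
      rw [map_add, map_smul, iterate_map_neg σ, smul_eq_mul] at e1
      rw [map_sub, map_smul, smul_eq_mul] at e2
      linear_combination e1 + σ^[n] c * e2
    have h3 := hC n
    rw [h2, valGE_iff (mul_ne_zero (mul_ne_zero hcn hβ) hφu),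
      ord_mul (mul_ne_zero hcn hβ) hφu, ord_mul hcn hβ, ord_iterate σ hc, hord] at h3
    exact_mod_cast h3
  by_contra hlt
  have hpos : 0 < μ - ord α := by linarith [not_le.1 hlt]
  obtain ⟨n, hn⟩ := exists_nat_gt ((ord c + ord (φ u) + C) / (μ - ord α))
  rw [div_lt_iff₀ hpos] at hn
  have := key n
  nlinarith

/-- Induction on `Ψ^(n+1) e = σ^n(a) Ψ^n e + Ψ^n (Ψ e - a e)`. The valuation of a sum is bounded by
the minimum, so one constant works for all `n`: errors do not accumulate. -/
theorem mem_growth_of_sub_mem {e : V} {a : k} {μ : ℚ} (ha : ValGE a μ)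
    (he : Ψ e - a • e ∈ growth Ψ μ) : e ∈ growth Ψ μ := by
  intro φ
  obtain ⟨C, hC⟩ := he φ
  refine ⟨max (C + μ) (-ord (φ e)), fun n => ?_⟩
  induction n with
  | zero =>
    refine (valGE_ord (φ e)).mono ?_
    have := le_max_right (C + μ) (-ord (φ e))
    push_cast
    linarith
  | succ n ih =>
    have h1 : Ψ^[n + 1] e = σ^[n] a • Ψ^[n] e + Ψ^[n] (Ψ e - a • e) := by
      rw [← iterate_semilinear_smul, ← iterate_map_add, add_sub_cancel,
        Function.iterate_succ_apply]
    rw [h1, map_add, map_smul, smul_eq_mul]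
    refine ValGE.add ?_ ?_
    · refine (((valGE_iterate_iff σ n).2 ha).mul ih).mono ?_
      push_cast; linarith
    · refine (hC n).mono ?_
      have := le_max_left (C + μ) (-ord (φ e))
      push_cast
      linarith

end Growth

section GrowthTensor

variable {k : Type*} [Field k] [SeriesField k] {σ : k →+* k} [Isometric σ]
  {V W : Type*} [AddCommGroup V] [Module k V] [AddCommGroup W] [Module k W]
  {Ψ : V →ₛₗ[σ] V} {Ψ' : W →ₛₗ[σ] W}

/-- In bases, the coordinates of `Ψ^n x ⊗ Ψ'^n y` are products of coordinates. The constant adds the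
losses of the two factors and of the values of `φ` on the finite product basis. -/
theorem tmul_mem_growth [FiniteDimensional k V] [FiniteDimensional k W] {μ μ' : ℚ} {x : V} {y : W}
    (hx : x ∈ growth Ψ μ) (hy : y ∈ growth Ψ' μ') :
    x ⊗ₜ[k] y ∈ growth (TensorProduct.map Ψ Ψ') (μ + μ') := by
  intro φ
  let b := Module.finBasis k V
  let c := Module.finBasis k W
  choose C hC using fun i => hx (b.coord i)
  choose C' hC' using fun j => hy (c.coord j)
  let D : Fin (Module.finrank k V) × Fin (Module.finrank k W) → ℚ := fun p =>
    |C p.1| + |C' p.2| + |(ord (φ (b p.1 ⊗ₜ c p.2)) : ℚ)|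
  refine ⟨∑ p, D p, fun n => ?_⟩
  rw [iterate_map_tmul]
  have h1 : (Ψ^[n] x) ⊗ₜ[k] (Ψ'^[n] y) = ∑ p : _ × _,
      (b.coord p.1 (Ψ^[n] x) * c.coord p.2 (Ψ'^[n] y)) • (b p.1 ⊗ₜ[k] c p.2) := by
    conv_lhs => rw [← b.sum_repr (Ψ^[n] x), ← c.sum_repr (Ψ'^[n] y)]
    rw [TensorProduct.sum_tmul, Fintype.sum_prod_type]
    refine Finset.sum_congr rfl fun i _ => ?_
    rw [TensorProduct.tmul_sum]
    refine Finset.sum_congr rfl fun j _ => ?_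
    rw [TensorProduct.smul_tmul_smul]
    rfl
  rw [h1, map_sum]
  refine ValGE.sum _ fun p _ => ?_
  rw [map_smul, smul_eq_mul]
  refine (((hC p.1 n).mul (hC' p.2 n)).mul (valGE_ord _)).mono ?_
  have h2 : D p ≤ ∑ p, D p := Finset.single_le_sum (f := D) (fun p _ => by positivity)
    (Finset.mem_univ p)
  have h3 := le_abs_self (C p.1)
  have h4 := le_abs_self (C' p.2)
  have h5 := neg_abs_le (ord (φ (b p.1 ⊗ₜ c p.2)) : ℚ)
  simp only [D] at h2
  simp only [D]
  linarith

end GrowthTensor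

/-! ## Triangularizable submodules -/

section Tri

variable {k : Type*} [Field k] {σ : k →+* k} {V W : Type*} [AddCommGroup V] [Module k V]
  [AddCommGroup W] [Module k W]

/-- `N` is obtained by successive extensions by difference modules of rank at most `1`. -/
inductive Tri (T : V →ₛₗ[σ] V) : Submodule k V → Prop
  | bot : Tri T ⊥
  | step {N : Submodule k V} {e : V} {a : k} (hN : Tri T N) (ha : a ≠ 0)
      (he : T e - a • e ∈ N) : Tri T (N ⊔ Submodule.span k {e})

theorem mem_of_mem_sup_span {T : V →ₛₗ[σ] V} {N N' : Submodule k V} {e : V}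
    (hN : ∀ x ∈ N, T x ∈ N') (he : T e ∈ N') :
    ∀ x ∈ N ⊔ Submodule.span k {e}, T x ∈ N' := by
  intro x hx
  obtain ⟨y, hy, z, hz, rfl⟩ := Submodule.mem_sup.1 hx
  obtain ⟨c, rfl⟩ := Submodule.mem_span_singleton.1 hz
  rw [map_add, LinearMap.map_smulₛₗ]
  exact N'.add_mem (hN y hy) (N'.smul_mem _ he)

theorem apply_mem_sup_span {T : V →ₛₗ[σ] V} {N : Submodule k V} {e : V} {a : k}
    (hN : ∀ x ∈ N, T x ∈ N) (he : T e - a • e ∈ N) :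
    ∀ x ∈ N ⊔ Submodule.span k {e}, T x ∈ N ⊔ Submodule.span k {e} := by
  refine mem_of_mem_sup_span (fun x hx => Submodule.mem_sup_left (hN x hx)) ?_
  rw [← sub_add_cancel (T e) (a • e)]
  exact Submodule.add_mem_sup he (Submodule.smul_mem _ _ (Submodule.mem_span_singleton_self e))

theorem Tri.apply_mem {T : V →ₛₗ[σ] V} {N : Submodule k V} (h : Tri T N) :
    ∀ x ∈ N, T x ∈ N := by
  induction h with
  | bot => intro x hx; rw [(Submodule.mem_bot k).1 hx, map_zero]; exact zero_mem _
  | step hN ha he ih => exact apply_mem_sup_span ih he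

/-- `Tri.step` allows `e` to lie already in `N`; this is why an image of a tower needs no removal of
collapsed steps. -/
theorem Tri.map {T : V →ₛₗ[σ] V} {T' : W →ₛₗ[σ] W} (f : V →ₗ[k] W)
    (hf : ∀ x, f (T x) = T' (f x)) {N : Submodule k V} (h : Tri T N) :
    Tri T' (N.map f) := by
  induction h with
  | bot => rw [Submodule.map_bot]; exact Tri.bot
  | @step N e a hN ha he ih =>
    rw [Submodule.map_sup, Submodule.map_span, Set.image_singleton]
    refine Tri.step ih ha ?_
    rw [← hf, ← map_smul, ← map_sub]
    exact Submodule.mem_map_of_mem he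

/-- From `T e ≡ a e` modulo `N` follows `Ψ e ≡ σ'(a)⁻¹ e`, so the same tower serves the inverse
operator. -/
theorem Tri.inverse {σ' : k →+* k} {T : V →ₛₗ[σ] V} {Ψ : V →ₛₗ[σ'] V}
    (hΨT : ∀ x, Ψ (T x) = x) {N : Submodule k V}
    (h : Tri T N) : Tri Ψ N := by
  induction h with
  | bot => exact Tri.bot
  | @step N e a hN ha he ih =>
    have ha' : σ' a ≠ 0 := (map_ne_zero σ').2 ha
    refine Tri.step ih (inv_ne_zero ha') ?_
    have h1 := N.smul_mem (-(σ' a)⁻¹) (ih.apply_mem _ he)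
    rw [map_sub, hΨT, LinearMap.map_smulₛₗ, smul_sub, smul_smul, neg_mul, inv_mul_cancel₀ ha'] at h1
    convert h1 using 1
    rw [neg_smul, neg_smul, one_smul]
    abel

/-- A tower of the quotient by an eigenline, preceded by that line. The vector `x` may be zero. -/
theorem Tri.comap_mkQ {T : V →ₛₗ[σ] V} {x : V} {β : k} (hβ : β ≠ 0) (hx : T x = β • x)
    (hle : Submodule.span k {x} ≤ (Submodule.span k {x}).comap T)
    {N : Submodule k (V ⧸ Submodule.span k {x})}
    (h : Tri (Submodule.mapQ (Submodule.span k {x}) (Submodule.span k {x}) T hle) N) :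
    Tri T (N.comap (Submodule.span k {x}).mkQ) := by
  induction h with
  | bot =>
    rw [Submodule.comap_bot, Submodule.ker_mkQ, ← bot_sup_eq (Submodule.span k {x})]
    refine Tri.step Tri.bot hβ ?_
    rw [hx, sub_self]
    exact zero_mem _
  | @step N e a hN ha he ih =>
    obtain ⟨e, rfl⟩ := Submodule.mkQ_surjective _ e
    have : (N ⊔ Submodule.span k {(Submodule.span k {x}).mkQ e}).comap
        (Submodule.span k {x}).mkQ =
        N.comap (Submodule.span k {x}).mkQ ⊔ Submodule.span k {e} := by
      apply le_antisymm
      · intro y hy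
        obtain ⟨z, hz, w, hw, hzw⟩ := Submodule.mem_sup.1 (Submodule.mem_comap.1 hy)
        obtain ⟨c, rfl⟩ := Submodule.mem_span_singleton.1 hw
        rw [← sub_add_cancel y (c • e)]
        refine Submodule.add_mem_sup ?_ (Submodule.smul_mem _ _ (Submodule.mem_span_singleton_self e))
        rw [Submodule.mem_comap, map_sub, map_smul, ← hzw, add_sub_cancel_right]
        exact hz
      · refine sup_le (Submodule.comap_mono le_sup_left) ?_
        rw [Submodule.span_singleton_le_iff_mem, Submodule.mem_comap]
        exact Submodule.mem_sup_right (Submodule.mem_span_singleton_self _)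
    rw [this]
    refine Tri.step ih ha ?_
    rw [Submodule.mem_comap, map_sub, map_smul]
    exact he

end Tri

/-! ## Eigenvectors -/

section Eigenvector

variable {B : BaseField}

theorem sigma_iterate_coe (q : ℂˣ) (n : ℕ) (f : B.K) :
    (((B.sigma q)^[n] f : B.K) : LaurentSeries ℂ) = dilHom (q ^ n) f := by
  induction n with
  | zero => rw [pow_zero, dilHom_one]; rfl
  | succ n ih =>
    rw [Function.iterate_succ_apply', pow_succ', ← dilHom_dilHom, ← ih]
    rfl

/-- The constants of `K`. -/
def BaseField.const (B : BaseField) (w : ℂ) : B.K := ⟨HahnSeries.single 0 w, B.single_mem 0 w⟩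

theorem sigma_const (q : ℂˣ) (w : ℂ) : B.sigma q (B.const w) = B.const w := by
  refine Subtype.ext ?_
  change dilHom q (HahnSeries.single 0 w) = HahnSeries.single 0 w
  ext n
  rw [dilHom_coeff]
  by_cases hn : n = 0
  · subst hn; simp
  · rw [HahnSeries.coeff_single_of_ne hn, mul_zero]

theorem const_ne_zero {w : ℂ} (hw : w ≠ 0) : B.const w ≠ 0 := fun h =>
  hw (by
    have : (HahnSeries.single 0 w : LaurentSeries ℂ) = 0 := congrArg Subtype.val h
    simpa using this)

/-- The polynomial `∑ c_k X^(k+1) - 1` is nonconstant and has no root at `0`; take one of its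
finitely many roots of least modulus. -/
theorem exists_min_root {r : ℕ} (c : Fin r → ℂ) (hc : ∃ k, c k ≠ 0) :
    ∃ w : ℂ, w ≠ 0 ∧ ∑ k, c k * w ^ (k + 1 : ℕ) = 1 ∧
      ∀ w' : ℂ, ‖w'‖ < ‖w‖ → ∑ k, c k * w' ^ (k + 1 : ℕ) ≠ 1 := by
  let p : Polynomial ℂ := ∑ k, Polynomial.C (c k) * Polynomial.X ^ (k + 1 : ℕ) - 1
  have heval : ∀ w, p.eval w = ∑ k, c k * w ^ (k + 1 : ℕ) - 1 := fun w => by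
    simp [p, Polynomial.eval_finsetSum]
  obtain ⟨i, hi⟩ := hc
  have hcoeff : p.coeff (i + 1) = c i := by
    simp only [p, Polynomial.coeff_sub, Polynomial.finsetSum_coeff, Polynomial.coeff_C_mul_X_pow,
      Polynomial.coeff_one]
    rw [Finset.sum_eq_single i]
    · simp
    · intro j _ hj
      rw [if_neg]
      intro h
      exact hj (Fin.ext (by omega))
    · simp
  have hp0 : p ≠ 0 := fun h => hi (by rw [← hcoeff, h, Polynomial.coeff_zero])
  have hdeg : p.degree ≠ 0 := by
    intro h
    have := Polynomial.le_degree_of_ne_zero (n := (i : ℕ) + 1) (by rw [hcoeff]; exact hi)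
    rw [h] at this
    norm_cast at this
  obtain ⟨w₀, hw₀⟩ := IsAlgClosed.exists_root p hdeg
  obtain ⟨w, hw, hmin⟩ := Finset.exists_min_image p.roots.toFinset (fun w => ‖w‖)
    ⟨w₀, by rw [Multiset.mem_toFinset, Polynomial.mem_roots hp0]; exact hw₀⟩
  rw [Multiset.mem_toFinset, Polynomial.mem_roots hp0, Polynomial.IsRoot.def, heval] at hw
  refine ⟨w, ?_, sub_eq_zero.1 hw, fun w' hlt h => ?_⟩
  · rintro rfl
    simp at hw
  · refine absurd (hmin w' ?_) (not_le.2 hlt)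
    rw [Multiset.mem_toFinset, Polynomial.mem_roots hp0, Polynomial.IsRoot.def, heval, h, sub_self]

/-- A cyclic difference module whose characteristic equation is integral with nonzero reduction
has an eigenvector. -/
theorem exists_eigenvector_of_cyclic {q : ℂˣ} (hq : ‖(q : ℂ)‖ < 1) {V : Type*} [AddCommGroup V]
    [Module B.K V] (T : V →ₛₗ[B.sigma q] V) (e : V) (r : ℕ) (a : ℕ → B.K)
    (ha : T^[r + 1] e = ∑ i ∈ Finset.range (r + 1), a i • T^[i] e)
    (hint : ∀ i ≤ r, ∀ n < 0, (a i : LaurentSeries ℂ).coeff n = 0)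
    (hne : ∃ i ≤ r, (a i : LaurentSeries ℂ).coeff 0 ≠ 0) :
    ∃ (f : ℕ → B.K) (w : ℂ), w ≠ 0 ∧ f r ≠ 0 ∧
      T (∑ i ∈ Finset.range (r + 1), f i • T^[i] e) =
        B.const w • ∑ i ∈ Finset.range (r + 1), f i • T^[i] e := by
  -- The eigenvalue will be `w⁻¹`. At `z = 0` the equation for the last coordinate has the
  -- characteristic equation solved by `w`. As `|q| < 1`, minimality of `|w|` says that `w q^n` is
  -- not a root for `n ≥ 1`, which is the absence of resonance.
  obtain ⟨w, hw0, hw1, hw⟩ := exists_min_root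
    (fun k : Fin (r + 1) => (a (r - k) : LaurentSeries ℂ).coeff 0) (by
      obtain ⟨i, hi, h⟩ := hne
      refine ⟨⟨r - i, by omega⟩, ?_⟩
      simpa [Nat.sub_sub_self hi] using h)
  let h : Fin (r + 1) → B.K := fun k => B.const w ^ (k + 1 : ℕ) * (B.sigma q)^[k] (a (r - k))
  have hcoeff : ∀ k n, (h k : LaurentSeries ℂ).coeff n =
      w ^ (k + 1 : ℕ) * ((q : ℂ) ^ (k : ℕ)) ^ n * (a (r - k) : LaurentSeries ℂ).coeff n := by
    intro k n
    have e1 : (h k : LaurentSeries ℂ) =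
        HahnSeries.single 0 (w ^ (k + 1 : ℕ)) * dilHom (q ^ (k : ℕ)) (a (r - k)) := by
      rw [← sigma_iterate_coe]
      change (HahnSeries.single 0 w : LaurentSeries ℂ) ^ (k + 1 : ℕ) * _ = _
      rw [HahnSeries.single_pow, smul_zero]
    rw [e1, HahnSeries.coeff_single_zero_mul, dilHom_coeff, Units.val_pow_eq_pow_val, mul_assoc]
  obtain ⟨g, hgB, hg0, hg⟩ := B.exists_solution (q := q) hq (h := fun k => h k) (e := 0) (g₀ := 1)
    (fun k => (h k).2) (fun k n hn => by rw [hcoeff, hint _ (by omega) n hn, mul_zero])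
    (zero_mem _) (fun n _ => by simp)
    (by
      intro n hn
      have h1 := hw (w * (q : ℂ) ^ n) (by
        rw [norm_mul, norm_pow]
        exact mul_lt_of_lt_one_right (norm_pos_iff.2 hw0)
          (pow_lt_one₀ (norm_nonneg _) hq (by omega)))
      refine Eq.trans_ne (Finset.sum_congr rfl fun k _ => ?_) h1
      rw [hcoeff, zpow_zero, mul_pow, ← pow_mul, mul_comm n]
      ring)
    (by
      have : ∑ k, (h k : LaurentSeries ℂ).coeff 0 = 1 := by
        rw [← hw1]
        refine Finset.sum_congr rfl fun k _ => ?_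
        rw [hcoeff, zpow_zero]
        ring
      rw [this]; simp)
  let g' : B.K := ⟨g, hgB⟩
  have hg' : g' = ∑ k, h k * (B.sigma q)^[k + 1] g' := by
    refine Subtype.ext ?_
    change g = B.toSubfield.subtype (∑ k, h k * (B.sigma q)^[k + 1] g')
    rw [map_sum]
    conv_lhs => rw [hg, add_zero]
    refine Finset.sum_congr rfl fun k _ => ?_
    rw [map_mul]
    change _ = (h k : LaurentSeries ℂ) * (((B.sigma q)^[k + 1] g' : B.K) : LaurentSeries ℂ)
    rw [sigma_iterate_coe]
  -- Coordinates of the eigenvector: comparing coefficients of `T^i e` gives `f 0 = w a 0 σ(f r)`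
  -- and `f (i+1) = w (σ(f i) + a (i+1) σ(f r))`. Unrolled up to `i = r`, this is the scalar
  -- equation solved by `g'`, so `f r = g'`.
  let f : ℕ → B.K := fun i => Nat.rec (B.const w * (a 0 * B.sigma q g'))
    (fun i fi => B.const w * (B.sigma q fi + a (i + 1) * B.sigma q g')) i
  have hf0 : f 0 = B.const w * (a 0 * B.sigma q g') := rfl
  have hfs : ∀ i, f (i + 1) = B.const w * (B.sigma q (f i) + a (i + 1) * B.sigma q g') :=
    fun i => rfl
  have hfi : ∀ i, f i = ∑ k ∈ Finset.range (i + 1),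
      B.const w ^ (k + 1) * (B.sigma q)^[k] (a (i - k)) * (B.sigma q)^[k + 1] g' := by
    intro i
    induction i with
    | zero => simp [hf0, mul_assoc]
    | succ i ih =>
      rw [hfs, ih, Finset.sum_range_succ' _ (i + 1), map_sum, mul_add, Finset.mul_sum]
      congr 1
      · refine Finset.sum_congr rfl fun k _ => ?_
        rw [map_mul, map_mul, map_pow, sigma_const, Nat.add_sub_add_right,
          Function.iterate_succ_apply' _ k (a (i - k)), Function.iterate_succ_apply' _ (k + 1) g']
        ring
      · simp [mul_assoc]
  have hfr : f r = g' := by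
    rw [hfi, Finset.sum_range]
    exact hg'.symm
  have hg'0 : g' ≠ 0 := fun h0 => by
    have : g = 0 := congrArg Subtype.val h0
    rw [this] at hg0
    simp at hg0
  have hw' : B.const w ≠ 0 := const_ne_zero hw0
  have hconst : B.const w * B.const w⁻¹ = 1 := by
    refine Subtype.ext ?_
    change (HahnSeries.single 0 w : LaurentSeries ℂ) * HahnSeries.single 0 w⁻¹ = 1
    rw [HahnSeries.single_mul_single, add_zero, mul_inv_cancel₀ hw0]
    rfl
  refine ⟨f, w⁻¹, inv_ne_zero hw0, by rw [hfr]; exact hg'0, ?_⟩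
  have hcancel : ∀ y : B.K, B.const w⁻¹ * (B.const w * y) = y := fun y => by
    rw [← mul_assoc, mul_comm (B.const w⁻¹), hconst, one_mul]
  rw [map_sum]
  simp only [LinearMap.map_smulₛₗ, ← Function.iterate_succ_apply' T]
  rw [Finset.sum_range_succ, hfr, ha, Finset.smul_sum, Finset.smul_sum, Finset.sum_range_succ',
    Finset.sum_range_succ' (fun i => B.const w⁻¹ • f i • T^[i] e), ← add_assoc,
    ← Finset.sum_add_distrib]
  congr 1
  · refine Finset.sum_congr rfl fun i _ => ?_
    rw [hfs, smul_smul, smul_smul, hcancel, add_smul, mul_comm (a (i + 1))]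
  · rw [hf0, smul_smul, smul_smul, hcancel, mul_comm (a 0)]

end Eigenvector

/-! ## Triangularization after ramification -/

/-! ### Cyclic vectors and twists -/

section Cyclic

variable {k : Type*} [Field k] {σ : k →+* k} {V : Type*} [AddCommGroup V] [Module k V]

/-- The first linear relation in the orbit of `e`. The orbit need not span `V`, since an eigenvector
in its span is enough. If all coefficients vanished, `T^(r+1) e = 0` would contradict injectivity.
-/
theorem exists_cyclic [FiniteDimensional k V] (T : V →ₛₗ[σ] V) (hT : Function.Injective T) {e : V} (he : e ≠ 0) :
    ∃ (r : ℕ) (a : ℕ → k), LinearIndependent k (fun i : Fin (r + 1) => T^[i] e) ∧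
      T^[r + 1] e = ∑ i ∈ Finset.range (r + 1), a i • T^[i] e ∧ ∃ i ≤ r, a i ≠ 0 := by
  classical
  have hex : ∃ n : ℕ, ¬ LinearIndependent k (fun i : Fin (n + 1) => T^[i] e) := by
    refine ⟨Module.finrank k V, fun h => ?_⟩
    have := h.fintype_card_le_finrank
    simp at this
  have hspec := Nat.find_spec hex
  have hmin := fun m hm => not_not.1 (Nat.find_min hex (m := m) hm)
  generalize Nat.find hex = n at hspec hmin
  obtain _ | r := n
  · exact absurd ((linearIndependent_unique_iff (v := fun i : Fin 1 => T^[i] e)).2 he)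
      hspec
  have hli := hmin r (Nat.lt_succ_self r)
  rw [linearIndependent_finSucc'] at hspec
  have hmem : T^[r + 1] e ∈ Submodule.span k (Set.range fun i : Fin (r + 1) => T^[i] e) := by
    by_contra h
    exact hspec ⟨hli, h⟩
  obtain ⟨c, hc⟩ := (Submodule.mem_span_range_iff_exists_fun k).1 hmem
  have hsum : T^[r + 1] e = ∑ i ∈ Finset.range (r + 1),
      (if h : i < r + 1 then c ⟨i, h⟩ else 0) • T^[i] e := by
    rw [Finset.sum_range, ← hc]
    refine Finset.sum_congr rfl fun i _ => ?_
    rw [dif_pos i.2]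
  refine ⟨r, fun i => if h : i < r + 1 then c ⟨i, h⟩ else 0, hli, hsum, ?_⟩
  by_contra hall
  push Not at hall
  rw [Finset.sum_eq_zero fun i hi => by
    rw [hall i (Nat.lt_succ_iff.1 (Finset.mem_range.1 hi)), zero_smul]] at hsum
  have : ∀ n : ℕ, T^[n] e ≠ 0 := by
    intro n
    induction n with
    | zero => exact he
    | succ n ih =>
      rw [Function.iterate_succ_apply']
      exact fun h => ih (hT (by rw [h, map_zero]))
  exact this _ hsum

/-- Rescaling a semilinear map by a scalar. -/
theorem exists_iterate_smul (T : V →ₛₗ[σ] V) {u : k} (hu : u ≠ 0) [SeriesField k] [Isometric σ]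
    (e : V) : ∃ d : ℕ → k, (∀ i, d i ≠ 0) ∧ (∀ i, ord (d i) = i * ord u) ∧
      ∀ i, (u • T)^[i] e = d i • T^[i] e := by
  refine ⟨fun i => Nat.rec 1 (fun _ d => u * σ d) i, fun i => ?_, fun i => ?_, fun i => ?_⟩
  · induction i with
    | zero => exact one_ne_zero
    | succ i ih => exact mul_ne_zero hu ((map_ne_zero σ).2 ih)
  · have hne : ∀ i : ℕ, (Nat.rec 1 (fun _ d => u * σ d) i : k) ≠ 0 := fun i => by
      induction i with
      | zero => exact one_ne_zero
      | succ i ih => exact mul_ne_zero hu ((map_ne_zero σ).2 ih)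
    induction i with
    | zero => simp [ord]
    | succ i ih =>
      dsimp only at ih ⊢
      rw [ord_mul hu ((map_ne_zero σ).2 (hne i)), ord_map σ (hne i), ih]
      push_cast; ring
  · induction i with
    | zero => simp
    | succ i ih =>
      rw [Function.iterate_succ_apply', ih, LinearMap.smul_apply, LinearMap.map_smulₛₗ, smul_smul,
        ← Function.iterate_succ_apply' T]

end Cyclic

/-! ### Newton polygons, eigenvectors and towers after ramification -/

section Ramification

variable {B : BaseField}

/-- The embedding `f(z) ↦ f(z_l ^ l)`, as an endomorphism of the field `K`. -/
def BaseField.ram (B : BaseField) (l : ℕ+) : B.K →+* B.K :=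
  (ramHom l).restrict B.toSubfield B.toSubfield fun _ h => B.ram_mem l h

theorem ramHom_ramHom (l l' : ℕ+) (f : LaurentSeries ℂ) :
    ramHom l' (ramHom l f) = ramHom (l * l') f := by
  have hl' : (l' : ℤ) ≠ 0 := by exact_mod_cast l'.ne_zero
  ext n
  by_cases h1 : (l' : ℤ) ∣ n
  · obtain ⟨m, rfl⟩ := h1
    rw [ramHom_coeff_mul]
    by_cases h2 : (l : ℤ) ∣ m
    · obtain ⟨p, rfl⟩ := h2
      have : (l' : ℤ) * (l * p) = ((l * l' : ℕ+) : ℤ) * p := by push_cast; ring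
      rw [ramHom_coeff_mul, this, ramHom_coeff_mul]
    · rw [ramHom_coeff_of_not_dvd _ _ h2, ramHom_coeff_of_not_dvd]
      rintro ⟨p, hp⟩
      refine h2 ⟨p, mul_left_cancel₀ hl' ?_⟩
      rw [hp]; push_cast; ring
  · rw [ramHom_coeff_of_not_dvd _ _ h1, ramHom_coeff_of_not_dvd]
    rintro ⟨p, rfl⟩
    exact h1 ⟨l * p, by push_cast; ring⟩

theorem ram_ram (l l' : ℕ+) (f : B.K) : B.ram l' (B.ram l f) = B.ram (l * l') f :=
  Subtype.ext (ramHom_ramHom l l' f)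

theorem valGE_ram {l : ℕ+} {f : B.K} {t : ℚ} (h : ValGE f t) : ValGE (B.ram l f) (l * t) := by
  intro n hn
  change (ramHom l (f : LaurentSeries ℂ)).coeff n = 0
  by_cases hd : (l : ℤ) ∣ n
  · obtain ⟨m, rfl⟩ := hd
    rw [ramHom_coeff_mul]
    have hl : (0 : ℚ) < (l : ℕ) := by exact_mod_cast l.pos
    refine h m ?_
    push_cast at hn
    exact lt_of_mul_lt_mul_left hn hl.le
  · exact ramHom_coeff_of_not_dvd l _ hd

theorem ord_ram {l : ℕ+} {f : B.K} (hf : f ≠ 0) : ord (B.ram l f) = l * ord f := by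
  have h0 : B.ram l f ≠ 0 := (map_ne_zero _).2 hf
  refine le_antisymm ?_ ?_
  · by_contra h
    have h1 : (B.ram l f : LaurentSeries ℂ).coeff (l * ord f) = 0 :=
      HahnSeries.coeff_eq_zero_of_lt_order (not_le.1 h)
    have h2 : (ramHom l (f : LaurentSeries ℂ)).coeff (l * ord f) = 0 := h1
    rw [ramHom_coeff_mul] at h2
    exact HahnSeries.coeff_order_eq_zero.not.2 (ser_ne_zero hf) h2
  · have := (valGE_iff h0 _).1 (valGE_ram (l := l) (valGE_ord f))
    exact_mod_cast this

theorem sigma_ram {q q' : ℂˣ} {l : ℕ+} (h : q' ^ (l : ℕ) = q) (f : B.K) :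
    B.sigma q' (B.ram l f) = B.ram l (B.sigma q f) := by
  refine Subtype.ext ?_
  change dilHom q' (ramHom l (f : LaurentSeries ℂ)) = ramHom l (dilHom q f)
  ext n
  rw [dilHom_coeff]
  by_cases hn : (l : ℤ) ∣ n
  · obtain ⟨m, rfl⟩ := hn
    rw [ramHom_coeff_mul, ramHom_coeff_mul, dilHom_coeff, zpow_mul, ← h]
    simp
  · rw [ramHom_coeff_of_not_dvd l _ hn, ramHom_coeff_of_not_dvd l _ hn, mul_zero]

theorem norm_lt_one_of_pow {q q' : ℂˣ} {l : ℕ+} (h : q' ^ (l : ℕ) = q) (hq : ‖(q : ℂ)‖ < 1) :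
    ‖(q' : ℂ)‖ < 1 := by
  rw [← h, Units.val_pow_eq_pow_val, norm_pow] at hq
  exact (pow_lt_one_iff_of_nonneg (norm_nonneg _) l.ne_zero).1 hq

/-- An edge of the Newton polygon: if `j` minimizes `ord (a i) / (r + 1 - i)`, take `l = r + 1 - j`
and `m = -ord (a j)`. The expressions in the conclusion are the valuations of the coefficients after
ramification by `l` and twisting by `z^m`. -/
theorem exists_newton_slope (r : ℕ) (a : ℕ → B.K) (ha : ∃ i ≤ r, a i ≠ 0) :
    ∃ (l : ℕ+) (m : ℤ), (∀ i ≤ r, a i ≠ 0 → 0 ≤ (l : ℤ) * ord (a i) + m * (r + 1 - i)) ∧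
      ∃ i ≤ r, a i ≠ 0 ∧ (l : ℤ) * ord (a i) + m * (r + 1 - i) = 0 := by
  classical
  obtain ⟨j, hj, hmin⟩ := Finset.exists_min_image
    ((Finset.range (r + 1)).filter fun i => a i ≠ 0)
    (fun i => (ord (a i) : ℚ) / (r + 1 - i))
    (by
      obtain ⟨i, hi, h⟩ := ha
      exact ⟨i, Finset.mem_filter.2 ⟨Finset.mem_range.2 (by omega), h⟩⟩)
  rw [Finset.mem_filter, Finset.mem_range] at hj
  obtain ⟨l, hl⟩ : ∃ l : ℕ+, ((l : ℕ) : ℤ) = r + 1 - j := by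
    obtain ⟨p, hp⟩ : ∃ p : ℕ, r + 1 - j = p + 1 := ⟨r - j, by omega⟩
    exact ⟨p.succPNat, by rw [Nat.succPNat_coe]; omega⟩
  refine ⟨l, -ord (a j), fun i hi h => ?_, j, by omega, hj.2, ?_⟩
  · have h1 := hmin i (Finset.mem_filter.2 ⟨Finset.mem_range.2 (by omega), h⟩)
    have hi' : (0 : ℚ) < r + 1 - i := by
      have : (i : ℚ) ≤ r := by exact_mod_cast hi
      linarith
    have hj' : (0 : ℚ) < r + 1 - j := by
      have : (j : ℚ) ≤ r := by exact_mod_cast Nat.lt_succ_iff.1 hj.1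
      linarith
    rw [div_le_div_iff₀ hj' hi'] at h1
    have h2 : ord (a j) * ((r : ℤ) + 1 - i) ≤ ord (a i) * (r + 1 - j) := by exact_mod_cast h1
    rw [hl]
    linarith
  · rw [hl]; ring

/-- After ramification, a difference module over `(K, σ_q)`, `|q| < 1`, has an eigenvector. -/
theorem exists_eigenvector {q : ℂˣ} (hq : ‖(q : ℂ)‖ < 1) {V : Type*} [AddCommGroup V]
    [Module B.K V] [FiniteDimensional B.K V] [Nontrivial V] (T : V →ₛₗ[B.sigma q] V)
    (hT : Function.Injective T) :
    ∃ l : ℕ+, ∀ (q' : ℂˣ), q' ^ (l : ℕ) = q → ∀ {W : Type*} [AddCommGroup W] [Module B.K W]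
      [FiniteDimensional B.K W]
      (T' : W →ₛₗ[B.sigma q'] W) (ι : V →ₛₗ[B.ram l] W), (∀ x, T' (ι x) = ι (T x)) →
      (∀ (n : ℕ) (v : Fin n → V), LinearIndependent B.K v → LinearIndependent B.K (ι ∘ v)) →
      ∃ (x : W) (β : B.K), x ≠ 0 ∧ β ≠ 0 ∧ T' x = β • x := by
  obtain ⟨e, he⟩ := exists_ne (0 : V)
  obtain ⟨r, a, hli, ha, hne⟩ := exists_cyclic T hT he
  obtain ⟨l, m, hlm, j, hj, hja, hjm⟩ := exists_newton_slope r a hne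
  refine ⟨l, fun q' hq' W _ _ _ T' ι hι hιli => ?_⟩
  have hiter : ∀ i, T'^[i] (ι e) = ι (T^[i] e) := fun i =>
    (Function.Semiconj.iterate_right (fun x => (hι x).symm) i e).symm
  -- Twisting by `z^m` turns the relation among the `T'^i (ι e)` into one with coefficients `a' i`,
  -- all integral and at least one of valuation zero.
  let u : B.K := ⟨HahnSeries.single m 1, B.single_mem m 1⟩
  have hu : u ≠ 0 := fun h => by
    have : (HahnSeries.single m (1 : ℂ) : LaurentSeries ℂ) = 0 := congrArg Subtype.val h
    simp at this
  have hord : ord u = m := by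
    change (HahnSeries.single m (1 : ℂ) : LaurentSeries ℂ).order = m
    exact HahnSeries.order_single one_ne_zero
  obtain ⟨d, hd, hdord, hdi⟩ := exists_iterate_smul T' hu (ι e)
  let a' : ℕ → B.K := fun i => d (r + 1) * B.ram l (a i) * (d i)⁻¹
  have ha'0 : ∀ i, a i = 0 → a' i = 0 := fun i h => by simp [a', h]
  have ha' : ∀ i, a i ≠ 0 → a' i ≠ 0 := fun i h =>
    mul_ne_zero (mul_ne_zero (hd _) ((map_ne_zero _).2 h)) (inv_ne_zero (hd i))
  have ha'ord : ∀ i, a i ≠ 0 → ord (a' i) = (l : ℤ) * ord (a i) + m * (r + 1 - i) := by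
    intro i h
    have h1 : B.ram l (a i) ≠ 0 := (map_ne_zero _).2 h
    simp only [a']
    rw [ord_mul (mul_ne_zero (hd _) h1) (inv_ne_zero (hd i)), ord_mul (hd _) h1, ord_inv (hd i),
      ord_ram h, hdord, hdord, hord]
    push_cast; ring
  obtain ⟨f, w, hw, hfr, hf⟩ := exists_eigenvector_of_cyclic (norm_lt_one_of_pow hq' hq) (u • T')
    (ι e) r a' (by
      rw [hdi, hiter, ha, map_sum, Finset.smul_sum]
      refine Finset.sum_congr rfl fun i _ => ?_
      rw [hdi, hiter, LinearMap.map_smulₛₗ, smul_smul, smul_smul, inv_mul_cancel_right₀ (hd i)])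
    (by
      intro i hi n hn
      by_cases h : a i = 0
      · rw [ha'0 i h]; rfl
      · refine HahnSeries.coeff_eq_zero_of_lt_order (hn.trans_le ?_)
        have := ha'ord i h
        change (a' i : LaurentSeries ℂ).order = _ at this
        rw [this]
        exact hlm i hi h)
    ⟨j, hj, by
      have h1 := ha'ord j hja
      rw [hjm] at h1
      have h2 := HahnSeries.coeff_order_eq_zero.not.2 (ser_ne_zero (ha' j hja))
      change ¬ (a' j : LaurentSeries ℂ).coeff (ord (a' j)) = 0 at h2
      rwa [h1] at h2⟩
  set x := ∑ i ∈ Finset.range (r + 1), f i • (u • T')^[i] (ι e) with hx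
  refine ⟨x, u⁻¹ * B.const w, fun h0 => ?_, mul_ne_zero (inv_ne_zero hu) (const_ne_zero hw), ?_⟩
  · have hli' := hιli _ _ hli
    have h1 : ∑ i : Fin (r + 1), (f i * d i) • (ι ∘ fun i : Fin (r + 1) => T^[i] e) i = 0 := by
      rw [← h0, hx, Finset.sum_range]
      refine Finset.sum_congr rfl fun i _ => ?_
      rw [hdi, hiter, smul_smul]; rfl
    have h2 := Fintype.linearIndependent_iff.1 hli' _ h1 ⟨r, Nat.lt_succ_self r⟩
    exact mul_ne_zero hfr (hd r) h2
  · rw [mul_smul, ← hf, LinearMap.smul_apply, inv_smul_smul₀ hu]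

theorem ramify_inverse {τ τ' : ℂ} (l : ℕ+) {V : Type*} [AddCommGroup V] [Module B.K V]
    {T : V →ₛₗ[B.sigma (qOf τ)] V} {Ψ : V →ₛₗ[B.sigma (qOf τ')] V}
    (hσ : ∀ a, BaseField.Ram.sigma B l (qRoot τ' l) (BaseField.Ram.sigma B l (qRoot τ l) a) = a)
    (hΨT : ∀ x, Ψ (T x) = x) (x : B.Ram l ⊗[B.K] V) : ramify l Ψ (ramify l T x) = x := by
  induction x with
  | zero => simp
  | add x y hx hy => rw [map_add, map_add, hx, hy]
  | tmul a v =>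
    change (BaseField.Ram.sigma B l (qRoot τ' l) (BaseField.Ram.sigma B l (qRoot τ l) a)) ⊗ₜ
      Ψ (T v) = _
    rw [hσ, hΨT]

theorem sigma_qRoot_neg (τ : ℂ) (l : ℕ+) (a : B.Ram l) :
    BaseField.Ram.sigma B l (qRoot (-τ) l) (BaseField.Ram.sigma B l (qRoot τ l) a) = a := by
  refine Subtype.ext ?_
  change dilHom (qRoot (-τ) l) (dilHom (qRoot τ l) _) = _
  rw [dilHom_dilHom]
  have : qRoot (-τ) l * qRoot τ l = 1 := by
    ext
    simp only [qRoot, qOf, Units.val_mul, Units.val_mk0, Units.val_one]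
    rw [← Complex.exp_add, ← Complex.exp_zero]
    congr 1
    ring
  rw [this, dilHom_one]
  rfl

/-- The embedding of `K_l` into `K_{l l'}`. -/
def BaseField.ramFrom (B : BaseField) (l l' : ℕ+) : B.Ram l →+* B.K := B.ram l'

/-- The map `K_l ⊗ V → V'` induced by a semilinear map `V → V'` over the ramification of level
`l * l'`. -/
def liftRam {l l' : ℕ+} {V V' : Type*} [AddCommGroup V] [Module B.K V] [AddCommGroup V']
    [Module B.K V'] (ρ : V →ₛₗ[B.ram (l * l')] V') :
    (B.Ram l ⊗[B.K] V) →ₛₗ[B.ramFrom l l'] V' :=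
  let f : (B.Ram l ⊗[B.K] V) →+ V' := TensorProduct.liftAddHom
    { toFun := fun a =>
        { toFun := fun v => B.ramFrom l l' a • ρ v
          map_zero' := by rw [map_zero, smul_zero]
          map_add' := fun v w => by rw [map_add, smul_add] }
      map_zero' := by ext v; change B.ramFrom l l' 0 • ρ v = 0; rw [map_zero, zero_smul]
      map_add' := fun a b => by
        ext v
        change B.ramFrom l l' (a + b) • ρ v = _
        rw [map_add, add_smul]; rfl }
    (fun r a v => by
      change B.ramFrom l l' (r • a) • ρ v =
        B.ramFrom l l' a • ρ (r • v)
      rw [LinearMap.map_smulₛₗ, smul_smul, Algebra.smul_def, map_mul, mul_comm]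
      congr 2
      exact ram_ram l l' r)
  { toFun := f
    map_add' := map_add f
    map_smul' := fun c x => by
      induction x with
      | zero => simp
      | add x y hx hy => rw [smul_add, map_add, map_add, smul_add, hx, hy]
      | tmul a v =>
        rw [TensorProduct.smul_tmul']
        change B.ramFrom l l' (c * a) • ρ v =
          B.ramFrom l l' c • B.ramFrom l l' a • ρ v
        rw [map_mul, mul_smul] }

theorem liftRam_tmul {l l' : ℕ+} {V V' : Type*} [AddCommGroup V] [Module B.K V] [AddCommGroup V']
    [Module B.K V'] (ρ : V →ₛₗ[B.ram (l * l')] V') (a : B.Ram l) (v : V) :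
    liftRam ρ (a ⊗ₜ v) = B.ramFrom l l' a • ρ v := rfl

theorem liftRam_ramify {l l' : ℕ+} {τ : ℂ} {q' : ℂˣ} (hq' : q' ^ (l' : ℕ) = qRoot τ l)
    {V V' : Type*} [AddCommGroup V] [Module B.K V] [AddCommGroup V'] [Module B.K V']
    {T : V →ₛₗ[B.sigma (qOf τ)] V} {T' : V' →ₛₗ[B.sigma q'] V'} {ρ : V →ₛₗ[B.ram (l * l')] V'}
    (h : ∀ x, ρ (T x) = T' (ρ x)) (x : B.Ram l ⊗[B.K] V) :
    liftRam ρ (ramify l T x) = T' (liftRam ρ x) := by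
  induction x with
  | zero => simp
  | add x y hx hy => rw [map_add, map_add, map_add, map_add, hx, hy]
  | tmul a v =>
    change liftRam ρ (BaseField.Ram.sigma B l (qRoot τ l) a ⊗ₜ T v) = _
    rw [liftRam_tmul, liftRam_tmul, LinearMap.map_smulₛₗ, h]
    congr 1
    exact (sigma_ram hq' (show B.K from a)).symm

theorem span_range_liftRam {l l' : ℕ+} {V V' : Type*} [AddCommGroup V] [Module B.K V]
    [AddCommGroup V'] [Module B.K V'] (ρ : V →ₛₗ[B.ram (l * l')] V') :
    Submodule.span B.K (Set.range (liftRam ρ)) = Submodule.span B.K (Set.range ρ) := by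
  apply le_antisymm
  · rw [Submodule.span_le]
    rintro _ ⟨x, rfl⟩
    induction x with
    | zero => rw [map_zero]; exact zero_mem _
    | add x y hx hy => rw [map_add]; exact add_mem hx hy
    | tmul a v =>
      rw [liftRam_tmul]
      exact Submodule.smul_mem _ _ (Submodule.subset_span ⟨v, rfl⟩)
  · refine Submodule.span_mono ?_
    rintro _ ⟨v, rfl⟩
    exact ⟨1 ⊗ₜ v, by rw [liftRam_tmul, map_one, one_smul]⟩

/-- `v ↦ 1 ⊗ v`, as a semilinear map. -/
def oneTmul (B : BaseField) (l : ℕ+) (V : Type*) [AddCommGroup V] [Module B.K V] :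
    V →ₛₗ[algebraMap B.K (B.Ram l)] B.Ram l ⊗[B.K] V where
  toFun v := 1 ⊗ₜ v
  map_add' := TensorProduct.tmul_add 1
  map_smul' r v := by
    rw [← TensorProduct.smul_tmul, TensorProduct.smul_tmul', Algebra.smul_def, smul_eq_mul]

universe u w

/-- The ramified module `K_l ⊗ V`, as a module over `K`. -/
theorem exists_ramified {τ τ' : ℂ} (hτ : τ' = -τ) (l : ℕ+) {V : Type u} [AddCommGroup V]
    [Module B.K V] [FiniteDimensional B.K V] (T : V →ₛₗ[B.sigma (qOf τ)] V)
    (Ψ : V →ₛₗ[B.sigma (qOf τ')] V) (hΨT : ∀ x, Ψ (T x) = x) :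
    ∃ (W : Type u) (_ : AddCommGroup W) (_ : Module B.K W) (_ : FiniteDimensional B.K W)
      (T₁ : W →ₛₗ[B.sigma (qOf (τ / (l : ℕ)))] W) (Ψ₁ : W →ₛₗ[B.sigma (qOf (τ' / (l : ℕ)))] W)
      (ι : V →ₛₗ[B.ram l] W),
      (∀ x, Ψ₁ (T₁ x) = x) ∧ (∀ x, T₁ (ι x) = ι (T x)) ∧
      (∀ (n : ℕ) (v : Fin n → V), LinearIndependent B.K v → LinearIndependent B.K (ι ∘ v)) ∧
      Module.finrank B.K W = Module.finrank B.K V ∧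
      ∀ (l' : ℕ+) (q' : ℂˣ), q' ^ (l' : ℕ) = qOf (τ / (l : ℕ)) → ∀ {V' : Type w}
        [AddCommGroup V'] [Module B.K V'] (T' : V' →ₛₗ[B.sigma q'] V')
        (ρ : V →ₛₗ[B.ram (l * l')] V'), (∀ x, ρ (T x) = T' (ρ x)) →
        ∃ ρ' : W →ₛₗ[B.ram l'] V', (∀ x, ρ' (T₁ x) = T' (ρ' x)) ∧
          Submodule.span B.K (Set.range ρ') = Submodule.span B.K (Set.range ρ) := by
  -- `B.Ram l` is the field `B.K` by definition, so the `K_l`-structure of the tensor product is a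
  -- structure over `B.K`. It is this structure that is used, not the one through `z = z_l^l`.
  refine ⟨B.Ram l ⊗[B.K] V, inferInstance,
    (inferInstance : Module (B.Ram l) (B.Ram l ⊗[B.K] V)),
    (inferInstance : FiniteDimensional (B.Ram l) (B.Ram l ⊗[B.K] V)),
    ramify l T, ramify l Ψ, oneTmul B l V, ?_, ?_, ?_, ?_, ?_⟩
  · subst hτ
    exact ramify_inverse l (sigma_qRoot_neg τ l) hΨT
  · intro x
    change BaseField.Ram.sigma B l (qRoot τ l) 1 ⊗ₜ T x = 1 ⊗ₜ T x
    rw [map_one]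
  · intro n v hv
    exact Module.Flat.linearIndependent_one_tmul (S := B.Ram l) hv
  · exact Module.finrank_baseChange (R := B.Ram l)
  · intro l' q' hq' V' _ _ T' ρ h
    exact ⟨liftRam ρ, liftRam_ramify hq' h, span_range_liftRam ρ⟩

/-- After ramification, every difference module is triangularizable. -/
theorem exists_tri (n : ℕ) : ∀ {τ τ' : ℂ}, τ' = -τ → ‖(qOf τ : ℂ)‖ < 1 → ∀ {V : Type u}
    [AddCommGroup V] [Module B.K V] [FiniteDimensional B.K V] (T : V →ₛₗ[B.sigma (qOf τ)] V)
    (Ψ : V →ₛₗ[B.sigma (qOf τ')] V), (∀ x, Ψ (T x) = x) → Module.finrank B.K V = n →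
    ∃ l : ℕ+, ∀ (q' : ℂˣ), q' = qOf (τ / (l : ℕ)) → ∀ {V' : Type w} [AddCommGroup V']
      [Module B.K V'] (T' : V' →ₛₗ[B.sigma q'] V') (ρ : V →ₛₗ[B.ram l] V'),
      (∀ x, ρ (T x) = T' (ρ x)) → Tri T' (Submodule.span B.K (Set.range ρ)) := by
  induction n using Nat.strong_induction_on with
  | _ n ih =>
  -- The conclusion concerns every semilinear image `ρ` of `V`, not only `K_l ⊗ V`. Successive
  -- ramifications then compose by factoring `ρ`, with no identification of `K_{l'} ⊗ (K_l ⊗ V)`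
  -- with `K_{l l'} ⊗ V`. The inverse `Ψ` is carried along so that the operator stays injective on
  -- quotients.
  intro τ τ' hτ hq V _ _ _ T Ψ hΨT hn
  have hT : Function.Injective T := Function.LeftInverse.injective hΨT
  rcases subsingleton_or_nontrivial V with hV | hV
  · refine ⟨1, fun q' hq' V' _ _ T' ρ h => ?_⟩
    have : Submodule.span B.K (Set.range ρ) = ⊥ := by
      rw [Submodule.span_eq_bot]
      rintro _ ⟨x, rfl⟩
      rw [Subsingleton.elim x 0, map_zero]
    rw [this]
    exact Tri.bot
  · obtain ⟨l, hl⟩ := exists_eigenvector hq T hT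
    obtain ⟨W, _, _, _, T₁, Ψ₁, ι, hΨT₁, hι, hιli, hfr, hext⟩ :=
      exists_ramified.{u, w} hτ l T Ψ hΨT
    have hql : qOf (τ / (l : ℕ)) ^ (l : ℕ) = qOf τ := qRoot_pow τ l
    obtain ⟨x, β, hx, hβ, hTx⟩ := hl _ hql T₁ ι hι hιli
    set X := Submodule.span B.K {x} with hX
    have hTX : X ≤ X.comap T₁ := by
      rw [hX, Submodule.span_singleton_le_iff_mem, Submodule.mem_comap, hTx]
      exact Submodule.smul_mem _ _ (Submodule.mem_span_singleton_self x)
    have hΨx : Ψ₁ x = (B.sigma (qOf (τ' / (l : ℕ))) β)⁻¹ • x := by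
      rw [eq_inv_smul_iff₀ ((map_ne_zero _).2 hβ), ← LinearMap.map_smulₛₗ, ← hTx, hΨT₁]
    have hΨX : X ≤ X.comap Ψ₁ := by
      rw [hX, Submodule.span_singleton_le_iff_mem, Submodule.mem_comap, hΨx]
      exact Submodule.smul_mem _ _ (Submodule.mem_span_singleton_self x)
    have hrank : Module.finrank B.K (W ⧸ X) < n := by
      have h1 := X.finrank_quotient_add_finrank
      have h2 : Module.finrank B.K X = 1 := finrank_span_singleton hx
      omega
    obtain ⟨l', hl'⟩ := ih _ hrank (τ := τ / (l : ℕ)) (τ' := τ' / (l : ℕ)) (by rw [hτ, neg_div])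
      (norm_lt_one_of_pow hql hq) (X.mapQ X T₁ hTX) (X.mapQ X Ψ₁ hΨX) (by
        intro y
        obtain ⟨y, rfl⟩ := X.mkQ_surjective y
        rw [Submodule.mkQ_apply, Submodule.mapQ_apply, Submodule.mapQ_apply, hΨT₁]) rfl
    refine ⟨l * l', fun q' hq' V' _ _ T' ρ h => ?_⟩
    have hq'' : q' = qOf (τ / (l : ℕ) / (l' : ℕ)) := by
      rw [hq', div_div]; push_cast; rfl
    have hqpow : q' ^ (l' : ℕ) = qOf (τ / (l : ℕ)) := by
      rw [hq'']; exact qRoot_pow _ l'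
    obtain ⟨ρ', hρ', hspan⟩ := hext l' q' hqpow T' ρ h
    -- `ρ'` need not be injective: if `ρ' x = 0`, then `Y` is zero, which `Tri.comap_mkQ` permits.
    set Y := Submodule.span B.K {ρ' x} with hY
    have hTY : T' (ρ' x) = B.ram l' β • ρ' x := by
      rw [← hρ', hTx, LinearMap.map_smulₛₗ]
    have hTYle : Y ≤ Y.comap T' := by
      rw [hY, Submodule.span_singleton_le_iff_mem, Submodule.mem_comap, hTY]
      exact Submodule.smul_mem _ _ (Submodule.mem_span_singleton_self _)
    have hρX : X ≤ Y.comap ρ' := by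
      rw [hX, Submodule.span_singleton_le_iff_mem, Submodule.mem_comap]
      exact Submodule.mem_span_singleton_self _
    have htri := hl' q' hq'' (Y.mapQ Y T' hTYle) (X.mapQ Y ρ' hρX) (by
      intro y
      obtain ⟨y, rfl⟩ := X.mkQ_surjective y
      simp only [Submodule.mkQ_apply, Submodule.mapQ_apply, hρ'])
    have hlift := htri.comap_mkQ ((map_ne_zero _).2 hβ) hTY hTYle
    have hrange : Submodule.span B.K (Set.range (X.mapQ Y ρ' hρX)) =
        (Submodule.span B.K (Set.range ρ')).map Y.mkQ := by
      rw [Submodule.map_span, ← Set.range_comp]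
      congr 1
      ext y
      constructor
      · rintro ⟨z, rfl⟩
        obtain ⟨z, rfl⟩ := X.mkQ_surjective z
        exact ⟨z, by simp⟩
      · rintro ⟨z, rfl⟩
        exact ⟨X.mkQ z, by simp⟩
    rw [hrange, Submodule.comap_map_mkQ, hspan] at hlift
    rwa [sup_eq_right.2] at hlift
    rw [Submodule.span_singleton_le_iff_mem, ← hspan]
    exact Submodule.subset_span ⟨x, rfl⟩

end Ramification

/-! ## Sorting the slopes -/

/-- As `|q| > 1`, rewrite the equation as `f = σ⁻¹((b / a) f + c / a)`, where the dilation factor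
has modulus below `1`. Putting `f = u g` with `u = σ⁻¹(c / a)` normalizes it to `g = h σ⁻¹(g) + 1`;
`ord a < ord b` gives `ord h > 0`, so there is no resonance. -/
theorem BaseField.exists_split (B : BaseField) {q : ℂˣ} (hq : 1 < ‖(q : ℂ)‖) {a b : B.K} (c : B.K)
    (ha : a ≠ 0) (hb : b ≠ 0) (hab : ord a < ord b) : ∃ f : B.K, a * B.sigma q f - b * f = c := by
  by_cases hc : c = 0
  · exact ⟨0, by simp [hc]⟩
  have hq' : ‖((q⁻¹ : ℂˣ) : ℂ)‖ < 1 := by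
    rw [Units.val_inv_eq_inv_val, norm_inv]
    exact inv_lt_one_of_one_lt₀ hq
  set s := B.sigma q⁻¹ with hs
  have hinv : ∀ x, B.sigma q (s x) = x := fun x => by
    refine Subtype.ext ?_
    change dilHom q (dilHom q⁻¹ (x : LaurentSeries ℂ)) = x
    rw [dilHom_dilHom, mul_inv_cancel, dilHom_one]
  have hca : c / a ≠ 0 := div_ne_zero hc ha
  have hba : b / a ≠ 0 := div_ne_zero hb ha
  set u : B.K := s (c / a) with hu
  have hu0 : u ≠ 0 := (map_ne_zero s).2 hca
  have hsu : s u ≠ 0 := (map_ne_zero s).2 hu0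
  set h : B.K := s (b / a) * s u * u⁻¹ with hh
  have hord : 0 < ord h := by
    rw [hh, ord_mul (mul_ne_zero ((map_ne_zero s).2 hba) hsu) (inv_ne_zero hu0),
      ord_mul ((map_ne_zero s).2 hba) hsu, ord_inv hu0, ord_map s hba, ord_map s hu0,
      div_eq_mul_inv, ord_mul hb (inv_ne_zero ha), ord_inv ha]
    omega
  have hcoeff : ∀ n ≤ 0, (h : LaurentSeries ℂ).coeff n = 0 := fun n hn =>
    HahnSeries.coeff_eq_zero_of_lt_order (lt_of_le_of_lt hn hord)
  obtain ⟨g, hgB, -, hg⟩ := B.exists_solution (r := 1) hq' (h := fun _ => h) (e := 1) (g₀ := 1)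
    (fun _ => h.2) (fun _ n hn => hcoeff n hn.le) (one_mem _)
    (fun n hn => by rw [HahnSeries.coeff_one, if_neg hn.ne])
    (fun n _ => by simp [hcoeff 0 le_rfl]) (by simp [hcoeff 0 le_rfl])
  let g' : B.K := ⟨g, hgB⟩
  have hg' : g' = h * s g' + 1 := by
    refine Subtype.ext ?_
    have h1 : g = h * dilHom q⁻¹ g + 1 := by simpa using hg
    exact h1
  refine ⟨u * g', ?_⟩
  have h1 : u * g' = s (b / a * (u * g') + c / a) := by
    rw [map_add, map_mul, map_mul, ← hu]
    conv_lhs => rw [hg']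
    rw [hh]
    field_simp
  have h2 : B.sigma q (u * g') = b / a * (u * g') + c / a := by
    conv_lhs => rw [h1]
    rw [hinv]
  rw [h2]
  field_simp
  ring

/-! ### Towers with nonincreasing slopes -/

section Sorted

variable {k : Type*} [Field k] [SeriesField k] {σ : k →+* k} {V : Type*} [AddCommGroup V]
  [Module k V]

/-- `N` is obtained by successive extensions by modules of rank `1` with nonincreasing slopes, all
of them at least `m`. -/
inductive SortedTri (Ψ : V →ₛₗ[σ] V) : ℤ → Submodule k V → Prop
  | bot (m : ℤ) : SortedTri Ψ m ⊥
  | step {m : ℤ} {N : Submodule k V} {e : V} {a : k} (hN : SortedTri Ψ m N) (ha : a ≠ 0)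
      (hm : ord a ≤ m) (hmem : e ∉ N) (he : Ψ e - a • e ∈ N) :
      SortedTri Ψ (ord a) (N ⊔ Submodule.span k {e})

theorem SortedTri.tri {Ψ : V →ₛₗ[σ] V} {m : ℤ} {N : Submodule k V} (h : SortedTri Ψ m N) :
    Tri Ψ N := by
  induction h with
  | bot => exact Tri.bot
  | step hN ha hm hmem he ih => exact Tri.step ih ha he

/-- Insertion sort. If the new slope exceeds that of the top vector `e'`, replace `e` by `e + f e'`
to remove the component of `Ψ e - b e` along `e'`. The new vector can then be inserted below `e'`.
The bound on `m'` ensures that `e'` may be put back on top. -/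
theorem SortedTri.insert {Ψ : V →ₛₗ[σ] V}
    (hsplit : ∀ a b c : k, a ≠ 0 → b ≠ 0 → ord a < ord b → ∃ f : k, a * σ f - b * f = c)
    {m : ℤ} {N : Submodule k V} (h : SortedTri Ψ m N) {b : k} (hb : b ≠ 0) :
    ∀ {e : V}, e ∉ N → Ψ e - b • e ∈ N →
      ∃ m', min m (ord b) ≤ m' ∧ SortedTri Ψ m' (N ⊔ Submodule.span k {e}) := by
  induction h with
  | bot m =>
    intro e hmem he
    exact ⟨ord b, min_le_right _ _, SortedTri.step (SortedTri.bot (ord b)) hb le_rfl hmem he⟩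
  | @step m N e' a hN ha hm hmem' he' ih =>
    intro e hmem he
    rcases le_or_gt (ord b) (ord a) with hle | hlt
    · exact ⟨ord b, min_le_right _ _,
        SortedTri.step (SortedTri.step hN ha hm hmem' he') hb hle hmem he⟩
    · obtain ⟨y, hy, z, hz, hyz⟩ := Submodule.mem_sup.1 he
      obtain ⟨c, rfl⟩ := Submodule.mem_span_singleton.1 hz
      -- The component along `e'` of `Ψ e₁ - b e₁` modulo `N` is `c + a σ(f) - b f`; hence the
      -- right-hand side `-c`.
      obtain ⟨f, hf⟩ := hsplit a b (-c) ha hb hlt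
      set e₁ := e + f • e' with he₁
      have hmem₁ : e₁ ∉ N ⊔ Submodule.span k {e'} := by
        intro h1
        refine hmem ?_
        have h2 : e = e₁ - f • e' := by rw [he₁, add_sub_cancel_right]
        rw [h2]
        exact sub_mem h1 (Submodule.mem_sup_right
          (Submodule.smul_mem _ _ (Submodule.mem_span_singleton_self e')))
      have he₁' : Ψ e₁ - b • e₁ ∈ N := by
        have h1 : Ψ e₁ - b • e₁ = y + σ f • (Ψ e' - a • e') := by
          have h2 : Ψ e = b • e + (y + c • e') := by rw [hyz]; abel
          have h3 : (a * σ f - b * f) • e' = -(c • e') := by rw [hf, neg_smul]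
          rw [sub_smul, sub_eq_iff_eq_add] at h3
          rw [he₁, map_add, LinearMap.map_smulₛₗ, h2, smul_sub, smul_add, smul_smul, smul_smul,
            mul_comm (σ f), h3]
          abel
        rw [h1]
        exact N.add_mem hy (N.smul_mem _ he')
      obtain ⟨m', hm', hsorted⟩ := ih (e := e₁) (fun h1 => hmem₁ (Submodule.mem_sup_left h1)) he₁'
      have hmem'' : e' ∉ N ⊔ Submodule.span k {e₁} := by
        intro h1
        obtain ⟨y', hy', z', hz', h2⟩ := Submodule.mem_sup.1 h1
        obtain ⟨t, rfl⟩ := Submodule.mem_span_singleton.1 hz'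
        by_cases ht : t = 0
        · refine hmem' ?_
          rw [← h2, ht, zero_smul, add_zero]
          exact hy'
        · refine hmem₁ ?_
          have h3 : e₁ = t⁻¹ • (e' - y') := by
            rw [← h2, add_sub_cancel_left, inv_smul_smul₀ ht]
          rw [h3]
          exact Submodule.smul_mem _ _ (sub_mem
            (Submodule.mem_sup_right (Submodule.mem_span_singleton_self e'))
            (Submodule.mem_sup_left hy'))
      refine ⟨ord a, min_le_left _ _, ?_⟩
      have hsup : N ⊔ Submodule.span k {e'} ⊔ Submodule.span k {e} =
          N ⊔ Submodule.span k {e₁} ⊔ Submodule.span k {e'} := by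
        have hin : ∀ w : V, w ∈ Submodule.span k {w} := Submodule.mem_span_singleton_self
        apply le_antisymm
        · refine sup_le (sup_le (le_sup_of_le_left le_sup_left) le_sup_right) ?_
          rw [Submodule.span_singleton_le_iff_mem]
          have h2 : e = e₁ - f • e' := by rw [he₁, add_sub_cancel_right]
          rw [h2]
          exact sub_mem (Submodule.mem_sup_left (Submodule.mem_sup_right (hin e₁)))
            (Submodule.mem_sup_right (Submodule.smul_mem _ _ (hin e')))
        · refine sup_le (sup_le (le_sup_of_le_left le_sup_left) ?_)
            (le_sup_of_le_left le_sup_right)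
          rw [Submodule.span_singleton_le_iff_mem]
          exact add_mem (Submodule.mem_sup_right (hin e))
            (Submodule.mem_sup_left (Submodule.mem_sup_right (Submodule.smul_mem _ _ (hin e'))))
      rw [hsup]
      exact SortedTri.step hsorted ha ((le_min hm hlt.le).trans hm') hmem''
        (Submodule.mem_sup_left he')

theorem Tri.exists_sorted {Ψ : V →ₛₗ[σ] V}
    (hsplit : ∀ a b c : k, a ≠ 0 → b ≠ 0 → ord a < ord b → ∃ f : k, a * σ f - b * f = c)
    {N : Submodule k V} (h : Tri Ψ N) : ∃ m, SortedTri Ψ m N := by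
  induction h with
  | bot => exact ⟨0, SortedTri.bot 0⟩
  | @step N e a hN ha he ih =>
    obtain ⟨m, hm⟩ := ih
    by_cases hmem : e ∈ N
    · refine ⟨m, ?_⟩
      rwa [sup_eq_left.2 ((Submodule.span_singleton_le_iff_mem _ _).2 hmem)]
    · obtain ⟨m', -, h'⟩ := hm.insert hsplit ha hmem he
      exact ⟨m', h'⟩

theorem SortedTri.exists_flag {Ψ : V →ₛₗ[σ] V} {m : ℤ} {N : Submodule k V}
    (h : SortedTri Ψ m N) :
    ∃ (n : ℕ) (F : Fin (n + 1) → Submodule k V) (e : Fin n → V) (a : Fin n → k),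
      (∀ i, Tri Ψ (F i)) ∧ F 0 = ⊥ ∧ F (Fin.last n) = N ∧
      (∀ i : Fin n, F i.succ = F i.castSucc ⊔ Submodule.span k {e i}) ∧
      (∀ i : Fin n, e i ∉ F i.castSucc) ∧ (∀ i : Fin n, Ψ (e i) - a i • e i ∈ F i.castSucc) ∧
      (∀ i, a i ≠ 0) ∧ (∀ i, m ≤ ord (a i)) ∧ Antitone fun i => ord (a i) := by
  induction h with
  | bot m =>
    exact ⟨0, fun _ => ⊥, Fin.elim0, Fin.elim0, fun _ => Tri.bot, rfl, rfl, fun i => i.elim0,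
      fun i => i.elim0, fun i => i.elim0, fun i => i.elim0, fun i => i.elim0, fun i => i.elim0⟩
  | @step m N e a hN ha hm hmem he ih =>
    obtain ⟨n, F, e', a', hF, h0, hlast, hsucc, hnot, happ, ha', hm', hanti⟩ := ih
    refine ⟨n + 1, Fin.snoc (α := fun _ => Submodule k V) F (N ⊔ Submodule.span k {e}),
      Fin.snoc (α := fun _ => V) e' e, Fin.snoc (α := fun _ => k) a' a,
      ?_, ?_, ?_, ?_, ?_, ?_, ?_, ?_, ?_⟩
    · intro i
      induction i using Fin.lastCases with
      | last => rw [Fin.snoc_last]; exact Tri.step hN.tri ha he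
      | cast i => rw [Fin.snoc_castSucc]; exact hF i
    · rw [← Fin.castSucc_zero, Fin.snoc_castSucc, h0]
    · rw [Fin.snoc_last]
    · intro i
      induction i using Fin.lastCases with
      | last => rw [Fin.succ_last, Fin.snoc_last, Fin.snoc_castSucc, Fin.snoc_last, hlast]
      | cast i =>
        rw [Fin.succ_castSucc, Fin.snoc_castSucc, Fin.snoc_castSucc, Fin.snoc_castSucc, hsucc]
    · intro i
      induction i using Fin.lastCases with
      | last => rw [Fin.snoc_last, Fin.snoc_castSucc, hlast]; exact hmem
      | cast i => rw [Fin.snoc_castSucc, Fin.snoc_castSucc]; exact hnot i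
    · intro i
      induction i using Fin.lastCases with
      | last => rw [Fin.snoc_last, Fin.snoc_last, Fin.snoc_castSucc, hlast]; exact he
      | cast i => rw [Fin.snoc_castSucc, Fin.snoc_castSucc, Fin.snoc_castSucc]; exact happ i
    · intro i
      induction i using Fin.lastCases with
      | last => rw [Fin.snoc_last]; exact ha
      | cast i => rw [Fin.snoc_castSucc]; exact ha' i
    · intro i
      induction i using Fin.lastCases with
      | last => rw [Fin.snoc_last]
      | cast i => rw [Fin.snoc_castSucc]; exact hm.trans (hm' i)
    · intro i j hij
      dsimp only
      induction j using Fin.lastCases with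
      | last =>
        rw [Fin.snoc_last]
        induction i using Fin.lastCases with
        | last => rw [Fin.snoc_last]
        | cast i => rw [Fin.snoc_castSucc]; exact hm.trans (hm' i)
      | cast j =>
        induction i using Fin.lastCases with
        | last => exact absurd hij (not_le.2 (Fin.castSucc_lt_last j))
        | cast i =>
          rw [Fin.snoc_castSucc, Fin.snoc_castSucc]
          exact hanti (Fin.castSucc_le_castSucc_iff.1 hij)

end Sorted

/-! ### Triangularizations of ramified modules -/

section Ramified

variable {B : BaseField} {τ : ℂ}

theorem sigma_qOf_neg (τ : ℂ) (a : B.K) : B.sigma (qOf τ) (B.sigma (qOf (-τ)) a) = a := by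
  refine Subtype.ext ?_
  change dilHom (qOf τ) (dilHom (qOf (-τ)) _) = _
  have : qOf τ * qOf (-τ) = 1 := by
    ext
    simp only [qOf, Units.val_mul, Units.val_mk0, Units.val_one]
    rw [← Complex.exp_add, ← Complex.exp_zero]
    congr 1
    ring
  rw [dilHom_dilHom, this, dilHom_one]
  rfl

/-- The inverse of a bijective `σ_q`-linear map. -/
theorem exists_inverse {M : Type*} [AddCommGroup M] [Module B.K M]
    (Φ : M →ₛₗ[B.sigma (qOf τ)] M) (hΦ : Function.Bijective Φ) :
    ∃ T : M →ₛₗ[B.sigma (qOf (-τ))] M, (∀ x, Φ (T x) = x) ∧ ∀ x, T (Φ x) = x := by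
  let E := Equiv.ofBijective Φ hΦ
  have hE : ∀ x, Φ (E.symm x) = x := E.apply_symm_apply
  refine ⟨{ toFun := E.symm, map_add' := fun x y => ?_, map_smul' := fun c x => ?_ }, hE,
    E.symm_apply_apply⟩
  · apply hΦ.1
    rw [hE, map_add Φ, hE, hE]
  · apply hΦ.1
    rw [LinearMap.map_smulₛₗ, hE, hE, sigma_qOf_neg]

theorem one_lt_norm_qRoot (hτ : 1 < ‖(qOf τ : ℂ)‖) (l : ℕ+) : 1 < ‖(qRoot τ l : ℂ)‖ := by
  rw [← qRoot_pow τ l, Units.val_pow_eq_pow_val, norm_pow] at hτ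
  by_contra h
  exact absurd (pow_le_one₀ (norm_nonneg _) (not_lt.1 h)) (not_le.2 hτ)

theorem norm_qOf_neg (hτ : 1 < ‖(qOf τ : ℂ)‖) : ‖(qOf (-τ) : ℂ)‖ < 1 := by
  have h : (qOf (-τ) : ℂ) = (qOf τ : ℂ)⁻¹ := by
    simp only [qOf, Units.val_mk0]
    rw [← Complex.exp_neg]
    congr 1
    ring
  rw [h, norm_inv]
  exact inv_lt_one_of_one_lt₀ hτ

theorem sigma_qRoot_neg' (τ : ℂ) (l : ℕ+) (a : B.Ram l) :
    BaseField.Ram.sigma B l (qRoot τ l) (BaseField.Ram.sigma B l (qRoot (-τ) l) a) = a := by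
  have := sigma_qRoot_neg (-τ) l a
  rwa [neg_neg] at this

/-- `exists_tri` requires a dilation of modulus below `1`, so it is applied to the inverse of `Φ`,
with parameter `-τ`. The tower is then transferred to `Φ` by `Tri.inverse`. -/
theorem exists_tri_ramify (hτ : 1 < ‖(qOf τ : ℂ)‖) {M : Type*} [AddCommGroup M] [Module B.K M]
    [FiniteDimensional B.K M] (Φ : M →ₛₗ[B.sigma (qOf τ)] M) (hΦ : Function.Bijective Φ) :
    ∃ l : ℕ+, Tri (ramify l Φ) ⊤ := by
  obtain ⟨T, hΦT, hTΦ⟩ := exists_inverse Φ hΦ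
  obtain ⟨l, hl⟩ := exists_tri _ (τ := -τ) (τ' := τ) (neg_neg τ).symm (norm_qOf_neg hτ) T Φ hΦT rfl
  refine ⟨l, Tri.inverse (T := ramify l T) (ramify_inverse l (sigma_qRoot_neg' τ l) hΦT) ?_⟩
  have h1 : Tri (ramify l T) (Submodule.span (B.Ram l) (Set.range (oneTmul B l M))) := by
    refine @hl (qOf (-τ / (l : ℕ))) rfl (B.Ram l ⊗[B.K] M) inferInstance
      (inferInstance : Module (B.Ram l) (B.Ram l ⊗[B.K] M)) (ramify l T) (oneTmul B l M) ?_
    intro x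
    change 1 ⊗ₜ T x = BaseField.Ram.sigma B l (qRoot (-τ) l) 1 ⊗ₜ T x
    rw [map_one]
  have h2 : Submodule.span (B.Ram l) (Set.range (oneTmul B l M)) = ⊤ := by
    rw [eq_top_iff]
    rintro x -
    induction x with
    | zero => exact zero_mem _
    | add x y hx hy => exact add_mem hx hy
    | tmul a m =>
      have : a ⊗ₜ[B.K] m = a • oneTmul B l M m := by
        change _ = a • ((1 : B.Ram l) ⊗ₜ[B.K] m)
        rw [TensorProduct.smul_tmul', smul_eq_mul, mul_one]
      rw [this]
      exact Submodule.smul_mem _ _ (Submodule.subset_span ⟨m, rfl⟩)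
  rwa [h2] at h1

theorem tri_ramify_of_surjective {l : ℕ+} {M M' : Type*} [AddCommGroup M] [Module B.K M]
    [AddCommGroup M'] [Module B.K M'] {Φ : M →ₛₗ[B.sigma (qOf τ)] M}
    {Φ' : M' →ₛₗ[B.sigma (qOf τ)] M'} (f : M →ₗ[B.K] M') (hf : Function.Surjective f)
    (hcomm : ∀ x, f (Φ x) = Φ' (f x)) (h : Tri (ramify l Φ) ⊤) : Tri (ramify l Φ') ⊤ := by
  have h1 := h.map (T' := ramify l Φ') (f.baseChange (B.Ram l)) (by
    intro x
    induction x with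
    | zero => simp
    | add x y hx hy => rw [map_add, map_add, map_add, map_add, hx, hy]
    | tmul a m =>
      change BaseField.Ram.sigma B l (qRoot τ l) a ⊗ₜ f (Φ m) =
        BaseField.Ram.sigma B l (qRoot τ l) a ⊗ₜ Φ' (f m)
      rw [hcomm])
  rwa [Submodule.map_top, LinearMap.range_eq_top.2] at h1
  exact LinearMap.lTensor_surjective (B.Ram l) hf

theorem exists_sorted_triangularization (hτ : 1 < ‖(qOf τ : ℂ)‖) {l : ℕ+} {M : Type*}
    [AddCommGroup M] [Module B.K M] {Φ : M →ₛₗ[B.sigma (qOf τ)] M} (hΦ : Function.Bijective Φ)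
    (h : Tri (ramify l Φ) ⊤) :
    ∃ T : Triangularization (ramify l Φ), (∀ i, T.a i ≠ 0) ∧ Antitone fun i => ord (T.a i) := by
  obtain ⟨T, hΦT, hTΦ⟩ := exists_inverse Φ hΦ
  have hinv := ramify_inverse l (sigma_qRoot_neg τ l) hTΦ
  have hsplit : ∀ a b c : B.Ram l, a ≠ 0 → b ≠ 0 → ord a < ord b →
      ∃ f : B.Ram l, a * BaseField.Ram.sigma B l (qRoot τ l) f - b * f = c :=
    fun a b c ha hb hab => B.exists_split (one_lt_norm_qRoot hτ l) (a := a) (b := b) c ha hb hab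
  obtain ⟨m, hm⟩ := h.exists_sorted hsplit
  obtain ⟨n, F, e, a, hF, h0, hlast, hsucc, hnot, happ, ha, -, hanti⟩ := hm.exists_flag
  refine ⟨⟨n, F, e, a, fun i x => ⟨fun hx => ?_, (hF i).apply_mem x⟩, h0, hlast, hsucc, hnot, happ⟩,
    ha, hanti⟩
  rw [← hinv x]
  exact ((hF i).inverse hinv).apply_mem _ hx

/-- A tower for `M₁ × M₂` at one level `l` projects to towers for both factors, which are then
sorted separately. -/
theorem exists_common_triangularization (hτ : 1 < ‖(qOf τ : ℂ)‖) {M₁ M₂ : Type*}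
    [AddCommGroup M₁] [Module B.K M₁] [FiniteDimensional B.K M₁]
    [AddCommGroup M₂] [Module B.K M₂] [FiniteDimensional B.K M₂]
    {Φ₁ : M₁ →ₛₗ[B.sigma (qOf τ)] M₁} (hΦ₁ : Function.Bijective Φ₁)
    {Φ₂ : M₂ →ₛₗ[B.sigma (qOf τ)] M₂} (hΦ₂ : Function.Bijective Φ₂) :
    ∃ (l : ℕ+) (T₁ : Triangularization (ramify l Φ₁)) (T₂ : Triangularization (ramify l Φ₂)),
      (∀ i, T₁.a i ≠ 0) ∧ (Antitone fun i => ord (T₁.a i)) ∧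
      (∀ i, T₂.a i ≠ 0) ∧ Antitone fun i => ord (T₂.a i) := by
  let Φ : M₁ × M₂ →ₛₗ[B.sigma (qOf τ)] M₁ × M₂ :=
    { toFun := fun x => (Φ₁ x.1, Φ₂ x.2)
      map_add' := fun x y => by simp
      map_smul' := fun c x => by simp [LinearMap.map_smulₛₗ] }
  obtain ⟨l, hl⟩ := exists_tri_ramify hτ Φ (hΦ₁.prodMap hΦ₂)
  obtain ⟨T₁, h1, h1'⟩ := exists_sorted_triangularization hτ hΦ₁
    (tri_ramify_of_surjective (LinearMap.fst B.K M₁ M₂) Prod.fst_surjective (fun _ => rfl) hl)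
  obtain ⟨T₂, h2, h2'⟩ := exists_sorted_triangularization hτ hΦ₂
    (tri_ramify_of_surjective (LinearMap.snd B.K M₁ M₂) Prod.snd_surjective (fun _ => rfl) hl)
  exact ⟨l, T₁, T₂, h1, h1', h2, h2'⟩

end Ramified

/-! ## Growth and ramification -/

section RamifiedGrowth

variable {B : BaseField} {τ : ℂ} {l : ℕ+} {M : Type*} [AddCommGroup M] [Module B.K M]

theorem iterate_ramify_one_tmul (Φ : M →ₛₗ[B.sigma (qOf τ)] M) (n : ℕ) (x : M) :
    (ramify l Φ)^[n] ((1 : B.Ram l) ⊗ₜ[B.K] x) = (1 : B.Ram l) ⊗ₜ[B.K] Φ^[n] x := by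
  induction n with
  | zero => rfl
  | succ n ih =>
    rw [Function.iterate_succ_apply', ih, Function.iterate_succ_apply']
    change BaseField.Ram.sigma B l (qRoot τ l) 1 ⊗ₜ _ = _
    rw [map_one]

theorem valGE_algebraMap {f : B.K} {t : ℚ} (h : ValGE f t) :
    ValGE (algebraMap B.K (B.Ram l) f) (l * t) :=
  valGE_ram (l := l) h

theorem one_tmul_mem_growth [FiniteDimensional B.K M] {Φ : M →ₛₗ[B.sigma (qOf τ)] M} {μ : ℚ}
    {x : M} (hx : x ∈ growth Φ μ) :
    (1 : B.Ram l) ⊗ₜ[B.K] x ∈ growth (ramify l Φ) (l * μ) := by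
  intro φ
  let b := Module.finBasis B.K M
  choose C hC using fun i => hx (b.coord i)
  let D : Fin (Module.finrank B.K M) → ℚ := fun i =>
    l * |C i| + |(ord (φ ((1 : B.Ram l) ⊗ₜ b i)) : ℚ)|
  refine ⟨∑ i, D i, fun n => ?_⟩
  have h1 : (1 : B.Ram l) ⊗ₜ[B.K] Φ^[n] x =
      ∑ i, algebraMap B.K (B.Ram l) (b.coord i (Φ^[n] x)) • ((1 : B.Ram l) ⊗ₜ[B.K] b i) := by
    conv_lhs => rw [← b.sum_repr (Φ^[n] x)]
    rw [TensorProduct.tmul_sum]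
    refine Finset.sum_congr rfl fun i _ => ?_
    exact (oneTmul B l M).map_smulₛₗ _ _
  rw [iterate_ramify_one_tmul, h1, map_sum]
  refine ValGE.sum _ fun i _ => ?_
  rw [map_smul, smul_eq_mul]
  refine ((valGE_algebraMap (hC i n)).mul (valGE_ord _)).mono ?_
  have h2 : D i ≤ ∑ i, D i := Finset.single_le_sum (f := D) (fun i _ => by positivity)
    (Finset.mem_univ i)
  have hl : (0 : ℚ) ≤ (l : ℕ) := by positivity
  have h3 := mul_le_mul_of_nonneg_left (le_abs_self (C i)) hl
  have h4 := neg_abs_le (ord (φ ((1 : B.Ram l) ⊗ₜ b i)) : ℚ)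
  simp only [D] at h2
  simp only [D]
  linarith

/-- The `K`-linear map `K_l → K` that extracts the coefficients of exponent `≡ s` modulo `l`. -/
def sectionMap (B : BaseField) (l : ℕ+) (s : ℤ) : B.Ram l →ₗ[B.K] B.K where
  toFun f := ⟨section₀ l s ((show B.K from f) : LaurentSeries ℂ),
    B.section₀_mem l s (show B.K from f).2⟩
  map_add' _ _ := Subtype.ext (map_add (section₀ l s) _ _)
  map_smul' a _ := Subtype.ext (section₀_ramHom_mul l s a _)

theorem valGE_sectionMap {s : ℤ} {f : B.Ram l} {t : ℚ} (h : ValGE f t) :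
    ValGE (sectionMap B l s f) ((t - s) / l) := by
  intro n hn
  have hl : (0 : ℚ) < (l : ℕ) := by exact_mod_cast l.pos
  rw [lt_div_iff₀ hl] at hn
  refine h (l * n + s) ?_
  push_cast
  linarith

theorem sectionMap_sigma (s : ℤ) (f : B.Ram l) :
    sectionMap B l s (BaseField.Ram.sigma B l (qRoot τ l) f) =
      B.const ((qRoot τ l : ℂ) ^ s) * B.sigma (qOf τ) (sectionMap B l s f) := by
  refine Subtype.ext ?_
  refine (section₀_dilHom l s (qRoot τ l) _).trans ?_
  rw [qRoot_pow]
  rfl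

theorem sectionMap_zero_one : sectionMap B l 0 1 = 1 := by
  refine Subtype.ext ?_
  change section₀ l 0 1 = 1
  ext n
  rw [section₀_coeff, HahnSeries.coeff_one, HahnSeries.coeff_one, add_zero]
  simp

/-- The `n`-th power of the uniformizer of `K_l`. -/
def ramZPow (B : BaseField) (l : ℕ+) (n : ℤ) : B.Ram l :=
  (⟨HahnSeries.single n 1, B.single_mem n 1⟩ : B.K)

theorem sum_sectionMap (f : B.Ram l) :
    ∑ s : Fin l, ramZPow B l (s : ℤ) * algebraMap B.K (B.Ram l) (sectionMap B l (s : ℤ) f) = f := by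
  have h := sum_section₀ l ((show B.K from f) : LaurentSeries ℂ)
  refine Subtype.ext (Eq.trans ?_ h)
  exact map_sum B.toSubfield.subtype _ _

/-- The extension of `sectionMap` to modules. -/
def sectionModule (l : ℕ+) (s : ℤ) (M : Type*) [AddCommGroup M] [Module B.K M] :
    (B.Ram l ⊗[B.K] M) →ₗ[B.K] M :=
  (TensorProduct.lid B.K M).toLinearMap ∘ₗ (sectionMap B l s).rTensor M

theorem sectionModule_tmul (s : ℤ) (a : B.Ram l) (m : M) :
    sectionModule l s M (a ⊗ₜ m) = sectionMap B l s a • m := by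
  simp [sectionModule]

theorem sum_sectionModule (x : B.Ram l ⊗[B.K] M) :
    ∑ s : Fin l, ramZPow B l (s : ℤ) • ((1 : B.Ram l) ⊗ₜ[B.K] sectionModule l (s : ℤ) M x) = x := by
  induction x with
  | zero => simp
  | add x y hx hy =>
    simp only [map_add, TensorProduct.tmul_add, smul_add, Finset.sum_add_distrib, hx, hy]
  | tmul a m =>
    conv_rhs => rw [← sum_sectionMap a, TensorProduct.sum_tmul]
    refine Finset.sum_congr rfl fun s _ => ?_
    rw [sectionModule_tmul, TensorProduct.smul_tmul', ← TensorProduct.smul_tmul, Algebra.smul_def,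
      smul_eq_mul, mul_one, mul_comm]

/-- Dilating `z_l^(l n + s)` by `q_l` gives `q^n q_l^s`: the sections commute with the operators up
to the constant `q_l^s`, which `σ_q` fixes and which cannot lower valuations. -/
theorem sectionModule_ramify (Φ : M →ₛₗ[B.sigma (qOf τ)] M) (s : ℤ) (x : B.Ram l ⊗[B.K] M) :
    sectionModule l s M (ramify l Φ x) =
      B.const ((qRoot τ l : ℂ) ^ s) • Φ (sectionModule l s M x) := by
  induction x with
  | zero => simp
  | add x y hx hy => rw [map_add, map_add, hx, hy, map_add, map_add, smul_add]
  | tmul a m =>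
    change sectionModule l s M (BaseField.Ram.sigma B l (qRoot τ l) a ⊗ₜ Φ m) = _
    rw [sectionModule_tmul, sectionModule_tmul, sectionMap_sigma, LinearMap.map_smulₛₗ, mul_smul]

theorem const_mul (w w' : ℂ) : B.const w * B.const w' = B.const (w * w') := by
  refine Subtype.ext ?_
  change (HahnSeries.single 0 w : LaurentSeries ℂ) * HahnSeries.single 0 w' = _
  rw [HahnSeries.single_mul_single, add_zero]
  rfl

theorem valGE_const (w : ℂ) : ValGE (B.const w) 0 := by
  intro n hn
  change (HahnSeries.single 0 w : LaurentSeries ℂ).coeff n = 0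
  rw [HahnSeries.coeff_single_of_ne]
  rintro rfl
  simp at hn

theorem sectionModule_iterate (Φ : M →ₛₗ[B.sigma (qOf τ)] M) (s : ℤ) (n : ℕ)
    (x : B.Ram l ⊗[B.K] M) : ∃ w : ℂ,
      Φ^[n] (sectionModule l s M x) = B.const w • sectionModule l s M ((ramify l Φ)^[n] x) := by
  induction n with
  | zero => exact ⟨1, by rw [show B.const 1 = 1 from rfl, one_smul]; rfl⟩
  | succ n ih =>
    obtain ⟨w, hw⟩ := ih
    have hq : (qRoot τ l : ℂ) ^ s ≠ 0 := zpow_ne_zero _ (qRoot τ l).ne_zero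
    refine ⟨w * ((qRoot τ l : ℂ) ^ s)⁻¹, ?_⟩
    rw [Function.iterate_succ_apply', hw, LinearMap.map_smulₛₗ, sigma_const,
      Function.iterate_succ_apply', sectionModule_ramify, smul_smul, const_mul,
      inv_mul_cancel_right₀ hq]

theorem sectionModule_mem_growth {Φ : M →ₛₗ[B.sigma (qOf τ)] M} {μ : ℚ} {x : B.Ram l ⊗[B.K] M}
    (hx : x ∈ growth (ramify l Φ) (l * μ)) (s : ℤ) : sectionModule l s M x ∈ growth Φ μ := by
  intro φ
  -- A form on `M` after a section equals the same section after the base-changed form, so the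
  -- growth hypothesis over `K_l` applies. Taking a section divides valuations by `l`, up to the
  -- shift `s`.
  let φ' : (B.Ram l ⊗[B.K] M) →ₗ[B.Ram l] B.Ram l :=
    (Algebra.TensorProduct.rid B.K (B.Ram l) (B.Ram l)).toLinearMap ∘ₗ φ.baseChange (B.Ram l)
  have hφ' : ∀ y, φ (sectionModule l s M y) = sectionMap B l s (φ' y) := by
    intro y
    induction y with
    | zero => simp
    | add y z hy hz => simp only [map_add, hy, hz]
    | tmul a m =>
      have h1 : φ' (a ⊗ₜ m) = φ m • a := by simp [φ']
      rw [h1, sectionModule_tmul, map_smul, map_smul, smul_eq_mul, smul_eq_mul, mul_comm]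
  obtain ⟨C, hC⟩ := hx φ'
  refine ⟨(C + s) / l, fun n => ?_⟩
  obtain ⟨w, hw⟩ := sectionModule_iterate Φ s n x
  rw [hw, map_smul, smul_eq_mul, hφ']
  refine ((valGE_const w).mul (valGE_sectionMap (hC n))).mono (le_of_eq ?_)
  have hl : ((l : ℕ) : ℚ) ≠ 0 := by exact_mod_cast l.ne_zero
  field_simp
  ring

theorem sectionModule_one_tmul (x : M) :
    sectionModule l 0 M ((1 : B.Ram l) ⊗ₜ[B.K] x) = x := by
  rw [sectionModule_tmul, sectionMap_zero_one, one_smul]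

/-- The section of exponent `0` sends every `K_l`-multiple of `1 ⊗ w`, `w ∈ S`, into `S`, and sends
`1 ⊗ z` to `z`. -/
theorem mem_of_one_tmul_mem_span {S : Submodule B.K M} {z : M}
    (hz : (1 : B.Ram l) ⊗ₜ[B.K] z ∈
      Submodule.span (B.Ram l) ((fun w : M => (1 : B.Ram l) ⊗ₜ[B.K] w) '' S)) : z ∈ S := by
  have key : ∀ y ∈ Submodule.span (B.Ram l) ((fun w : M => (1 : B.Ram l) ⊗ₜ[B.K] w) '' S),
      ∀ c : B.Ram l, sectionModule l 0 M (c • y) ∈ S := by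
    intro y hy
    induction hy using Submodule.span_induction with
    | mem y hy =>
      obtain ⟨w, hw, rfl⟩ := hy
      intro c
      dsimp only
      rw [TensorProduct.smul_tmul', sectionModule_tmul]
      exact S.smul_mem _ hw
    | zero => intro c; rw [smul_zero, map_zero]; exact zero_mem _
    | add y y' _ _ h h' => intro c; rw [smul_add, map_add]; exact add_mem (h c) (h' c)
    | smul a y _ h => intro c; rw [smul_smul]; exact h _
  have := key _ hz 1
  rwa [one_smul, sectionModule_one_tmul] at this

end RamifiedGrowth

/-! ## Triangularizations and growth -/

section TriangularizationGrowth

variable {k : Type*} [Field k] {σ : k →+* k} {V : Type*} [AddCommGroup V] [Module k V]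
  {Ψ : V →ₛₗ[σ] V} (T : Triangularization Ψ)

theorem Triangularization.monotone : Monotone T.N := by
  refine Fin.monotone_iff_le_succ.2 fun i => ?_
  rw [T.succ]
  exact le_sup_left

theorem Triangularization.e_mem (i : Fin T.n) : T.e i ∈ T.N i.succ := by
  rw [T.succ]
  exact Submodule.mem_sup_right (Submodule.mem_span_singleton_self _)

theorem Triangularization.e_mem_of_lt {i j : Fin T.n} (h : j < i) : T.e j ∈ T.N i.castSucc :=
  T.monotone (Fin.succ_le_castSucc_iff.2 h) (T.e_mem j)

theorem Triangularization.span_e : Submodule.span k (Set.range T.e) = ⊤ := by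
  have : ∀ i, T.N i ≤ Submodule.span k (Set.range T.e) := by
    intro i
    induction i using Fin.induction with
    | zero => rw [T.bot]; exact bot_le
    | succ i ih =>
      rw [T.succ]
      refine sup_le ih ?_
      rw [Submodule.span_singleton_le_iff_mem]
      exact Submodule.subset_span ⟨i, rfl⟩
  rw [eq_top_iff, ← T.top]
  exact this _

theorem Triangularization.exists_dual (i : Fin T.n) :
    ∃ φ : V →ₗ[k] k, (∀ x ∈ T.N i.castSucc, φ x = 0) ∧ φ (T.e i) ≠ 0 := by
  obtain ⟨φ, h1, h2⟩ := Submodule.exists_le_ker_of_notMem (T.notMem i)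
  exact ⟨φ, fun x hx => h2 hx, h1⟩

variable [SeriesField k] [Isometric σ]

theorem Triangularization.le_growth {μ : ℚ} (i : Fin (T.n + 1)) :
    (∀ j : Fin T.n, j.castSucc < i → μ ≤ ord (T.a j)) → T.N i ≤ growth Ψ μ := by
  induction i using Fin.induction with
  | zero => intro _; rw [T.bot]; exact bot_le
  | succ i ih =>
    intro h
    have h1 := ih fun j hj => h j (hj.trans (Fin.castSucc_lt_succ))
    rw [T.succ]
    refine sup_le h1 ?_
    rw [Submodule.span_singleton_le_iff_mem]
    exact mem_growth_of_sub_mem ((valGE_ord _).mono (h i Fin.castSucc_lt_succ)) (h1 (T.apply_e i))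

/-- All earlier slopes are at least that of `e i`, so the whole step of the tower containing `e i`
grows at its rate. This is what sorting provides. -/
theorem Triangularization.e_mem_growth (hanti : Antitone fun i => ord (T.a i)) (i : Fin T.n) :
    T.e i ∈ growth Ψ (ord (T.a i)) := by
  refine T.le_growth i.succ (fun j hj => ?_) (T.e_mem i)
  have : j ≤ i := Fin.castSucc_lt_succ_iff.1 hj
  exact_mod_cast hanti this

variable {W : Type*} [AddCommGroup W] [Module k W] {Ψ' : W →ₛₗ[σ] W} (T' : Triangularization Ψ')

theorem mem_span_of_mem_growth (ha : ∀ i, T.a i ≠ 0) (ha' : ∀ i, T'.a i ≠ 0)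
    (hanti : Antitone fun i => ord (T.a i)) (hanti' : Antitone fun i => ord (T'.a i)) {μ : ℚ}
    {x : V ⊗[k] W} (hx : x ∈ growth (TensorProduct.map Ψ Ψ') μ) :
    x ∈ Submodule.span k {y | ∃ i j, μ ≤ ord (T.a i) + ord (T'.a j) ∧
      y = T.e i ⊗ₜ[k] T'.e j} := by
  classical
  have hspan : Submodule.span k (Set.range fun p : Fin T.n × Fin T'.n =>
      T.e p.1 ⊗ₜ[k] T'.e p.2) = ⊤ := by
    rw [← TensorProduct.map₂_mk_top_top_eq_top, ← T.span_e, ← T'.span_e, Submodule.map₂_span_span]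
    congr 1
    ext y
    simp [Set.mem_image2]
  have hx' : x ∈ Submodule.span k (Set.range fun p : Fin T.n × Fin T'.n =>
      T.e p.1 ⊗ₜ[k] T'.e p.2) := hspan ▸ Submodule.mem_top
  obtain ⟨c, rfl⟩ := (Submodule.mem_span_range_iff_exists_fun k).1 hx'
  by_cases hgood : ∀ p : Fin T.n × Fin T'.n, c p ≠ 0 → μ ≤ ord (T.a p.1) + ord (T'.a p.2)
  · refine Submodule.sum_mem _ fun p _ => ?_
    by_cases hp : c p = 0
    · rw [hp, zero_smul]; exact zero_mem _
    · exact Submodule.smul_mem _ _ (Submodule.subset_span ⟨p.1, p.2, hgood p hp, rfl⟩)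
  exfalso
  push Not at hgood
  obtain ⟨p₀, hp₀, hp₀'⟩ := hgood
  -- A maximal offending pair for the product order on indices. Beyond it total slopes are no
  -- larger, so any nonzero coefficient there would offend too; by maximality those coefficients
  -- vanish.
  obtain ⟨p, hp⟩ := ((Finset.univ.filter fun p : Fin T.n × Fin T'.n =>
    c p ≠ 0 ∧ (ord (T.a p.1) + ord (T'.a p.2) : ℚ) < μ)).exists_maximal
      ⟨p₀, Finset.mem_filter.2 ⟨Finset.mem_univ _, hp₀, hp₀'⟩⟩
  obtain ⟨hcp, hlt⟩ := (Finset.mem_filter.1 hp.1).2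
  obtain ⟨i, j⟩ := p
  dsimp only at hlt
  obtain ⟨φ, hφ, hφe⟩ := T.exists_dual i
  obtain ⟨φ', hφ', hφe'⟩ := T'.exists_dual j
  -- `E` contains every `e i' ⊗ e' j'` with `i' < i` or `j' < j`, and is killed by `φ ⊗ φ'`. Modulo
  -- `E`, `x` is its `(i, j)` term, an eigenvector of multiplier `T.a i * T'.a j`.
  set E : Submodule k (V ⊗[k] W) :=
    Submodule.map₂ (TensorProduct.mk k V W) (T.N i.castSucc) ⊤ ⊔
      Submodule.map₂ (TensorProduct.mk k V W) ⊤ (T'.N j.castSucc) with hE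
  have hE1 : ∀ v ∈ T.N i.castSucc, ∀ w : W, v ⊗ₜ[k] w ∈ E := fun v hv w =>
    Submodule.mem_sup_left (Submodule.apply_mem_map₂ _ hv Submodule.mem_top)
  have hE2 : ∀ v : V, ∀ w ∈ T'.N j.castSucc, v ⊗ₜ[k] w ∈ E := fun v w hw =>
    Submodule.mem_sup_right (Submodule.apply_mem_map₂ _ Submodule.mem_top hw)
  have hEstable : E ≤ E.comap (TensorProduct.map Ψ Ψ') := by
    refine sup_le (Submodule.map₂_le.2 fun v hv w _ => ?_) (Submodule.map₂_le.2 fun v _ w hw => ?_)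
    · exact hE1 _ ((T.isDiffSubmodule _ v).2 hv) _
    · exact hE2 _ _ ((T'.isDiffSubmodule _ w).2 hw)
  let θ : V ⊗[k] W →ₗ[k] k := LinearMap.mul' k k ∘ₗ TensorProduct.map φ φ'
  have hθ : ∀ v w, θ (v ⊗ₜ w) = φ v * φ' w := fun v w => rfl
  have hθE : E ≤ LinearMap.ker θ := by
    refine sup_le (Submodule.map₂_le.2 fun v hv w _ => ?_) (Submodule.map₂_le.2 fun v _ w hw => ?_)
    · change θ (v ⊗ₜ w) = 0
      rw [hθ, hφ v hv, zero_mul]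
    · change θ (v ⊗ₜ w) = 0
      rw [hθ, hφ' w hw, mul_zero]
  have hle := le_ord_of_mem_growth (E := E) (fun x hx => hEstable hx) (u := T.e i ⊗ₜ[k] T'.e j)
    (α := T.a i * T'.a j) (mul_ne_zero (ha i) (ha' j)) (by
      have : TensorProduct.map Ψ Ψ' (T.e i ⊗ₜ[k] T'.e j) -
          (T.a i * T'.a j) • (T.e i ⊗ₜ[k] T'.e j) =
          (Ψ (T.e i) - T.a i • T.e i) ⊗ₜ[k] Ψ' (T'.e j) +
            (T.a i • T.e i) ⊗ₜ[k] (Ψ' (T'.e j) - T'.a j • T'.e j) := by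
        rw [TensorProduct.map_tmul, TensorProduct.sub_tmul, TensorProduct.tmul_sub,
          TensorProduct.smul_tmul_smul]
        abel
      rw [this]
      exact add_mem (hE1 _ (T.apply_e i) _) (hE2 _ _ (T'.apply_e j)))
    (φ := θ) (fun x hx => hθE hx) (by rw [hθ]; exact mul_ne_zero hφe hφe') hcp (by
      rw [← Finset.sum_erase_add _ _ (Finset.mem_univ (i, j)), add_sub_cancel_right]
      refine Submodule.sum_mem _ fun p hpmem => ?_
      by_cases hc : c p = 0
      · rw [hc, zero_smul]; exact zero_mem _
      refine E.smul_mem _ ?_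
      by_cases h1 : p.1 < i
      · exact hE1 _ (T.e_mem_of_lt h1) _
      by_cases h2 : p.2 < j
      · exact hE2 _ _ (T'.e_mem_of_lt h2)
      exfalso
      have hge : ((i, j) : Fin T.n × Fin T'.n) ≤ p := ⟨not_lt.1 h1, not_lt.1 h2⟩
      have e1 : ord (T.a p.1) ≤ ord (T.a i) := hanti hge.1
      have e2 : ord (T'.a p.2) ≤ ord (T'.a j) := hanti' hge.2
      have e3 : (ord (T.a p.1) + ord (T'.a p.2) : ℚ) ≤ ord (T.a i) + ord (T'.a j) := by
        exact_mod_cast add_le_add e1 e2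
      have := hp.2 (Finset.mem_filter.2 ⟨Finset.mem_univ _, hc, e3.trans_lt hlt⟩) hge
      exact Finset.ne_of_mem_erase hpmem (le_antisymm this hge)) hx
  rw [ord_mul (ha i) (ha' j)] at hle
  push_cast at hle
  linarith

end TriangularizationGrowth

/-! ## The slope filtration -/

section SlopeFiltration

variable {B : BaseField} {τ : ℂ}

/-- If `a i = 0`, then `Ψ (e i)` lies in the previous step, and stability under `Ψ⁻¹` puts `e i`
there as well. -/
theorem triangularization_a_ne_zero {k V : Type*} [Field k] [AddCommGroup V] [Module k V]
    {σ : k →+* k} {Ψ : V →ₛₗ[σ] V} (T : Triangularization Ψ) (i : Fin T.n) : T.a i ≠ 0 := by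
  intro h
  have h1 := T.apply_e i
  rw [h, zero_smul, sub_zero] at h1
  exact T.notMem i ((T.isDiffSubmodule _ _).1 h1)

/-- A submodule with slopes at least `μ` is triangularized after ramification; its tower grows at
rate `l μ`, and a section brings this back to `K`. Conversely, in any triangularization of the
ramified growth submodule each `e i` has growth `l μ`, which bounds its slope below. Hence the
independence of the slopes from the tower is never needed. -/
theorem slopeFiltration_eq_growth (hτ : 1 < ‖(qOf τ : ℂ)‖) {M : Type*} [AddCommGroup M]
    [Module B.K M] [FiniteDimensional B.K M] (Φ : M →ₛₗ[B.sigma (qOf τ)] M)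
    (hΦ : Function.Bijective Φ) (μ : ℚ) : slopeFiltration Φ μ = growth Φ μ := by
  apply le_antisymm
  · refine sSup_le ?_
    rintro N ⟨h, hN⟩ x hx
    have hbij : Function.Bijective h.restrict := by
      refine ⟨fun y z hyz => Subtype.ext (hΦ.1 (congrArg Subtype.val hyz)), fun y => ?_⟩
      obtain ⟨z, hz⟩ := hΦ.2 y
      exact ⟨⟨z, (h z).1 (by rw [hz]; exact y.2)⟩, Subtype.ext hz⟩
    obtain ⟨l, hl⟩ := exists_tri_ramify hτ h.restrict hbij
    obtain ⟨T, -, -⟩ := exists_sorted_triangularization hτ hbij hl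
    have hlpos : (0 : ℚ) < (l : ℕ) := by exact_mod_cast l.pos
    have h1 := T.le_growth (μ := l * μ) (Fin.last _) (fun j _ => by
      have := hN _ ⟨l, T, j, rfl⟩
      rw [le_div_iff₀ hlpos, mul_comm] at this
      exact this)
    rw [T.top] at h1
    have h2 := sectionModule_mem_growth
      (h1 (Submodule.mem_top (x := (1 : B.Ram l) ⊗ₜ[B.K] (⟨x, hx⟩ : N)))) 0
    rw [sectionModule_one_tmul] at h2
    exact map_mem_growth N.subtype (fun _ => rfl) h2
  · refine le_sSup ⟨isDiffSubmodule_growth μ, ?_⟩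
    set h := isDiffSubmodule_growth (Ψ := Φ) μ
    rintro ν ⟨l, T, i, rfl⟩
    have hlpos : (0 : ℚ) < (l : ℕ) := by exact_mod_cast l.pos
    have hall : ∀ y, y ∈ growth (ramify l h.restrict) (l * μ) := by
      intro y
      induction y with
      | zero => exact zero_mem _
      | add y z hy hz => exact add_mem hy hz
      | tmul a m =>
        have h1 : (1 : B.Ram l) ⊗ₜ[B.K] m ∈ growth (ramify l h.restrict) (l * μ) :=
          one_tmul_mem_growth (mem_growth_of_injective (growth Φ μ).subtype
            (growth Φ μ).injective_subtype (fun _ => rfl) m.2)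
        have h2 := Submodule.smul_mem _ a h1
        rwa [TensorProduct.smul_tmul', smul_eq_mul, mul_one] at h2
    obtain ⟨φ, hφ, hφe⟩ := T.exists_dual i
    have := le_ord_of_mem_growth (fun x hx => (T.isDiffSubmodule _ x).2 hx)
      (triangularization_a_ne_zero T i) (T.apply_e i) hφ hφe one_ne_zero
      (by rw [one_smul, sub_self]; exact zero_mem _) (hall (T.e i))
    rw [le_div_iff₀ hlpos, mul_comm]
    exact this

/-- Over `K_l`, the growth space is spanned by products `e i ⊗ e j` of large total slope. Each
factor is a combination of its sections with powers of `z_l` as coefficients, and these sections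
grow at rate `ord (a i) / l`. The products of sections thus lie in `S`, and
`mem_of_one_tmul_mem_span` descends to `K`. -/
theorem growth_tensor_le (hτ : 1 < ‖(qOf τ : ℂ)‖) {M₁ M₂ : Type*}
    [AddCommGroup M₁] [Module B.K M₁] [FiniteDimensional B.K M₁]
    [AddCommGroup M₂] [Module B.K M₂] [FiniteDimensional B.K M₂]
    {Φ₁ : M₁ →ₛₗ[B.sigma (qOf τ)] M₁} (hΦ₁ : Function.Bijective Φ₁)
    {Φ₂ : M₂ →ₛₗ[B.sigma (qOf τ)] M₂} (hΦ₂ : Function.Bijective Φ₂) {μ : ℚ}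
    {S : Submodule B.K (M₁ ⊗[B.K] M₂)}
    (hS : ∀ μ₁ μ₂ : ℚ, μ ≤ μ₁ + μ₂ → ∀ x ∈ growth Φ₁ μ₁, ∀ y ∈ growth Φ₂ μ₂, x ⊗ₜ[B.K] y ∈ S) :
    growth (TensorProduct.map Φ₁ Φ₂) μ ≤ S := by
  intro z hz
  obtain ⟨l, T₁, T₂, h1, h1', h2, h2'⟩ := exists_common_triangularization hτ hΦ₁ hΦ₂
  have hlpos : (0 : ℚ) < (l : ℕ) := by exact_mod_cast l.pos
  let δ := TensorProduct.AlgebraTensorModule.distribBaseChange B.K (B.Ram l) M₁ M₂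
  have hδ : ∀ (a : B.Ram l) (x : M₁) (y : M₂),
      δ (a ⊗ₜ (x ⊗ₜ y)) = (a ⊗ₜ x) ⊗ₜ[B.Ram l] ((1 : B.Ram l) ⊗ₜ y) := fun a x y =>
    TensorProduct.AlgebraTensorModule.distribBaseChange_tmul ..
  have hδcomm : ∀ w, δ (ramify l (TensorProduct.map Φ₁ Φ₂) w) =
      TensorProduct.map (ramify l Φ₁) (ramify l Φ₂) (δ w) := by
    intro w
    induction w with
    | zero => simp
    | add w w' hw hw' => simp only [map_add, hw, hw']
    | tmul a v =>
      induction v with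
      | zero => simp
      | add v v' hv hv' => simp only [TensorProduct.tmul_add, map_add, hv, hv']
      | tmul x y =>
        rw [hδ, TensorProduct.map_tmul]
        change δ (BaseField.Ram.sigma B l (qRoot τ l) a ⊗ₜ (Φ₁ x ⊗ₜ Φ₂ y)) =
          (BaseField.Ram.sigma B l (qRoot τ l) a ⊗ₜ Φ₁ x) ⊗ₜ
            (BaseField.Ram.sigma B l (qRoot τ l) 1 ⊗ₜ Φ₂ y)
        rw [hδ, map_one]
  let δ' : (B.Ram l ⊗[B.K] (M₁ ⊗[B.K] M₂)) →ₗ[B.Ram l]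
      ((B.Ram l ⊗[B.K] M₁) ⊗[B.Ram l] (B.Ram l ⊗[B.K] M₂)) := δ.toLinearMap
  have hz' : δ' ((1 : B.Ram l) ⊗ₜ z) ∈
      growth (TensorProduct.map (ramify l Φ₁) (ramify l Φ₂)) (l * μ) := by
    intro φ
    obtain ⟨C, hC⟩ := one_tmul_mem_growth (l := l) hz (φ ∘ₗ δ')
    refine ⟨C, fun n => ?_⟩
    have : (TensorProduct.map (ramify l Φ₁) (ramify l Φ₂))^[n] (δ' (1 ⊗ₜ z)) =
        δ' ((ramify l (TensorProduct.map Φ₁ Φ₂))^[n] (1 ⊗ₜ z)) :=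
      ((Function.Semiconj.iterate_right hδcomm n) _).symm
    rw [this]
    exact hC n
  have hspan := mem_span_of_mem_growth T₁ T₂ h1 h2 h1' h2' hz'
  refine mem_of_one_tmul_mem_span (l := l) ?_
  set P := Submodule.span (B.Ram l) ((fun w => (1 : B.Ram l) ⊗ₜ[B.K] w) '' (S : Set (M₁ ⊗[B.K] M₂)))
  suffices hle : Submodule.span (B.Ram l) {y | ∃ i j, (l * μ : ℚ) ≤ ord (T₁.a i) + ord (T₂.a j) ∧
      y = T₁.e i ⊗ₜ[B.Ram l] T₂.e j} ≤ P.map δ' by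
    obtain ⟨w, hw, hwz⟩ := hle hspan
    have : w = (1 : B.Ram l) ⊗ₜ z := δ.injective hwz
    rwa [this] at hw
  rw [Submodule.span_le]
  rintro _ ⟨i, j, hij, rfl⟩
  have e1 := T₁.e_mem_growth h1' i
  have e2 := T₂.e_mem_growth h2' j
  have hdiv : ∀ n : ℤ, (n : ℚ) = (l : ℕ) * ((n : ℚ) / (l : ℕ)) := fun n => by field_simp
  rw [hdiv] at e1 e2
  rw [← sum_sectionModule (T₁.e i), ← sum_sectionModule (T₂.e j), TensorProduct.sum_tmul]
  refine Submodule.sum_mem _ fun s _ => ?_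
  rw [TensorProduct.tmul_sum]
  refine Submodule.sum_mem _ fun t _ => ?_
  rw [TensorProduct.smul_tmul_smul, ← hδ]
  refine Submodule.smul_mem _ _ (Submodule.mem_map_of_mem (Submodule.subset_span ⟨_, ?_, rfl⟩))
  refine hS _ _ ?_ _ (sectionModule_mem_growth e1 s) _ (sectionModule_mem_growth e2 t)
  rw [← add_div, le_div_iff₀ hlpos, mul_comm]
  exact hij

theorem bijective_tensorMap {M₁ M₂ : Type*} [AddCommGroup M₁] [Module B.K M₁]
    [AddCommGroup M₂] [Module B.K M₂]
    {Φ₁ : M₁ →ₛₗ[B.sigma (qOf τ)] M₁} (hΦ₁ : Function.Bijective Φ₁)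
    {Φ₂ : M₂ →ₛₗ[B.sigma (qOf τ)] M₂} (hΦ₂ : Function.Bijective Φ₂) :
    Function.Bijective (TensorProduct.map Φ₁ Φ₂) := by
  obtain ⟨S₁, h1, h1'⟩ := exists_inverse Φ₁ hΦ₁
  obtain ⟨S₂, h2, h2'⟩ := exists_inverse Φ₂ hΦ₂
  refine Function.bijective_iff_has_inverse.2 ⟨TensorProduct.map S₁ S₂, fun x => ?_, fun x => ?_⟩
  · induction x with
    | zero => simp
    | add x y hx hy => rw [map_add, map_add, hx, hy]
    | tmul x y => rw [TensorProduct.map_tmul, TensorProduct.map_tmul, h1', h2']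
  · induction x with
    | zero => simp
    | add x y hx hy => rw [map_add, map_add, hx, hy]
    | tmul x y => rw [TensorProduct.map_tmul, TensorProduct.map_tmul, h1, h2]

end SlopeFiltration

end QDiff

end

theorem proposition3p2p4 (B : QDiff.BaseField) (τ : ℂ) (hτ : 1 < ‖(QDiff.qOf τ : ℂ)‖)
    {M₁ M₂ : Type*}
    [AddCommGroup M₁] [Module B.K M₁] [FiniteDimensional B.K M₁]
    [AddCommGroup M₂] [Module B.K M₂] [FiniteDimensional B.K M₂]
    (Φ₁ : M₁ →ₛₗ[B.sigma (QDiff.qOf τ)] M₁) (hΦ₁ : Function.Bijective Φ₁)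
    (Φ₂ : M₂ →ₛₗ[B.sigma (QDiff.qOf τ)] M₂) (hΦ₂ : Function.Bijective Φ₂) (μ : ℚ) :
    QDiff.slopeFiltration (TensorProduct.map Φ₁ Φ₂) μ =
      ⨆ (μ₁ : ℚ) (μ₂ : ℚ) (_ : μ ≤ μ₁ + μ₂),
        LinearMap.range (TensorProduct.mapIncl
          (QDiff.slopeFiltration Φ₁ μ₁) (QDiff.slopeFiltration Φ₂ μ₂)) := by
  -- With all filtrations replaced by growth spaces, one inclusion is the descent argument and the
  -- other the additivity of valuations.
  rw [QDiff.slopeFiltration_eq_growth hτ _ (QDiff.bijective_tensorMap hΦ₁ hΦ₂)]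
  rw [funext (QDiff.slopeFiltration_eq_growth hτ Φ₁ hΦ₁),
    funext (QDiff.slopeFiltration_eq_growth hτ Φ₂ hΦ₂)]
  apply le_antisymm
  · refine QDiff.growth_tensor_le hτ hΦ₁ hΦ₂ fun μ₁ μ₂ h x hx y hy => ?_
    refine Submodule.mem_iSup_of_mem μ₁ (Submodule.mem_iSup_of_mem μ₂
      (Submodule.mem_iSup_of_mem h ?_))
    exact ⟨(⟨x, hx⟩ : QDiff.growth Φ₁ μ₁) ⊗ₜ (⟨y, hy⟩ : QDiff.growth Φ₂ μ₂), rfl⟩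
  · refine iSup_le fun μ₁ => iSup_le fun μ₂ => iSup_le fun h => ?_
    rintro _ ⟨w, rfl⟩
    induction w with
    | zero => rw [map_zero]; exact zero_mem _
    | add w w' hw hw' => rw [map_add]; exact add_mem hw hw'
    | tmul x y => exact QDiff.growth_anti h (QDiff.tmul_mem_growth x.2 y.2)
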